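/- Let $R$ be a commutative Noetherian local ring with residue field $k$. Complexes of $R$-modules are indexed homologically; for a complex $Z$ put $\sup Z=\sup\{i\in\mathbb Z \mid H_i(Z)\neq 0\}$ (so $\sup Z=-\infty$ if $Z$ is acyclic), and call $Z$ homologically finite if every $H_i(Z)$ is a finitely generated $R$-module and $H_i(Z)=0$ for $|i|\gg 0$. For a complex $Z$ of $R$-modules put $\operatorname{depth}_R Z=-\sup \mathbf{R}\mathrm{Hom}_R(k,Z)$. A quasi-deformation of $R$ is a diagram $R\to R'\leftarrow Q$ of local homomorphisms of commutative Noetherian local rings in which $R\to R'$ is flat and $Q\to R'$ is surjective with kernel generated by a $Q$-regular sequence. For a homologically finite complex $X$ of $R$-modules, $$\operatorname{CI-dim}_R X=\inf\{\operatorname{pd}_Q (X\otimes_R R')-\operatorname{pd}_Q R' \mid R\to R'\leftarrow Q\ \text{is a quasi-deformation}\},$$ where $\operatorname{pd}_Q Z$ is the infimum, over all quasi-isomorphisms $P\to Z$ with $P$ a complex of projective $Q$-modules such that $P_i=0$ for $i\ll 0$, of $\sup\{i\mid P_i\neq 0\}$. **Proposition.** Let $X$ and $Y$ be homologically finite complexes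 of $R$-modules with $\operatorname{CI-dim}_R X<\infty$ and $\sup(X\otimes_R^{\mathbf L}Y)<\infty$. Then $$\operatorname{depth}_R(X\otimes_R^{\mathbf L}Y)=\operatorname{depth}_R Y-\operatorname{CI-dim}_R X ,$$ as an equality in $\mathbb Z\cup\{\pm\infty\}$. (All differences that occur are well defined; the values $\pm\infty$ occur only when $X$ or $Y$ is acyclic.) -/

import Mathlib

open CategoryTheory CategoryTheory.Limits

universe u

/-! Complexes of `R`-modules are Mathlib's `CochainComplex (ModuleCat R) ℤ`.  Homological and
cohomological indexing are related as usual by `X_i = X^{-i}` and `H_i(X) = H^{-i}(X)`. Values such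
as suprema, depths and homological dimensions lie in `EReal`, with `sup ∅ = ⊥` and `inf ∅ = ⊤`. -/

namespace CIDepth

noncomputable section

/-- `sup X = sup {i | H_i(X) ≠ 0}`, where `H_i(X) = H^{-i}(X)`. -/
def supH {C : Type*} [Category C] [Abelian C] (X : CochainComplex C ℤ) : EReal :=
  ⨆ (i : ℤ) (_ : ¬ IsZero (X.homology (-i))), ((i : ℝ) : EReal)

/-- `H_i(X) = 0` for `i ≪ 0`, that is, `H^j(X) = 0` for `j ≫ 0`. -/
def HomologicallyBoundedBelow {C : Type*} [Category C] [Abelian C]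
    (X : CochainComplex C ℤ) : Prop :=
  ∃ n : ℤ, X.IsLE n

/-- A projective resolution `π : P ⟶ X` of a complex `X`: a quasi-isomorphism from a complex `P` of
projective objects with `P_i = 0` for `i ≪ 0`. -/
structure ProjRes {C : Type*} [Category C] [Abelian C] (X : CochainComplex C ℤ) where
  P : CochainComplex C ℤ
  π : P ⟶ X
  quasiIso : QuasiIso π
  projective : ∀ i : ℤ, Projective (P.X i)
  bounded : ∃ n : ℤ, P.IsStrictlyLE n

/-- A morphism of complexes is a quasi-isomorphism if the opposite morphism of complexes in the
opposite category is. -/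
theorem quasiIso_of_op {C : Type*} [Category C] [Abelian C] {K L : CochainComplex C ℤ} (f : K ⟶ L)
    (h : QuasiIso ((CochainComplex.opEquivalence C).functor.map f.op)) : QuasiIso f := by
  rw [quasiIso_iff] at h ⊢
  intro j
  obtain ⟨m, rfl⟩ : ∃ m : ℤ, j = -m := ⟨-j, by simp⟩
  have hm := h m
  rw [quasiIsoAt_iff' _ (m - 1) m (m + 1) (by simp) (by simp)] at hm
  rw [quasiIsoAt_iff' _ (-(m + 1)) (-m) (-(m - 1)) (by simp; lia) (by simp; lia)]
  rw [← ShortComplex.quasiIso_opMap_iff]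
  exact hm

/-- Complexes whose homology is bounded below have projective resolutions. -/
theorem nonempty_projRes {C : Type*} [Category C] [Abelian C] [EnoughProjectives C]
    (X : CochainComplex C ℤ) (hX : HomologicallyBoundedBelow X) : Nonempty (ProjRes X) := by
  obtain ⟨n, hn⟩ := hX
  let E := CochainComplex.opEquivalence C
  let Y := X.truncLE n
  have hL : (E.functor.obj (Opposite.op Y)).IsStrictlyGE (-n) := by
    rw [CochainComplex.isStrictlyGE_iff]
    intro i hi
    exact (Y.isZero_of_isStrictlyLE n (-i) (by lia)).op
  obtain ⟨I, j, hj, hI, hIn⟩ :=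
    CochainComplex.Plus.modelCategoryQuillen.exists_quasiIso_injective
      (E.functor.obj (Opposite.op Y)) (-n)
  let g : Opposite.op Y ⟶ E.inverse.obj I := E.unit.app _ ≫ E.inverse.map j
  have hg : E.functor.map g = j ≫ E.counitInv.app I := by
    have h₁ : E.functor.map (E.unit.app (Opposite.op Y)) =
        E.counitInv.app (E.functor.obj (Opposite.op Y)) :=
      (E.counitInv_app_functor (Opposite.op Y)).symm
    have h₂ := E.counitInv.naturality j
    rw [Functor.map_comp, h₁]
    exact h₂.symm
  have hq : QuasiIso g.unop := by
    apply quasiIso_of_op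
    change QuasiIso (E.functor.map g)
    rw [hg]
    infer_instance
  refine ⟨⟨(E.inverse.obj I).unop, g.unop ≫ X.ιTruncLE n, inferInstance, fun i => ?_, n, ?_⟩⟩
  · have := hI (-i)
    change Projective (I.X (-i)).unop
    infer_instance
  · rw [CochainComplex.isStrictlyLE_iff]
    intro i hi
    exact (I.isZero_of_isStrictlyGE (-n) (-i) (by lia)).unop

/-- A chosen projective resolution. -/
def projRes {C : Type*} [Category C] [Abelian C] [EnoughProjectives C]
    (X : CochainComplex C ℤ) (hX : HomologicallyBoundedBelow X) : ProjRes X :=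
  (nonempty_projRes X hX).some

/-- `pd X = inf {sup {i | P_i ≠ 0} | P is a projective resolution of X}`. -/
def pd {C : Type*} [Category C] [Abelian C] (X : CochainComplex C ℤ) : EReal :=
  ⨅ P : ProjRes X, ⨆ (i : ℤ) (_ : ¬ IsZero (P.P.X (-i))), ((i : ℝ) : EReal)

section Ring

variable {R : Type u} [CommRing R]

/-- Homologically finite complexes: all `H_i(X)` are finitely generated, and `H_i(X) = 0` for
`|i| ≫ 0`. -/
structure HomologicallyFinite (X : CochainComplex (ModuleCat.{u} R) ℤ) : Prop where
  boundedBelow : HomologicallyBoundedBelow X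
  boundedAbove : ∃ n : ℤ, X.IsGE n
  finite : ∀ i : ℤ, Module.Finite R (X.homology i)

/-- The derived tensor product `X ⊗ᴸ Y`, computed by a projective resolution of `X`. -/
def derivedTensor (X : CochainComplex (ModuleCat.{u} R) ℤ) (hX : HomologicallyBoundedBelow X)
    (Y : CochainComplex (ModuleCat.{u} R) ℤ) : CochainComplex (ModuleCat.{u} R) ℤ :=
  HomologicalComplex.tensorObj (projRes X hX).P Y

/-- The derived homomorphism complex `RHom(X, Y)`, computed by a projective resolution of `X`
(as a complex of abelian groups). -/
def rHom (X : CochainComplex (ModuleCat.{u} R) ℤ) (hX : HomologicallyBoundedBelow X)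
    (Y : CochainComplex (ModuleCat.{u} R) ℤ) : CochainComplex AddCommGrpCat.{u} ℤ :=
  CochainComplex.HomComplex (projRes X hX).P Y

/-- A module, regarded as a complex concentrated in degree `0`. -/
abbrev moduleComplex (M : Type u) [AddCommGroup M] [Module R M] :
    CochainComplex (ModuleCat.{u} R) ℤ :=
  (CochainComplex.singleFunctor (ModuleCat.{u} R) 0).obj (ModuleCat.of R M)

theorem homologicallyBoundedBelow_moduleComplex (M : Type u) [AddCommGroup M] [Module R M] :
    HomologicallyBoundedBelow (moduleComplex (R := R) M) :=
  ⟨0, inferInstance⟩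

/-- `depth X = - sup RHom(k, X)` over a local ring with residue field `k`. -/
def depth [IsLocalRing R] (X : CochainComplex (ModuleCat.{u} R) ℤ) : EReal :=
  - supH (rHom (moduleComplex (R := R) (IsLocalRing.ResidueField R))
      (homologicallyBoundedBelow_moduleComplex _) X)

/-- A quasi-deformation `R → R' ← Q` of `R`: local homomorphisms of Noetherian local rings, the
first flat, the second surjective with kernel generated by a `Q`-regular sequence. -/
structure QuasiDeformation (R : Type u) [CommRing R] where
  R' : Type u
  Q : Type u
  [commRing : CommRing R']
  [commRingQ : CommRing Q]
  [noetherian : IsNoetherianRing R']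
  [noetherianQ : IsNoetherianRing Q]
  [isLocalRing : IsLocalRing R']
  [isLocalRingQ : IsLocalRing Q]
  f : R →+* R'
  g : Q →+* R'
  isLocalHom : IsLocalHom f
  isLocalHomQ : IsLocalHom g
  flat : f.Flat
  surjective : Function.Surjective g
  ker : ∃ rs : List Q, RingTheory.Sequence.IsRegular Q rs ∧ RingHom.ker g = Ideal.ofList rs

attribute [instance] QuasiDeformation.commRing QuasiDeformation.commRingQ
  QuasiDeformation.noetherian QuasiDeformation.noetherianQ
  QuasiDeformation.isLocalRing QuasiDeformation.isLocalRingQ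

/-- `X' = X ⊗_R R'`, regarded as a complex of `Q`-modules by restriction along `Q → R'`. -/
def QuasiDeformation.baseChange (D : QuasiDeformation R)
    (X : CochainComplex (ModuleCat.{u} R) ℤ) : CochainComplex (ModuleCat.{u} D.Q) ℤ :=
  ((ModuleCat.restrictScalars D.g).mapHomologicalComplex _).obj
    (((ModuleCat.extendScalars D.f).mapHomologicalComplex _).obj X)

/-- `R'`, regarded as a complex of `Q`-modules concentrated in degree `0`. -/
def QuasiDeformation.ringComplex (D : QuasiDeformation R) :
    CochainComplex (ModuleCat.{u} D.Q) ℤ :=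
  (CochainComplex.singleFunctor (ModuleCat.{u} D.Q) 0).obj
    ((ModuleCat.restrictScalars D.g).obj (ModuleCat.of D.R' D.R'))

/-- The complete intersection dimension
`CI-dim X = inf {pd_Q X' - pd_Q R' | R → R' ← Q is a quasi-deformation}`. -/
def ciDim (X : CochainComplex (ModuleCat.{u} R) ℤ) : EReal :=
  ⨅ D : QuasiDeformation R, (pd (D.baseChange X) - pd D.ringComplex)

end Ring

end

end CIDepth

/-! Write s(Z) for `supE Z`, the negative of the depth of Z. The claim becomes s(X ⊗ᴸ Y) = s(Y) +
CI-dim X. It is proved for each quasi-deformation R → R' ← Q with pd_Q X' < ∞ separately, with pd_Q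
X' - pd_Q R' in place of CI-dim X (`pd_baseChange`). Since X ⊗ᴸ Y and Y do not depend on the
quasi-deformation, all these differences coincide once s(Y) is finite, and the infimum is their
common value. Infinite values are treated by hand.

For one quasi-deformation let X', Y' be the base changes to R' and c the length of the regular
sequence. Four facts are combined. (1) s_R(Y) = s_R'(Y') + e, where e is the depth of the closed
fibre of R → R'. The same e serves for X ⊗ᴸ Y, so it cancels (`exists_supE_extendScalars`). (2)
s_Q(Y') = s_R'(Y') for the surjection Q → R' (`supE_restrictScalars`). (3) s_Q(X' ⊗ᴸ_Q Y') = s_R'(X'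
⊗ᴸ_R' Y') + c (`supE_tensorObj_restrictScalars`). For c = 1, a Q-projective resolution G of Y' gives
a triangle with ends Y'[1] and Y' around R' ⊗_Q G, and tensoring with X' raises s by one. The
general case is by induction. (4) s_Q(X' ⊗ᴸ_Q Y') = s_Q(Y') + pd_Q X', the Auslander–Buchsbaum
formula (`supE_tensorObj`). Applied to R' and its residue field instead of X' and Y', facts (2)–(4)
also give pd_Q R' = c (`pd_restrictScalars_self`).

Facts (1), (2) and (4) rest on Koszul complexes, built as iterated cones of multiplications. An
element of the maximal ideal kills k, so each cone raises s by exactly one. After all generators of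
the maximal ideal have been used, the homology is a k-vector space, and s is the top homological
degree of nonzero homology (`supE_koszul`). In (4) this leaves one thing to check: a nonzero socle
element v in the last degree of a complex, and an element a in the last degree of a projective
complex with a ∉ 𝔪L and da ∈ 𝔪L, give a nonzero socle cycle a ⊗ v in the last degree of the tensor
product. Such an a exists exactly because the projective complex cannot be shortened
(`exists_minimal_model`). -/

open Pretriangulated Opposite
attribute [local instance] HasDerivedCategory.standard

/-! ### Ext from the residue field and cones of multiplications -/

namespace CIDepth
noncomputable section

section EReal

/-- Mutual domination up to the shift `c` suffices, so the sets need not be translates of each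
other. Empty and unbounded sets are covered. -/
lemma supSet_add (S T : Set ℤ) (c : ℤ) (h : ∀ i, i ∈ T → ∃ j ∈ S, i ≤ j + c)
    (h' : ∀ i ∈ S, ∃ j ∈ T, i + c ≤ j) :
    (⨆ (i : ℤ) (_ : i ∈ T), ((i : ℝ) : EReal)) = (⨆ (i : ℤ) (_ : i ∈ S), ((i : ℝ) : EReal)) +
      ((c : ℝ) : EReal) := by
  apply le_antisymm
  · refine iSup₂_le fun i hi => ?_
    obtain ⟨j, hj, hij⟩ := h i hi
    have h1 : ((i : ℝ) : EReal) ≤ ((j : ℝ) : EReal) + ((c : ℝ) : EReal) := by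
      rw [← EReal.coe_add]
      exact_mod_cast hij
    refine h1.trans ?_
    gcongr
    exact le_iSup₂_of_le (f := fun (i : ℤ) (_ : i ∈ S) => ((i : ℝ) : EReal)) j hj le_rfl
  · rw [← EReal.le_sub_iff_add_le (by simp) (by simp)]
    refine iSup₂_le fun i hi => ?_
    obtain ⟨j, hj, hij⟩ := h' i hi
    rw [EReal.le_sub_iff_add_le (by simp) (by simp), ← EReal.coe_add]
    refine le_trans ?_ (le_iSup₂_of_le j hj le_rfl)
    exact_mod_cast hij

end EReal

variable {R : Type u} [CommRing R]

/-- The derived category of `R`-modules. -/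
abbrev D (R : Type u) [CommRing R] := DerivedCategory (ModuleCat.{u} R)

/-- The localization functor from complexes to the derived category. -/
abbrev toD (R : Type u) [CommRing R] : CochainComplex (ModuleCat.{u} R) ℤ ⥤ D R :=
  DerivedCategory.Q

/-- The homology functor on the derived category. -/
abbrev hD (R : Type u) [CommRing R] (n : ℤ) : D R ⥤ ModuleCat.{u} R :=
  DerivedCategory.homologyFunctor (ModuleCat.{u} R) n

/-- `W` is a cone of the multiplication by `x` on `Z`. -/
def IsConeMul (x : R) (Z W : D R) : Prop :=
  ∃ (g : Z ⟶ W) (h : W ⟶ Z⟦(1 : ℤ)⟧), Triangle.mk (x • 𝟙 Z) g h ∈ distTriang (D R)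

/-- `V` is obtained from `Z` by successively taking cones of multiplications by elements
of a list. -/
inductive IsKoszul : List R → D R → D R → Prop
  | nil {Z V : D R} (e : Z ≅ V) : IsKoszul [] Z V
  | cons {x : R} {xs : List R} {Z W V : D R} (h : IsConeMul x Z W) (h' : IsKoszul xs W V) :
      IsKoszul (x :: xs) Z V

section Local

variable [IsLocalRing R]

/-- The residue field as an object of the derived category. -/
def resD (R : Type u) [CommRing R] [IsLocalRing R] : D R :=
  (DerivedCategory.singleFunctor (ModuleCat.{u} R) 0).obj
    (ModuleCat.of R (IsLocalRing.ResidueField R))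

/-- The functor of morphisms from the residue field. -/
abbrev homRes (R : Type u) [CommRing R] [IsLocalRing R] : D R ⥤ AddCommGrpCat.{u + 1} :=
  preadditiveCoyoneda.obj (op (resD R))

/-- `Ext^n(k, Z)`. -/
def extk (Z : D R) (n : ℤ) : AddCommGrpCat.{u + 1} := ((homRes R).shift n).obj Z

lemma isZero_extk_iff (Z : D R) (n : ℤ) :
    IsZero (extk Z n) ↔ ∀ f : resD R ⟶ Z⟦n⟧, f = 0 := by
  rw [AddCommGrpCat.isZero_iff_subsingleton]
  exact ⟨fun h f => h.elim (α := resD R ⟶ Z⟦n⟧) f 0,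
    fun h => ⟨fun a b => (h a).trans (h b).symm⟩⟩

lemma isZero_extk_iff_of_iso {Z W : D R} (e : Z ≅ W) (n : ℤ) :
    IsZero (extk Z n) ↔ IsZero (extk W n) :=
  (((homRes R).shift n).mapIso e).isZero_iff

/-- `sup RHom(k, Z)`. -/
def supE (Z : D R) : EReal := ⨆ (i : ℤ) (_ : ¬ IsZero (extk Z (-i))), ((i : ℝ) : EReal)

lemma supE_congr {Z W : D R} (e : Z ≅ W) : supE Z = supE W := by
  unfold supE
  simp only [isZero_extk_iff_of_iso e]

lemma smul_resD {x : R} (hx : x ∈ IsLocalRing.maximalIdeal R) : x • 𝟙 (resD R) = 0 := by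
  have : x • 𝟙 (ModuleCat.of R (IsLocalRing.ResidueField R)) = 0 := by
    ext m
    change x • m = 0
    rw [Algebra.smul_def, IsLocalRing.ResidueField.algebraMap_eq,
      (IsLocalRing.residue_eq_zero_iff x).2 hx, zero_mul]
  unfold resD
  rw [← CategoryTheory.Functor.map_id, ← CategoryTheory.Functor.map_smul, this,
    CategoryTheory.Functor.map_zero]

lemma homRes_shift_map_smul {x : R} (hx : x ∈ IsLocalRing.maximalIdeal R) (Z : D R) (n : ℤ) :
    ((homRes R).shift n).map (x • 𝟙 Z) = 0 := by
  ext (f : resD R ⟶ Z⟦n⟧)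
  change f ≫ (x • 𝟙 Z)⟦n⟧' = 0
  rw [CategoryTheory.Functor.map_smul, CategoryTheory.Functor.map_id, Linear.comp_smul, Category.comp_id,
    ← Category.id_comp f, ← Linear.smul_comp, smul_resD hx, zero_comp]

/-- Since x kills k, it acts as zero on Ext(k, Z), and the long exact sequence of the cone breaks
into short ones 0 → Extⁿ(k, Z) → Extⁿ(k, W) → Extⁿ⁺¹(k, Z) → 0. -/
lemma IsConeMul.isZero_extk_iff {x : R} (hx : x ∈ IsLocalRing.maximalIdeal R) {Z W : D R}
    (h : IsConeMul x Z W) (n₀ n₁ : ℤ) (hn : n₀ + 1 = n₁) :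
    IsZero (extk W n₀) ↔ IsZero (extk Z n₀) ∧ IsZero (extk Z n₁) := by
  obtain ⟨g, h, hT⟩ := h
  have h₂ := (homRes R).homologySequence_exact₂ _ hT n₀
  have h₃ := (homRes R).homologySequence_exact₃ _ hT n₀ n₁ hn
  have h₁ := (homRes R).homologySequence_exact₁ _ hT n₀ n₁ hn
  constructor
  · intro hW
    exact ⟨h₂.isZero_of_both_zeros (homRes_shift_map_smul hx Z n₀) (hW.eq_of_tgt _ _),
      h₁.isZero_of_both_zeros (hW.eq_of_src _ _) (homRes_shift_map_smul hx Z n₁)⟩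
  · rintro ⟨h0, h1⟩
    exact h₃.isZero_of_both_zeros (h0.eq_of_src _ _) (h1.eq_of_tgt _ _)

lemma IsConeMul.supE_eq {x : R} (hx : x ∈ IsLocalRing.maximalIdeal R) {Z W : D R}
    (h : IsConeMul x Z W) : supE W = supE Z + 1 := by
  have := supSet_add {i | ¬ IsZero (extk Z (-i))} {i | ¬ IsZero (extk W (-i))} 1 ?_ ?_
  · simpa [supE] using this
  · intro i hi
    simp only [Set.mem_ofPred_eq, h.isZero_extk_iff hx (-i) (-(i - 1)) (by lia), not_and_or] at hi
    rcases hi with hi | hi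
    exacts [⟨i, hi, by lia⟩, ⟨i - 1, hi, by lia⟩]
  · intro i hi
    refine ⟨i + 1, ?_, le_rfl⟩
    simp only [Set.mem_ofPred_eq, h.isZero_extk_iff hx (-(i + 1)) (-i) (by lia), not_and_or]
    exact Or.inr hi

lemma IsKoszul.supE_eq {xs : List R} {Z V : D R} (h : IsKoszul xs Z V)
    (hxs : ∀ x ∈ xs, x ∈ IsLocalRing.maximalIdeal R) :
    supE V = supE Z + ((xs.length : ℝ) : EReal) := by
  induction h with
  | nil e => simp [supE_congr e]
  | cons h h' ih =>
    simp only [List.mem_cons, forall_eq_or_imp] at hxs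
    rw [ih hxs.2, h.supE_eq hxs.1, List.length_cons, add_assoc]
    congr 1
    norm_cast
    rw [add_comm]

lemma isZero_extk_of_lt {Z : D R} {j : ℤ} (hZ : Z.IsGE j) {i : ℤ} (hi : i < j) :
    IsZero (extk Z i) := by
  rw [isZero_extk_iff]
  intro f
  have h0 : (resD R).IsLE 0 := by unfold resD; infer_instance
  have h1 : (Z⟦i⟧).IsGE (j - i) :=
    DerivedCategory.TStructure.t.isGE_shift Z j i (j - i) (by lia)
  exact DerivedCategory.TStructure.t.zero f 0 (j - i) (by lia)

lemma supE_le_of_isGE {Z : D R} {j : ℤ} (hZ : Z.IsGE (-j)) : supE Z ≤ ((j : ℝ) : EReal) := by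
  refine iSup₂_le fun i hi => ?_
  by_contra h
  refine hi (isZero_extk_of_lt hZ ?_)
  simp only [EReal.coe_le_coe_iff, Int.cast_le, not_le] at h
  lia

/-- A module map out of the residue field picking an element of the socle. -/
def socleMap {M : ModuleCat.{u} R} (m : M) (hm : ∀ x ∈ IsLocalRing.maximalIdeal R, x • m = 0) :
    ModuleCat.of R (IsLocalRing.ResidueField R) ⟶ M :=
  ModuleCat.ofHom ((IsLocalRing.maximalIdeal R).liftQ (LinearMap.toSpanSingleton R M m)
    (fun x hx => LinearMap.mem_ker.2 (hm x hx)))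

lemma socleMap_ne_zero {M : ModuleCat.{u} R} {m : M}
    (hm : ∀ x ∈ IsLocalRing.maximalIdeal R, x • m = 0) (h0 : m ≠ 0) : socleMap m hm ≠ 0 := by
  intro h
  have := ConcreteCategory.congr_hom h (Submodule.Quotient.mk (1 : R))
  have h1 : (1 : R) • m = 0 := this
  exact h0 (by rwa [one_smul] at h1)

/-- The truncation of `Z` to degrees ≤ j is a module placed in degree j, because `Z` has no
cohomology below j. A socle element is a nonzero map from k to that module, and the composite to `Z`
stays nonzero because it can be detected on H^j. -/
lemma not_isZero_extk {Z : D R} {j : ℤ} (hZ : Z.IsGE j) {m : (hD R j).obj Z} (h0 : m ≠ 0)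
    (hm : ∀ x ∈ IsLocalRing.maximalIdeal R, x • m = 0) : ¬ IsZero (extk Z j) := by
  obtain ⟨A, B, hA, hB, a, b, c, hT⟩ :=
    DerivedCategory.TStructure.t.exists_triangle Z j (j + 1) rfl
  have : A.IsLE j := ⟨hA⟩
  have : B.IsGE (j + 1) := ⟨hB⟩
  have : A.IsGE j := by
    rw [DerivedCategory.isGE_iff]
    intro i hi
    refine (DerivedCategory.HomologySequence.exact₁ _ hT (i - 1) i (by lia)).isZero_of_both_zeros
      ?_ ?_
    · exact (B.isZero_of_isGE (j + 1) (i - 1) (by lia)).eq_of_src _ _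
    · exact (Z.isZero_of_isGE j i (by lia)).eq_of_tgt _ _
  obtain ⟨Y, ⟨e⟩⟩ := DerivedCategory.exists_iso_singleFunctor_obj_of_isGE_of_isLE A j
  have : Mono ((hD R j).map a) := 
    (DerivedCategory.HomologySequence.exact₁ _ hT (j - 1) j (by lia)).mono_g
      ((B.isZero_of_isGE (j + 1) (j - 1) (by lia)).eq_of_src _ _)
  have : Epi ((hD R j).map a) := 
    (DerivedCategory.HomologySequence.exact₂ _ hT j).epi_f
      ((B.isZero_of_isGE (j + 1) j (by lia)).eq_of_tgt _ _)
  have := isIso_of_mono_of_epi ((hD R j).map a)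
  let eY : Y ≅ (hD R j).obj Z :=
    (DerivedCategory.singleFunctorCompHomologyFunctorIso (ModuleCat.{u} R) j).symm.app Y ≪≫
      (hD R j).mapIso e.symm ≪≫ asIso ((hD R j).map a)
  let φ := socleMap m hm ≫ eY.inv
  have hφ : φ ≠ 0 := fun h => socleMap_ne_zero hm h0 (by
    rw [← cancel_mono eY.inv, zero_comp]; exact h)
  have : (DerivedCategory.singleFunctor (ModuleCat.{u} R) j ⋙ hD R j).Faithful :=
    Functor.Faithful.of_iso
      (DerivedCategory.singleFunctorCompHomologyFunctorIso (ModuleCat.{u} R) j).symm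
  let ψ := (DerivedCategory.singleFunctor (ModuleCat.{u} R) j).map φ ≫ e.inv ≫ a
  have hψ : ψ ≠ 0 := by
    intro h
    apply hφ
    apply (DerivedCategory.singleFunctor (ModuleCat.{u} R) j ⋙ hD R j).map_injective
    have h' := congr_arg (hD R j).map h
    simp only [ψ, Functor.map_comp, Functor.map_zero] at h'
    rw [← Category.assoc, ← cancel_mono (inv ((hD R j).map a)), Category.assoc, IsIso.hom_inv_id,
      zero_comp, Category.comp_id, ← cancel_mono ((hD R j).map e.hom), Category.assoc,
      ← Functor.map_comp, e.inv_hom_id, CategoryTheory.Functor.map_id, zero_comp,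
      Category.comp_id] at h'
    rw [Functor.comp_map, h', CategoryTheory.Functor.map_zero]
  rw [isZero_extk_iff]
  intro h
  let s := ((DerivedCategory.singleFunctors (ModuleCat.{u} R)).shiftIso j 0 j (by lia)).app
    (ModuleCat.of R (IsLocalRing.ResidueField R))
  have := h (s.inv ≫ ψ⟦j⟧')
  apply hψ
  apply (shiftFunctor (D R) j).map_injective
  rw [← cancel_epi s.inv, CategoryTheory.Functor.map_zero, comp_zero]
  exact this

/-- A bounded above complex of projectives is K-projective, so homotopy classes of maps out of it
are morphisms in the derived category. -/
lemma isZero_rHom_homology_iff (X : CochainComplex (ModuleCat.{u} R) ℤ) (n : ℤ) :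
    IsZero ((rHom (moduleComplex (R := R) (IsLocalRing.ResidueField R))
      (homologicallyBoundedBelow_moduleComplex _) X).homology n) ↔
    IsZero (extk ((toD R).obj X) n) := by
  rw [AddCommGrpCat.isZero_iff_subsingleton, AddCommGrpCat.isZero_iff_subsingleton]
  let P := projRes (moduleComplex (R := R) (IsLocalRing.ResidueField R))
    (homologicallyBoundedBelow_moduleComplex _)
  have := P.projective
  have := P.quasiIso
  obtain ⟨d, hd⟩ := P.bounded
  have := CochainComplex.isKProjective_of_projective P.P d
  refine Equiv.subsingleton_congr ((CochainComplex.HomComplex.homologyAddEquiv P.P X n).toEquiv.trans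
    (CochainComplex.HomComplex.CohomologyClass.homAddEquiv.toEquiv.trans
    ((Equiv.ofBijective _ (CochainComplex.IsKProjective.Qh_map_bijective P.P _)).trans
    (Iso.homCongr ((DerivedCategory.quotientCompQhIso _).app P.P ≪≫ asIso ((toD R).map P.π) ≪≫
      ((DerivedCategory.singleFunctorIsoCompQ (ModuleCat.{u} R) 0).symm.app _))
      ((DerivedCategory.quotientCompQhIso _).app _ ≪≫ ((toD R).commShiftIso n).app X)))))

lemma depth_eq (X : CochainComplex (ModuleCat.{u} R) ℤ) :
    depth X = - supE ((toD R).obj X) := by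
  simp only [depth, supH, supE, isZero_rHom_homology_iff]

end Local

end

end CIDepth

/-! ### Koszul complexes and homology annihilated by the maximal ideal -/

namespace CIDepth
noncomputable section

lemma cochain_ofHom_smul {S C : Type*} [Ring S] [Category C] [Preadditive C]
    [Linear S C] {K L : CochainComplex C ℤ} (φ : K ⟶ L) (y : S) :
    CochainComplex.HomComplex.Cochain.ofHom (y • φ) =
      y • CochainComplex.HomComplex.Cochain.ofHom φ := by
  ext p
  simp

open CochainComplex HomComplex in
/-- Multiplication by `y` is null-homotopic on the cone of the multiplication by `y`. -/
lemma nonempty_homotopy_smul_mappingCone_self {S C : Type*} [Ring S] [Category C] [Preadditive C]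
    [Linear S C] [HasBinaryBiproducts C] (W : CochainComplex C ℤ) (y : S) :
    Nonempty (Homotopy (y • 𝟙 (mappingCone (y • 𝟙 W))) 0) := by
  -- The homotopy sends the copy of `W` in the cone identically to the shifted copy and is zero on
  -- the latter.
  refine ⟨(Cochain.equivHomotopy _ _).symm ⟨(mappingCone.snd (y • 𝟙 W)).comp
    (mappingCone.inl (y • 𝟙 W)) (zero_add _), ?_⟩⟩
  rw [δ_zero_cochain_comp _ _ 0 (by lia), mappingCone.δ_inl, mappingCone.δ_snd]
  simp only [Linear.smul_comp, cochain_ofHom_smul, Category.id_comp, Cochain.ofHom_zero, add_zero,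
    Cochain.comp_smul, Cochain.comp_id, Cochain.neg_comp, Cochain.smul_comp,
    Int.negOnePow_neg, Int.negOnePow_one, Units.neg_smul, one_smul, neg_neg]
  rw [← smul_add, add_comm, mappingCone.id]

open CochainComplex HomComplex in
/-- If multiplication by `x` is null-homotopic on `W`, it is null-homotopic on the cones of
multiplications on `W`. -/
lemma nonempty_homotopy_smul_mappingCone {S C : Type*} [Ring S] [Category C] [Preadditive C]
    [Linear S C] [HasBinaryBiproducts C] (W : CochainComplex C ℤ) (x y : S)
    (h : Nonempty (Homotopy (x • 𝟙 W) 0)) :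
    Nonempty (Homotopy (x • 𝟙 (mappingCone (y • 𝟙 W))) 0) := by
  obtain ⟨h⟩ := h
  obtain ⟨h, hh⟩ := Cochain.equivHomotopy _ _ h
  rw [Cochain.ofHom_zero, add_zero, cochain_ofHom_smul] at hh
  -- The homotopy is `h` on the unshifted copy of `W` and `-h` on the shifted one. The cross terms
  -- coming from y cancel because h commutes with scalars.
  refine ⟨(Cochain.equivHomotopy _ _).symm
    ⟨(mappingCone.snd (y • 𝟙 W)).comp (h.comp (Cochain.ofHom (mappingCone.inr (y • 𝟙 W)))
      (add_zero _)) (zero_add _) -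
      (mappingCone.fst (y • 𝟙 W)).1.comp (h.comp (mappingCone.inl (y • 𝟙 W)) (n₁₂ := -2) (by lia))
        (by lia), ?_⟩⟩
  rw [δ_sub, δ_zero_cochain_comp _ _ 0 (by lia), δ_comp_zero_cochain _ _ 0 (by lia),
    δ_comp (mappingCone.fst (y • 𝟙 W)).1 _ (by lia) 2 (-1) 0 (by lia) (by lia) (by lia),
    δ_comp h _ _ 0 0 (-1) (by lia) (by lia) (by lia), mappingCone.δ_inl, mappingCone.δ_snd, ← hh]
  simp only [Linear.smul_comp, cochain_ofHom_smul, Category.id_comp, Cochain.ofHom_zero, add_zero,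
    Cochain.comp_smul, Cochain.comp_id, Cochain.neg_comp, Cochain.smul_comp, Cochain.id_comp,
    Int.negOnePow_neg, Int.negOnePow_one, Units.neg_smul, one_smul, neg_neg, δ_ofHom,
    Cocycle.δ_eq_zero, Cochain.zero_comp, Cochain.comp_zero, smul_zero, zero_add,
    Cochain.comp_add, Cochain.comp_neg]
  rw [← mappingCone.id, smul_add]
  abel

variable {R : Type u} [CommRing R]

lemma homologyMap_smul_id (W : CochainComplex (ModuleCat.{u} R) ℤ) (x : R) (i : ℤ)
    (m : W.homology i) :
    HomologicalComplex.homologyMap (x • 𝟙 W) i m = x • m := by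
  have : HomologicalComplex.homologyMap (x • 𝟙 W) i = x • 𝟙 _ := by
    change ShortComplex.homologyMap (x • 𝟙 (W.sc i)) = _
    rw [ShortComplex.homologyMap_smul, ShortComplex.homologyMap_id]
    rfl
  rw [this]
  rfl

lemma smul_homology_eq_zero (W : CochainComplex (ModuleCat.{u} R) ℤ) (x : R)
    (h : Nonempty (Homotopy (x • 𝟙 W) 0)) (i : ℤ) (m : W.homology i) : x • m = 0 := by
  obtain ⟨h⟩ := h
  rw [← homologyMap_smul_id, h.homologyMap_eq, HomologicalComplex.homologyMap_zero]
  rfl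

/-- The cone of the multiplication by `x`. -/
abbrev coneMul (x : R) (W : CochainComplex (ModuleCat.{u} R) ℤ) :
    CochainComplex (ModuleCat.{u} R) ℤ :=
  CochainComplex.mappingCone (x • 𝟙 W)

lemma isConeMul_coneMul (x : R) (W : CochainComplex (ModuleCat.{u} R) ℤ) :
    IsConeMul x ((toD R).obj W) ((toD R).obj (coneMul x W)) := by
  have := DerivedCategory.mappingCone_triangle_distinguished (x • 𝟙 W)
  have e : (toD R).map (x • 𝟙 W) = x • 𝟙 ((toD R).obj W) := by
    rw [Functor.map_smul, CategoryTheory.Functor.map_id]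
  refine ⟨(DerivedCategory.Q.mapTriangle.obj (CochainComplex.mappingCone.triangle (x • 𝟙 W))).mor₂,
    (DerivedCategory.Q.mapTriangle.obj (CochainComplex.mappingCone.triangle (x • 𝟙 W))).mor₃, ?_⟩
  rw [← e]
  exact this

/-- The iterated cone of multiplications. -/
def koszul : List R → CochainComplex (ModuleCat.{u} R) ℤ → CochainComplex (ModuleCat.{u} R) ℤ
  | [], W => W
  | x :: xs, W => koszul xs (coneMul x W)

lemma isKoszul_koszul (xs : List R) (W : CochainComplex (ModuleCat.{u} R) ℤ) :
    IsKoszul xs ((toD R).obj W) ((toD R).obj (koszul xs W)) := by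
  induction xs generalizing W with
  | nil => exact .nil (Iso.refl _)
  | cons x xs ih => exact .cons (isConeMul_coneMul x W) (ih _)

lemma koszul_homotopy (xs : List R) (W : CochainComplex (ModuleCat.{u} R) ℤ) (x : R)
    (h : Nonempty (Homotopy (x • 𝟙 W) 0)) : Nonempty (Homotopy (x • 𝟙 (koszul xs W)) 0) := by
  induction xs generalizing W with
  | nil => exact h
  | cons y xs ih => exact ih _ (nonempty_homotopy_smul_mappingCone W x y h)

lemma koszul_homotopy_of_mem (xs : List R) (W : CochainComplex (ModuleCat.{u} R) ℤ) (x : R)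
    (hx : x ∈ xs) : Nonempty (Homotopy (x • 𝟙 (koszul xs W)) 0) := by
  induction xs generalizing W with
  | nil => simp at hx
  | cons y xs ih =>
    obtain rfl | hx := List.mem_cons.1 hx
    · exact koszul_homotopy xs _ x (nonempty_homotopy_smul_mappingCone_self W x)
    · exact ih _ hx

/-- Each listed generator acts null-homotopically, hence as zero on homology, and the annihilator of
a module is an ideal. -/
lemma smul_koszul_homology (xs : List R) (W : CochainComplex (ModuleCat.{u} R) ℤ) (x : R)
    (hx : x ∈ Ideal.ofList xs) (i : ℤ) (m : (koszul xs W).homology i) : x • m = 0 := by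
  refine Submodule.span_induction (p := fun x _ => x • m = 0) ?_ (zero_smul _ _) ?_ ?_ hx
  · intro x hx
    exact smul_homology_eq_zero _ x (koszul_homotopy_of_mem xs W x hx) i m
  · intro x y _ _ h1 h2
    rw [add_smul, h1, h2, add_zero]
  · intro a x _ h
    rw [smul_assoc, h, smul_zero]

lemma isConeMul_of_distinguished {x : R} {Z W : D R} {f : Z ⟶ Z} (hf : f = x • 𝟙 Z) {g : Z ⟶ W}
    {h : W ⟶ Z⟦(1 : ℤ)⟧} (hT : Triangle.mk f g h ∈ distTriang (D R)) : IsConeMul x Z W :=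
  ⟨g, h, hf ▸ hT⟩

lemma IsConeMul.of_iso {x : R} {Z W Z' W' : D R} (h : IsConeMul x Z W) (e : Z ≅ Z') (e' : W ≅ W') :
    IsConeMul x Z' W' := by
  obtain ⟨g, h, hT⟩ := h
  refine ⟨e.inv ≫ g ≫ e'.hom, e'.inv ≫ h ≫ e.hom⟦1⟧', isomorphic_distinguished _ hT _ ?_⟩
  refine Triangle.isoMk _ _ e.symm e.symm e'.symm ?_ ?_ ?_
  · change (x • 𝟙 Z') ≫ e.inv = e.inv ≫ (x • 𝟙 Z)
    rw [Linear.smul_comp, Linear.comp_smul, Category.id_comp, Category.comp_id]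
  · change (e.inv ≫ g ≫ e'.hom) ≫ e'.inv = e.inv ≫ g
    rw [Category.assoc, Category.assoc, Iso.hom_inv_id, Category.comp_id]
  · change (e'.inv ≫ h ≫ e.hom⟦1⟧') ≫ e.inv⟦1⟧' = e'.inv ≫ h
    rw [Category.assoc, Category.assoc, ← Functor.map_comp, Iso.hom_inv_id,
      CategoryTheory.Functor.map_id, Category.comp_id]

lemma IsKoszul.of_iso {xs : List R} {Z V Z' V' : D R} (h : IsKoszul xs Z V) (e : Z ≅ Z')
    (e' : V ≅ V') : IsKoszul xs Z' V' := by
  induction h generalizing Z' V' with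
  | nil e₀ => exact .nil (e.symm ≪≫ e₀ ≪≫ e')
  | cons h _ ih => exact .cons (h.of_iso e (Iso.refl _)) (ih (Iso.refl _) e')

/-- No additivity of `φ` is used. It may be a ring homomorphism, for extension of scalars, or a
set-theoretic section of a surjection, for restriction. -/
lemma IsKoszul.map {S : Type u} [CommRing S] (φ : R → S) (G : D R ⥤ D S)
    (hG : ∀ (x : R) (Z W : D R), IsConeMul x Z W → IsConeMul (φ x) (G.obj Z) (G.obj W))
    {xs : List R} {Z V : D R} (h : IsKoszul xs Z V) :
    IsKoszul (xs.map φ) (G.obj Z) (G.obj V) := by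
  induction h with
  | nil e => exact .nil (G.mapIso e)
  | cons h _ ih => exact .cons (hG _ _ _ h) ih

section ExactFunctor

variable {S : Type u} [CommRing S] (φ : R → S) (F : ModuleCat.{u} R ⥤ ModuleCat.{u} S) [F.Additive]
  [PreservesFiniteLimits F] [PreservesFiniteColimits F]
  (hF : ∀ (x : R) (M : ModuleCat.{u} R), F.map (x • 𝟙 M) = φ x • 𝟙 (F.obj M))

include hF in
lemma mapDerivedCategory_map_smul (x : R) (Z : D R) :
    F.mapDerivedCategory.map (x • 𝟙 Z) = φ x • 𝟙 (F.mapDerivedCategory.obj Z) := by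
  obtain ⟨K, ⟨e⟩⟩ : ∃ K, Nonempty ((toD R).obj K ≅ Z) := ⟨_, ⟨(toD R).objObjPreimageIso Z⟩⟩
  have h1 : F.mapDerivedCategory.map (x • 𝟙 ((toD R).obj K)) =
      φ x • 𝟙 (F.mapDerivedCategory.obj ((toD R).obj K)) := by
    rw [← cancel_mono (F.mapDerivedCategoryFactors.hom.app K), ← (toD R).map_id,
      ← Functor.map_smul, F.mapDerivedCategoryFactors_hom_naturality]
    have : (F.mapHomologicalComplex (ComplexShape.up ℤ)).map (x • 𝟙 K) = φ x • 𝟙 _ := by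
      ext i : 1
      exact hF x _
    rw [this, Functor.map_smul, CategoryTheory.Functor.map_id]
    simp
  rw [← cancel_epi (F.mapDerivedCategory.map e.hom), ← Functor.map_comp]
  rw [Linear.comp_smul, Category.comp_id, Linear.comp_smul, Category.comp_id,
    ← Category.id_comp e.hom, ← Linear.smul_comp, Functor.map_comp, h1]
  simp

include hF in
lemma IsConeMul.mapDerivedCategory (x : R) (Z W : D R) (h : IsConeMul x Z W) :
    IsConeMul (φ x) (F.mapDerivedCategory.obj Z) (F.mapDerivedCategory.obj W) := by
  obtain ⟨g, h, hT⟩ := h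
  have := F.mapDerivedCategory.map_distinguished _ hT
  exact isConeMul_of_distinguished (mapDerivedCategory_map_smul φ F hF x Z) this

/-- Homology commutes with exact functors. -/
def mapHomologyIso (K : CochainComplex (ModuleCat.{u} R) ℤ) (n : ℤ) :
    ((F.mapHomologicalComplex (ComplexShape.up ℤ)).obj K).homology n ≅ F.obj (K.homology n) :=
  (K.sc n).mapHomologyIso F

include hF in
lemma IsKoszul.mapHomologicalComplex {xs : List R} {K L : CochainComplex (ModuleCat.{u} R) ℤ}
    (h : IsKoszul xs ((toD R).obj K) ((toD R).obj L)) :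
    IsKoszul (xs.map φ) ((toD S).obj ((F.mapHomologicalComplex _).obj K))
      ((toD S).obj ((F.mapHomologicalComplex _).obj L)) :=
  (h.map φ F.mapDerivedCategory (IsConeMul.mapDerivedCategory φ F hF)).of_iso
    (F.mapDerivedCategoryFactors.app K) (F.mapDerivedCategoryFactors.app L)

end ExactFunctor

lemma IsConeMul.isGE {x : R} {Z W : D R} (h : IsConeMul x Z W) {n : ℤ} (hZ : Z.IsGE n) :
    W.IsGE (n - 1) := by
  obtain ⟨g, h, hT⟩ := h
  rw [DerivedCategory.isGE_iff]
  intro i hi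
  exact (DerivedCategory.HomologySequence.exact₃ _ hT i (i + 1) (by lia)).isZero_of_both_zeros
    ((Z.isZero_of_isGE n i (by lia)).eq_of_src _ _)
    ((Z.isZero_of_isGE n (i + 1) (by lia)).eq_of_tgt _ _)

lemma IsKoszul.isGE {xs : List R} {Z V : D R} (h : IsKoszul xs Z V) (hZ : ∃ n, Z.IsGE n) :
    ∃ n, V.IsGE n := by
  induction h with
  | nil e =>
    obtain ⟨n, hn⟩ := hZ
    exact ⟨n, DerivedCategory.TStructure.t.isGE_of_iso e n⟩
  | cons h _ ih =>
    obtain ⟨n, hn⟩ := hZ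
    exact ih ⟨_, h.isGE hn⟩

/-- The supremum of the (homological) degrees of nonzero homology. -/
def supD (Z : D R) : EReal := ⨆ (i : ℤ) (_ : ¬ IsZero ((hD R (-i)).obj Z)), ((i : ℝ) : EReal)

lemma supD_toD (K : CochainComplex (ModuleCat.{u} R) ℤ) : supD ((toD R).obj K) = supH K := by
  have (i : ℤ) : IsZero ((hD R i).obj ((toD R).obj K)) ↔ IsZero (K.homology i) :=
    ((DerivedCategory.homologyFunctorFactors (ModuleCat.{u} R) i).app K).isZero_iff
  simp only [supD, supH, this]

lemma isGE_iff_supD_le (Z : D R) (n : ℤ) : Z.IsGE n ↔ supD Z ≤ (((-n : ℤ) : ℝ) : EReal) := by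
  rw [DerivedCategory.isGE_iff, supD]
  simp only [iSup_le_iff, EReal.coe_le_coe_iff, Int.cast_le]
  constructor
  · intro h i hi
    by_contra h'
    exact hi (h _ (by lia))
  · intro h i hi
    by_contra h'
    have := h (-i) (by rwa [neg_neg])
    lia

lemma exists_isGE_iff (Z : D R) : (∃ n, Z.IsGE n) ↔ supD Z < ⊤ := by
  constructor
  · rintro ⟨n, hn⟩
    exact ((isGE_iff_supD_le Z n).1 hn).trans_lt (EReal.coe_lt_top _)
  · intro h
    induction hs : supD Z with
    | bot => exact ⟨0, by rw [isGE_iff_supD_le, hs]; exact bot_le⟩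
    | top => simp [hs] at h
    | coe r =>
      refine ⟨-⌈r⌉, ?_⟩
      rw [isGE_iff_supD_le, hs, neg_neg, EReal.coe_le_coe_iff]
      exact Int.le_ceil r

/-- An object with bounded homology is either acyclic or has a first nonzero homology. -/
lemma isZero_or_exists_least (Z : D R) (hZ : ∃ n, Z.IsGE n) :
    (∀ n, Z.IsGE n) ∨ ∃ n, Z.IsGE n ∧ ¬ IsZero ((hD R n).obj Z) := by
  by_cases h : ∃ i, ¬ IsZero ((hD R i).obj Z)
  · obtain ⟨n, hn⟩ := hZ
    obtain ⟨j, hj, hj'⟩ := Int.exists_least_of_bdd (P := fun i => ¬ IsZero ((hD R i).obj Z))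
      ⟨n, fun z hz => by
        by_contra h'
        exact hz (Z.isZero_of_isGE n z (by lia))⟩ h
    refine Or.inr ⟨j, ?_, hj⟩
    rw [DerivedCategory.isGE_iff]
    intro i hi
    by_contra h'
    exact absurd (hj' i h') (by lia)
  · push Not at h
    exact Or.inl fun n => (DerivedCategory.isGE_iff Z n).2 fun i _ => h i

lemma supD_eq_bot {Z : D R} (h : ∀ n, Z.IsGE n) : supD Z = ⊥ := by
  rw [supD, iSup₂_eq_bot]
  intro i hi
  have := h (-i + 1)
  exact absurd (Z.isZero_of_isGE (-i + 1) (-i) (by lia)) hi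

lemma supD_eq {Z : D R} {j : ℤ} (hZ : Z.IsGE j) (h : ¬ IsZero ((hD R j).obj Z)) :
    supD Z = (((-j : ℤ) : ℝ) : EReal) := by
  refine le_antisymm ((isGE_iff_supD_le Z j).1 hZ) (le_iSup₂_of_le (-j) ?_ le_rfl)
  rwa [neg_neg]

section Local

variable [IsLocalRing R]

lemma supE_eq_bot {Z : D R} (h : ∀ n, Z.IsGE n) : supE Z = ⊥ := by
  rw [supE, iSup₂_eq_bot]
  intro i hi
  exact absurd (isZero_extk_of_lt (h (-i + 1)) (by lia)) hi

lemma supE_eq_of_socle {Z : D R} {j : ℤ} (hZ : Z.IsGE j) {m : (hD R j).obj Z} (h0 : m ≠ 0)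
    (hm : ∀ x ∈ IsLocalRing.maximalIdeal R, x • m = 0) : supE Z = (((-j : ℤ) : ℝ) : EReal) := by
  refine le_antisymm (supE_le_of_isGE (by rwa [neg_neg])) ?_
  refine le_iSup₂_of_le (-j) ?_ le_rfl
  rw [neg_neg]
  exact not_isZero_extk hZ h0 hm

/-- When the maximal ideal kills all cohomology, every element of the first nonzero cohomology
module is a socle element. -/
lemma supE_eq_supD {Z : D R} (hZ : ∃ n, Z.IsGE n)
    (h : ∀ x ∈ IsLocalRing.maximalIdeal R, ∀ (i : ℤ) (m : (hD R i).obj Z), x • m = 0) :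
    supE Z = supD Z := by
  obtain h' | ⟨j, hj, hj'⟩ := isZero_or_exists_least Z hZ
  · rw [supE_eq_bot h', supD_eq_bot h']
  · rw [supD_eq hj hj']
    rw [ModuleCat.isZero_iff_subsingleton, not_subsingleton_iff_nontrivial] at hj'
    obtain ⟨m, hm⟩ := exists_ne (0 : (hD R j).obj Z)
    exact supE_eq_of_socle hj hm fun x hx => h x hx j m

end Local

end

end CIDepth

/-! ### Maximal regular sequences -/

namespace CIDepth
noncomputable section

section RegularSequences

variable {S : Type u} [CommRing S]

open RingTheory.Sequence
open scoped Pointwise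

/-- After dividing out the elements of a list successively, there is a nonzero element killed
by an ideal `I`. -/
def HasSocleMod (I : Ideal S) : List S → ∀ (M : Type u) [AddCommGroup M] [Module S M], Prop
  | [], M, _, _ => ∃ m : M, m ≠ 0 ∧ ∀ x ∈ I, x • m = 0
  | z :: zs, M, _, _ => HasSocleMod I zs (QuotSMulTop z M)

/-- Retracts are used because they survive each successive quotient, whereas an injection in general
does not. The application is to a summand of a direct sum. -/
lemma HasSocleMod.of_retract {I : Ideal S} {zs : List S} {M N : Type u} [AddCommGroup M]
    [Module S M] [AddCommGroup N] [Module S N] (h : HasSocleMod I zs M) (i : M →ₗ[S] N)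
    (p : N →ₗ[S] M) (hpi : p ∘ₗ i = LinearMap.id) : HasSocleMod I zs N := by
  induction zs generalizing M N with
  | nil =>
    obtain ⟨m, hm, hx⟩ := h
    refine ⟨i m, fun h0 => hm ?_, fun x hx' => by rw [← map_smul, hx x hx', map_zero]⟩
    have := LinearMap.congr_fun hpi m
    rw [LinearMap.comp_apply, h0, map_zero] at this
    exact this.symm
  | cons z zs ih =>
    refine ih (M := QuotSMulTop z M) (N := QuotSMulTop z N) h (QuotSMulTop.map z i)
      (QuotSMulTop.map z p) ?_
    rw [← QuotSMulTop.map_comp, hpi, QuotSMulTop.map_id]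

lemma HasSocleMod.congr {I : Ideal S} {zs : List S} {M N : Type u} [AddCommGroup M]
    [Module S M] [AddCommGroup N] [Module S N] (h : HasSocleMod I zs M) (e : M ≃ₗ[S] N) :
    HasSocleMod I zs N :=
  h.of_retract e.toLinearMap e.symm.toLinearMap (by ext; simp)

/-- The existence of a maximal regular sequence on a nonzero finite module. -/
lemma exists_isWeaklyRegular_hasSocleMod [IsNoetherianRing S] [IsLocalRing S] (M : Type u)
    [AddCommGroup M] [Module S M] [Module.Finite S M] (N : Submodule S M) (hN : N ≠ ⊤) :
    ∃ zs : List S, (∀ z ∈ zs, z ∈ IsLocalRing.maximalIdeal S) ∧ IsWeaklyRegular (M ⧸ N) zs ∧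
      HasSocleMod (IsLocalRing.maximalIdeal S) zs (M ⧸ N) := by
  have : IsNoetherian S M := isNoetherian_of_isNoetherianRing_of_finite S M
  induction N using WellFoundedGT.induction with
  | ind N ih =>
  have : Nontrivial (M ⧸ N) := Submodule.Quotient.nontrivial_iff.2 hN
  -- Either the maximal ideal is associated and the socle is nonzero, or prime avoidance over the
  -- finitely many associated primes yields a regular element in it.
  by_cases h : IsLocalRing.maximalIdeal S ∈ associatedPrimes S (M ⧸ N)
  · obtain ⟨hp, m, hm⟩ := isAssociatedPrime_iff.1 (AssociatedPrimes.mem_iff.1 h)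
    refine ⟨[], by simp, IsWeaklyRegular.nil _ _, m, fun h0 => ?_, fun x hx => ?_⟩
    · apply hp.ne_top
      rw [hm, h0, eq_top_iff]
      intro x _
      simp [Submodule.mem_colon_singleton]
    · rw [hm] at hx
      simpa [Submodule.mem_colon_singleton] using hx
  · obtain ⟨z, hz, hzr⟩ : ∃ z ∈ IsLocalRing.maximalIdeal S, IsSMulRegular (M ⧸ N) z := by
      by_contra! hcon
      have hsub : (IsLocalRing.maximalIdeal S : Set S) ⊆
          ⋃ p ∈ ((associatedPrimes.finite S (M ⧸ N)).toFinset : Set (Ideal S)), (p : Set S) := by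
        intro z hz
        have := hcon z hz
        rw [Set.Finite.coe_toFinset, biUnion_associatedPrimes_eq_compl_regular]
        exact this
      rw [Ideal.subset_union_prime (f := fun p : Ideal S => p) ⊥ ⊥] at hsub
      · obtain ⟨p, hp, hle⟩ := hsub
        rw [Set.Finite.mem_toFinset] at hp
        have : p.IsPrime := hp.isPrime
        rw [(IsLocalRing.maximalIdeal.isMaximal S).eq_of_le this.ne_top hle] at h
        exact h hp
      · intro p hp _ _
        rw [Set.Finite.mem_toFinset] at hp
        exact hp.isPrime
    -- The quotient of `M ⧸ N` by z is again a quotient of `M`, by the strictly larger `N'`. This is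
    -- what allows Noetherian induction on `N`.
    let N' : Submodule S M := (z • (⊤ : Submodule S (M ⧸ N))).comap N.mkQ
    have hNN' : N ≤ N' := fun m hm => by
      change N.mkQ m ∈ z • (⊤ : Submodule S (M ⧸ N))
      have h0 : N.mkQ m = 0 := (Submodule.Quotient.mk_eq_zero N).2 hm
      rw [h0]
      exact zero_mem _
    have hlt : N < N' := by
      refine lt_of_le_of_ne hNN' fun heq => ?_
      obtain ⟨m, hm⟩ := exists_ne (0 : M ⧸ N)
      obtain ⟨m, rfl⟩ := N.mkQ_surjective m
      apply hm
      apply hzr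
      change z • N.mkQ m = z • 0
      rw [smul_zero, ← map_smul]
      apply (Submodule.Quotient.mk_eq_zero N).2
      rw [heq]
      change N.mkQ (z • m) ∈ z • (⊤ : Submodule S (M ⧸ N))
      rw [map_smul]
      exact Submodule.smul_mem_pointwise_smul _ z _ trivial
    have hne : N' ≠ ⊤ := by
      intro h'
      have : (⊤ : Submodule S (M ⧸ N)) ≠ z • ⊤ :=
        Submodule.top_ne_pointwise_smul_of_mem_jacobson_annihilator
          (IsLocalRing.maximalIdeal_le_jacobson _ hz)
      apply this
      rw [eq_comm, eq_top_iff]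
      intro m _
      obtain ⟨m, rfl⟩ := N.mkQ_surjective m
      exact h'.ge (trivial : m ∈ ⊤)
    obtain ⟨zs, hzs, h1, h2⟩ := ih N' hlt hne
    let e : (M ⧸ N') ≃ₗ[S] QuotSMulTop z (M ⧸ N) := by
      refine (Submodule.quotEquivOfEq _ _ ?_).trans (LinearMap.quotKerEquivOfSurjective
        ((z • (⊤ : Submodule S (M ⧸ N))).mkQ ∘ₗ N.mkQ)
        ((Submodule.mkQ_surjective _).comp (Submodule.mkQ_surjective _)))
      rw [LinearMap.ker_comp, Submodule.ker_mkQ]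
    refine ⟨z :: zs, by simpa using ⟨hz, hzs⟩, ?_, ?_⟩
    · rw [isWeaklyRegular_cons_iff]
      exact ⟨hzr, (e.isWeaklyRegular_congr zs).1 h1⟩
    · change HasSocleMod _ zs (QuotSMulTop z (M ⧸ N))
      exact h2.congr e

end RegularSequences

end

end CIDepth

/-! ### Depth under surjections and flat local homomorphisms -/

namespace CIDepth
noncomputable section

open RingTheory.Sequence TensorProduct
open scoped Pointwise ChangeOfRings

lemma ereal_add_coe_cancel {a b : EReal} (c : ℝ) (h : a + (c : EReal) = b + (c : EReal)) : a = b := by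
  have := congrArg (fun x => x - (c : EReal)) h
  simpa only [EReal.add_sub_cancel_right] using this

section ExtendScalars

variable {R S : Type u} [CommRing R] [CommRing S] (f : R →+* S)

instance : (ModuleCat.extendScalars.{u, u, u} f).Additive :=
  (ModuleCat.extendRestrictScalarsAdj f).left_adjoint_additive

/-- The functor `extendScalars` is the usual tensor product. -/
def extendScalarsEquiv (M : ModuleCat.{u} R) :
    letI := f.toAlgebra
    (ModuleCat.extendScalars f).obj M ≃ₗ[S] S ⊗[R] M :=
  letI := f.toAlgebra
  { toFun := fun x => x
    invFun := fun x => x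
    map_add' := fun _ _ => rfl
    map_smul' := fun _ _ => rfl
    left_inv := fun _ => rfl
    right_inv := fun _ => rfl }

variable [IsLocalRing R]

lemma exists_finsupp_residueField (N : ModuleCat.{u} R)
    (hN : ∀ x ∈ IsLocalRing.maximalIdeal R, ∀ m : N, x • m = 0) :
    ∃ ι : Type u, Nonempty (N ≃ₗ[R] (ι →₀ IsLocalRing.ResidueField R)) := by
  have hT : Module.IsTorsionBySet R N (IsLocalRing.maximalIdeal R : Set R) :=
    fun m x => hN x x.2 m
  let : Module (IsLocalRing.ResidueField R) N := hT.module
  have : IsScalarTower R (IsLocalRing.ResidueField R) N := hT.isScalarTower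
  let b := Module.Basis.ofVectorSpace (IsLocalRing.ResidueField R) N
  exact ⟨_, ⟨b.repr.restrictScalars R⟩⟩

/-- Koszul homology is a k-vector space, so its base change is a direct sum of copies of the closed
fibre. The index type has to be nonempty for the socle of the fibre to appear in the sum. -/
lemma exists_extendScalars_finsupp (N : ModuleCat.{u} R)
    (hN : ∀ x ∈ IsLocalRing.maximalIdeal R, ∀ m : N, x • m = 0) :
    letI := f.toAlgebra
    ∃ ι : Type u, (Nontrivial N → Nonempty ι) ∧ Nonempty ((ModuleCat.extendScalars f).obj N ≃ₗ[S]
      (ι →₀ (S ⊗[R] IsLocalRing.ResidueField R))) := by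
  classical
  let := f.toAlgebra
  obtain ⟨ι, ⟨e⟩⟩ := exists_finsupp_residueField N hN
  refine ⟨ι, fun h => ?_, ⟨(extendScalarsEquiv f N).trans
    ((TensorProduct.AlgebraTensorModule.congr (LinearEquiv.refl S S) e).trans
      (TensorProduct.finsuppRight R S S _ ι))⟩⟩
  by_contra hι
  rw [not_nonempty_iff] at hι
  have := e.injective.subsingleton
  exact not_subsingleton N this

lemma isWeaklyRegular_finsupp {M : Type u} [AddCommGroup M] [Module S M] {zs : List S}
    (h : IsWeaklyRegular M zs) (ι : Type u) : IsWeaklyRegular (ι →₀ M) zs := by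
  classical
  exact ((TensorProduct.finsuppScalarLeft S M ι).isWeaklyRegular_congr zs).1
    (h.isWeaklyRegular_lTensor (M₂ := ι →₀ S))

lemma HasSocleMod.finsupp {I : Ideal S} {M : Type u} [AddCommGroup M] [Module S M] {zs : List S}
    (h : HasSocleMod I zs M) (ι : Type u) [Nonempty ι] : HasSocleMod I zs (ι →₀ M) :=
  let i := Classical.arbitrary ι
  h.of_retract (Finsupp.lsingle i) (Finsupp.lapply i) (by ext; simp)

end ExtendScalars

section Reduction

variable {S : Type u} [CommRing S]

lemma hD_map_smul (x : S) (Z : D S) (i : ℤ) (m : (hD S i).obj Z) :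
    (hD S i).map (x • 𝟙 Z) m = x • m := by
  obtain ⟨K, ⟨e⟩⟩ : ∃ K, Nonempty ((toD S).obj K ≅ Z) := ⟨_, ⟨(toD S).objObjPreimageIso Z⟩⟩
  let e' := (hD S i).mapIso e.symm ≪≫
    (DerivedCategory.homologyFunctorFactors (ModuleCat.{u} S) i).app K
  have h1 : (x • 𝟙 Z) ≫ e.inv = e.inv ≫ (toD S).map (x • 𝟙 K) := by
    rw [CategoryTheory.Functor.map_smul, CategoryTheory.Functor.map_id, Linear.smul_comp,
      Linear.comp_smul, Category.id_comp, Category.comp_id]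
  have h2 : (hD S i).map (x • 𝟙 Z) ≫ e'.hom =
      e'.hom ≫ HomologicalComplex.homologyMap (x • 𝟙 K) i := by
    have := (DerivedCategory.homologyFunctorFactors (ModuleCat.{u} S) i).hom.naturality (x • 𝟙 K)
    dsimp [e'] at this ⊢
    rw [← Functor.map_comp_assoc, h1, Functor.map_comp_assoc, this]
    exact (Category.assoc _ _ _).symm
  apply (ConcreteCategory.bijective_of_isIso e'.hom).1
  change ((hD S i).map (x • 𝟙 Z) ≫ e'.hom) m = _
  rw [h2, map_smul]
  exact homologyMap_smul_id K x i _

/-- The homology of the cone of the multiplication by an element which is regular on homology. -/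
lemma IsConeMul.nonempty_homology_equiv {z : S} {Z W : D S} (h : IsConeMul z Z W) (i : ℤ)
    (hz : IsSMulRegular ((hD S (i + 1)).obj Z) z) :
    Nonempty (QuotSMulTop z ((hD S i).obj Z) ≃ₗ[S] (hD S i).obj W) := by
  obtain ⟨g, h, hT⟩ := h
  obtain ⟨δ, h₁, h₃⟩ : ∃ δ : (hD S i).obj W ⟶ (hD S (i + 1)).obj Z,
      LinearMap.range δ.hom = LinearMap.ker ((hD S (i + 1)).map (z • 𝟙 Z)).hom ∧
      LinearMap.range ((hD S i).map g).hom = LinearMap.ker δ.hom :=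
    ⟨_, (ShortComplex.moduleCat_exact_iff_range_eq_ker _).1
        (DerivedCategory.HomologySequence.exact₁ _ hT i (i + 1)),
      (ShortComplex.moduleCat_exact_iff_range_eq_ker _).1
        (DerivedCategory.HomologySequence.exact₃ _ hT i (i + 1))⟩
  have h₂ : LinearMap.range ((hD S i).map (z • 𝟙 Z)).hom = LinearMap.ker ((hD S i).map g).hom :=
    (ShortComplex.moduleCat_exact_iff_range_eq_ker _).1
      (DerivedCategory.HomologySequence.exact₂ _ hT i)
  -- The image of the connecting map is killed by z, which is regular on its target.
  have hδ : LinearMap.ker δ.hom = ⊤ := by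
    rw [eq_top_iff]
    intro w _
    rw [LinearMap.mem_ker]
    apply hz
    have := h₁.le ⟨w, rfl⟩
    rw [LinearMap.mem_ker] at this
    change z • _ = z • 0
    rw [smul_zero, ← this]
    exact (hD_map_smul z Z (i + 1) (δ.hom w)).symm
  refine ⟨(Submodule.quotEquivOfEq _ _ ?_).trans
    (LinearMap.quotKerEquivOfSurjective ((hD S i).map g).hom ?_)⟩
  · rw [← h₂]
    ext m
    rw [Submodule.mem_smul_pointwise_iff_exists]
    constructor
    · rintro ⟨y, -, rfl⟩
      exact ⟨y, hD_map_smul z Z i y⟩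
    · rintro ⟨y, rfl⟩
      exact ⟨y, trivial, (hD_map_smul z Z i y).symm⟩
  · rw [← LinearMap.range_eq_top, h₃, hδ]

variable [IsLocalRing S]

/-- A cone on an element regular on all cohomology replaces cohomology by its quotient in the same
degree. So the bound j is kept while `supE` grows by one, until a socle element appears in degree j.
-/
lemma supE_add_length_of_hasSocleMod {zs : List S}
    (hzs : ∀ z ∈ zs, z ∈ IsLocalRing.maximalIdeal S) {Z : D S} {j : ℤ} (hZ : Z.IsGE j)
    (hreg : ∀ i, IsWeaklyRegular ((hD S i).obj Z) zs)
    (hsoc : HasSocleMod (IsLocalRing.maximalIdeal S) zs ((hD S j).obj Z)) :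
    supE Z + ((zs.length : ℝ) : EReal) = (((-j : ℤ) : ℝ) : EReal) := by
  induction zs generalizing Z with
  | nil =>
    obtain ⟨m, h0, hm⟩ := hsoc
    rw [supE_eq_of_socle hZ h0 hm]
    simp
  | cons z zs ih =>
    obtain ⟨W, g, h, hT⟩ := distinguished_cocone_triangle (z • 𝟙 Z)
    have hW : IsConeMul z Z W := ⟨g, h, hT⟩
    have e := fun i => (hW.nonempty_homology_equiv i
      ((isWeaklyRegular_cons_iff _ _ _).1 (hreg (i + 1))).1).some
    have hWj : W.IsGE j := by
      rw [DerivedCategory.isGE_iff]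
      intro i hi
      have := ModuleCat.subsingleton_of_isZero (Z.isZero_of_isGE j i hi)
      have : Subsingleton (QuotSMulTop z ((hD S i).obj Z)) := inferInstance
      exact ModuleCat.isZero_of_iff_subsingleton.2 (e i).symm.injective.subsingleton
    rw [← ih (fun x hx => hzs x (by simp [hx])) hWj (fun i => ((e i).isWeaklyRegular_congr zs).1
      ((isWeaklyRegular_cons_iff _ _ _).1 (hreg i)).2) (hsoc.congr (M := QuotSMulTop z _) (e j)),
      hW.supE_eq (hzs z (by simp)), List.length_cons, add_assoc]
    congr 1
    push_cast
    rw [add_comm]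

end Reduction

lemma exists_ofList_eq {S : Type u} [CommRing S] [IsNoetherianRing S] (I : Ideal S) :
    ∃ xs : List S, Ideal.ofList xs = I := by
  obtain ⟨s, hs⟩ := (IsNoetherian.noetherian I : I.FG)
  exact ⟨s.toList, by simpa [Ideal.ofList] using hs⟩

lemma smul_eq_zero_of_iso {S : Type u} [CommRing S] {M N : ModuleCat.{u} S} (e : M ≅ N) {x : S}
    (h : ∀ n : N, x • n = 0) (m : M) : x • m = 0 := by
  apply (ConcreteCategory.bijective_of_isIso e.hom).1
  rw [map_smul, h, map_zero]

/-- Depth sensitivity of the Koszul complex: depth questions become questions about the top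
nonvanishing homology. -/
lemma supE_koszul {S : Type u} [CommRing S] [IsLocalRing S] {xs : List S}
    (hxs : Ideal.ofList xs = IsLocalRing.maximalIdeal S) (K : CochainComplex (ModuleCat.{u} S) ℤ)
    (hK : ∃ n, ((toD S).obj K).IsGE n) :
    supE ((toD S).obj K) + ((xs.length : ℝ) : EReal) = supD ((toD S).obj (koszul xs K)) := by
  have h := isKoszul_koszul xs K
  rw [← h.supE_eq (fun x hx => hxs ▸ Ideal.subset_span hx)]
  refine supE_eq_supD (h.isGE hK) fun x hx i => smul_eq_zero_of_iso
    ((DerivedCategory.homologyFunctorFactors (ModuleCat.{u} S) i).app _) ?_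
  exact smul_koszul_homology xs K x (hxs ▸ hx) i

section Restrict

variable {Q S : Type u} [CommRing Q] [CommRing S] [IsLocalRing Q] [IsLocalRing S]
  [IsNoetherianRing S] (g : Q →+* S)

omit [IsLocalRing Q] [IsLocalRing S] [IsNoetherianRing S] in
lemma isGE_toD_iff_of_isZero_iff {K : CochainComplex (ModuleCat.{u} S) ℤ}
    {L : CochainComplex (ModuleCat.{u} Q) ℤ}
    (h : ∀ i, IsZero (K.homology i) ↔ IsZero (L.homology i)) (n : ℤ) :
    ((toD S).obj K).IsGE n ↔ ((toD Q).obj L).IsGE n := by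
  have h1 := fun i => (h i).trans ((DerivedCategory.homologyFunctorFactors
    (ModuleCat.{u} Q) i).app L).isZero_iff.symm
  have h2 := fun i => ((DerivedCategory.homologyFunctorFactors
    (ModuleCat.{u} S) i).app K).isZero_iff.trans (h1 i)
  rw [DerivedCategory.isGE_iff, DerivedCategory.isGE_iff]
  exact forall₂_congr fun i _ => h2 i

omit [IsLocalRing Q] [IsLocalRing S] [IsNoetherianRing S] in
lemma isZero_restrictScalars_iff (M : ModuleCat.{u} S) :
    IsZero ((ModuleCat.restrictScalars g).obj M) ↔ IsZero M := by
  rw [ModuleCat.isZero_iff_subsingleton, ModuleCat.isZero_iff_subsingleton]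
  rfl

/-- Both sides are computed by one complex, the Koszul complex over `S` on generators of its maximal
ideal. Over `Q` it is a Koszul complex on lifts of these generators. The lifts need not generate the
maximal ideal of `Q`: the homology is killed by that ideal anyway, since it maps into that of `S`.
-/
lemma supE_restrictScalars [IsLocalHom g] (hg : Function.Surjective g)
    (Y : CochainComplex (ModuleCat.{u} S) ℤ) (hY : ∃ n, ((toD S).obj Y).IsGE n) :
    supE ((toD Q).obj (((ModuleCat.restrictScalars g).mapHomologicalComplex _).obj Y)) =
      supE ((toD S).obj Y) := by
  obtain ⟨ys, hys⟩ := exists_ofList_eq (IsLocalRing.maximalIdeal S)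
  let φ := Function.surjInv hg
  have hφ (x : S) : g (φ x) = x := Function.surjInv_eq hg x
  let G := (ModuleCat.restrictScalars g).mapHomologicalComplex (ComplexShape.up ℤ)
  have hzero (K : CochainComplex (ModuleCat.{u} S) ℤ) (i : ℤ) :
      IsZero (K.homology i) ↔ IsZero ((G.obj K).homology i) :=
    (isZero_restrictScalars_iff g _).symm.trans
      (mapHomologyIso (ModuleCat.restrictScalars g) K i).isZero_iff.symm
  have h1 := isKoszul_koszul ys Y
  have h2 := h1.mapHomologicalComplex φ (ModuleCat.restrictScalars g) (fun x M => by
    ext m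
    change x • (show M from m) = g (φ x) • (show M from m)
    rw [hφ])
  have hm : ∀ x ∈ ys.map φ, x ∈ IsLocalRing.maximalIdeal Q := by
    intro x hx
    obtain ⟨y, hy, rfl⟩ := List.mem_map.1 hx
    rw [IsLocalRing.mem_maximalIdeal, mem_nonunits_iff, ← isUnit_map_iff g, hφ]
    exact (hys ▸ Ideal.subset_span hy : y ∈ IsLocalRing.maximalIdeal S)
  obtain ⟨n, hn⟩ := hY
  have hGE : ∃ n, ((toD Q).obj (G.obj Y)).IsGE n :=
    ⟨n, (isGE_toD_iff_of_isZero_iff (hzero Y) n).1 hn⟩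
  apply ereal_add_coe_cancel (ys.length : ℝ)
  rw [supE_koszul hys Y ⟨n, hn⟩]
  have h3 := h2.supE_eq hm
  rw [List.length_map] at h3
  rw [← h3, supE_eq_supD (h2.isGE hGE), supD_toD, supD_toD]
  · unfold supH
    simp only [hzero]
    rfl
  · intro x hx i
    refine smul_eq_zero_of_iso
      ((DerivedCategory.homologyFunctorFactors (ModuleCat.{u} Q) i).app _ ≪≫
        mapHomologyIso (ModuleCat.restrictScalars g) _ i) fun m => ?_
    refine smul_koszul_homology ys Y (g x) ?_ i m
    rw [hys, IsLocalRing.mem_maximalIdeal, mem_nonunits_iff, isUnit_map_iff g]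
    exact hx

end Restrict

section Flat

variable {R S : Type u} [CommRing R] [CommRing S] [IsLocalRing R] [IsLocalRing S]
  [IsNoetherianRing R] [IsNoetherianRing S] (f : R →+* S)

omit [IsLocalRing S] [IsNoetherianRing R] [IsLocalRing R] [IsNoetherianRing S] in
lemma extendScalars_map_smul (x : R) (M : ModuleCat.{u} R) :
    (ModuleCat.extendScalars f).map (x • 𝟙 M) = f x • 𝟙 _ := by
  apply ModuleCat.ExtendScalars.hom_ext
  intro m
  let := f.toAlgebra
  change (1 : S) ⊗ₜ[R] (x • m) = (algebraMap R S x * 1) ⊗ₜ[R] m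
  rw [← TensorProduct.smul_tmul, Algebra.smul_def]

omit [IsLocalRing S] [IsNoetherianRing R] [IsLocalRing R] [IsNoetherianRing S] in
/-- A flat ring homomorphism preserves bounded complexes. -/
lemma isGE_extendScalars (hf : f.Flat) {Y : CochainComplex (ModuleCat.{u} R) ℤ} {n : ℤ}
    (hY : ((toD R).obj Y).IsGE n) :
    ((toD S).obj (((ModuleCat.extendScalars f).mapHomologicalComplex _).obj Y)).IsGE n := by
  have := ModuleCat.preservesFiniteLimits_extendScalars_of_flat hf
  rw [DerivedCategory.isGE_iff] at hY ⊢
  intro i hi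
  exact ((DerivedCategory.homologyFunctorFactors (ModuleCat.{u} S) i).app _).isZero_iff.2
    ((mapHomologyIso (ModuleCat.extendScalars f) Y i).isZero_iff.2
      ((ModuleCat.extendScalars f).map_isZero
        (((DerivedCategory.homologyFunctorFactors (ModuleCat.{u} R) i).app _).isZero_iff.1
          (hY i hi))))

/-- The behaviour of the depth under a flat local homomorphism. -/
lemma exists_supE_extendScalars (hf : f.Flat) [IsLocalHom f] :
    ∃ e : ℕ, ∀ Y : CochainComplex (ModuleCat.{u} R) ℤ, (∃ n, ((toD R).obj Y).IsGE n) →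
      supE ((toD S).obj (((ModuleCat.extendScalars f).mapHomologicalComplex _).obj Y)) +
        ((e : ℝ) : EReal) = supE ((toD R).obj Y) := by
  let := f.toAlgebra
  have : Module.Flat R S := hf
  have : IsLocalHom (algebraMap R S) := ‹IsLocalHom f›
  have : Module.FaithfullyFlat R S := Module.FaithfullyFlat.of_flat_of_isLocalHom
  have := ModuleCat.preservesFiniteLimits_extendScalars_of_flat hf
  have : Nontrivial (S ⊗[R] IsLocalRing.ResidueField R) :=
    Module.FaithfullyFlat.lTensor_nontrivial R S _
  -- A maximal regular sequence on the closed fibre. Its length is chosen before `Y`, so it serves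
  -- all complexes at once.
  obtain ⟨zs, hzs, hreg, hsoc⟩ := exists_isWeaklyRegular_hasSocleMod (S := S)
    (S ⊗[R] IsLocalRing.ResidueField R) ⊥ bot_ne_top
  let e₀ := Submodule.quotEquivOfEqBot (⊥ : Submodule S (S ⊗[R] IsLocalRing.ResidueField R)) rfl
  replace hreg := (e₀.isWeaklyRegular_congr zs).1 hreg
  replace hsoc := hsoc.congr e₀
  refine ⟨zs.length, fun Y hY => ?_⟩
  obtain ⟨xs, hxs⟩ := exists_ofList_eq (IsLocalRing.maximalIdeal R)
  let G := (ModuleCat.extendScalars f).mapHomologicalComplex (ComplexShape.up ℤ)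
  let V := koszul xs Y
  have h1 : IsKoszul xs ((toD R).obj Y) ((toD R).obj V) := isKoszul_koszul xs Y
  have h2 : IsKoszul (xs.map f) ((toD S).obj (G.obj Y)) ((toD S).obj (G.obj V)) :=
    h1.mapHomologicalComplex f (ModuleCat.extendScalars f) (extendScalars_map_smul f)
  have h3 := h2.supE_eq (fun x hx => by
    obtain ⟨y, hy, rfl⟩ := List.mem_map.1 hx
    rw [IsLocalRing.mem_maximalIdeal, mem_nonunits_iff, isUnit_map_iff f]
    exact (hxs ▸ Ideal.subset_span hy : y ∈ IsLocalRing.maximalIdeal R))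
  rw [List.length_map] at h3
  apply ereal_add_coe_cancel (xs.length : ℝ)
  rw [supE_koszul hxs Y hY, add_right_comm, ← h3]
  have hV := h1.isGE hY
  change _ = supD ((toD R).obj V)
  obtain h | ⟨j, hj, hj'⟩ := isZero_or_exists_least _ hV
  · rw [supD_eq_bot h, supE_eq_bot fun n => isGE_extendScalars f hf (h n), EReal.bot_add]
  · rw [supD_eq hj hj']
    let e₁ (i : ℤ) : (hD S i).obj ((toD S).obj (G.obj V)) ≅
        (ModuleCat.extendScalars f).obj (V.homology i) :=
      (DerivedCategory.homologyFunctorFactors (ModuleCat.{u} S) i).app _ ≪≫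
        mapHomologyIso (ModuleCat.extendScalars f) V i
    have h5 := fun i => exists_extendScalars_finsupp f (V.homology i)
      (fun x hx m => smul_koszul_homology xs Y x (hxs ▸ hx) i m)
    refine supE_add_length_of_hasSocleMod hzs (isGE_extendScalars f hf hj) (fun i => ?_) ?_
    · obtain ⟨ι, -, ⟨e⟩⟩ := h5 i
      exact (((e₁ i).toLinearEquiv.trans e).isWeaklyRegular_congr zs).2
        (isWeaklyRegular_finsupp hreg ι)
    · obtain ⟨ι, hι, ⟨e⟩⟩ := h5 j
      have : Nonempty ι := hι (by
        rw [← not_subsingleton_iff_nontrivial, ← ModuleCat.isZero_iff_subsingleton]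
        exact fun h => hj' (((DerivedCategory.homologyFunctorFactors
          (ModuleCat.{u} R) j).app _).isZero_iff.2 h))
      exact (hsoc.finsupp ι).congr ((e₁ j).toLinearEquiv.trans e).symm

end Flat

end

end CIDepth

/-! ### Total complexes in terms of elements -/

namespace CIDepth
noncomputable section

open HomologicalComplex

/-- Exactness of an additive functor, on short complexes. -/
def PreservesExact {A B : Type u} [CommRing A] [CommRing B] (G : ModuleCat.{u} A ⥤ ModuleCat.{u} B)
    [G.PreservesZeroMorphisms] : Prop :=
  ∀ S : ShortComplex (ModuleCat.{u} A), S.Exact → (S.map G).Exact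

section Bifunctor

variable {A B C : Type u} [CommRing A] [CommRing B] [CommRing C]
  (F : ModuleCat.{u} A ⥤ ModuleCat.{u} B ⥤ ModuleCat.{u} C)
  [F.Additive] [∀ X, (F.obj X).Additive]
  (K : CochainComplex (ModuleCat.{u} A) ℤ) (L L' L'' : CochainComplex (ModuleCat.{u} B) ℤ)

/-- The total complex of a bifunctor applied to two complexes of modules. -/
abbrev tot : CochainComplex (ModuleCat.{u} C) ℤ := mapBifunctor K L F (ComplexShape.up ℤ)

/-- The inclusion of a summand. -/
abbrev totι (p q n : ℤ) (h : p + q = n) : (F.obj (K.X p)).obj (L.X q) ⟶ (tot F K L).X n :=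
  ιMapBifunctor K L F (ComplexShape.up ℤ) p q n h

/-- The projection onto a summand. -/
def totπ (p q n : ℤ) (h : p + q = n) : (tot F K L).X n ⟶ (F.obj (K.X p)).obj (L.X q) :=
  mapBifunctorDesc (fun i₁ i₂ h' => if hp : i₁ = p then
    eqToHom (by obtain rfl : i₂ = q := by { change i₁ + i₂ = n at h'; lia }
                rw [hp]) else 0)

@[simp]
lemma totι_π_self (p q n : ℤ) (h : p + q = n) :
    totι F K L p q n h ≫ totπ F K L p q n h = 𝟙 _ := by
  simp [totι, totπ]

@[simp]
lemma totι_π_self_assoc (p q n : ℤ) (h : p + q = n) {Z : ModuleCat.{u} C}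
    (f : (F.obj (K.X p)).obj (L.X q) ⟶ Z) :
    totι F K L p q n h ≫ totπ F K L p q n h ≫ f = f := by
  rw [← Category.assoc, totι_π_self, Category.id_comp]

lemma totι_π_of_ne (p q n : ℤ) (h : p + q = n) (p' q' : ℤ) (h' : p' + q' = n) (hp : p ≠ p') :
    totι F K L p q n h ≫ totπ F K L p' q' n h' = 0 := by
  simp [totι, totπ, hp]

/-- Elements of the total complex have finite support, since it is a coproduct. Allowing every
larger `t` makes the condition stable under sums of elements. -/
lemma tot_exists_eq_sum {n : ℤ} (x : (tot F K L).X n) : ∃ s : Finset ℤ, ∀ t, s ⊆ t →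
    x = ∑ p ∈ t, totι F K L p (n - p) n (by lia) (totπ F K L p (n - p) n (by lia) x) := by
  classical
  let N : Submodule C ((tot F K L).X n) :=
    ⨆ p : ℤ, LinearMap.range (totι F K L p (n - p) n (by lia)).hom
  -- The projection to the quotient by the span of the summands vanishes on each summand, hence is
  -- zero.
  have hN : N = ⊤ := by
    have h0 : ModuleCat.ofHom N.mkQ = 0 := by
      apply mapBifunctor.hom_ext
      intro p q h
      obtain rfl : q = n - p := by change p + q = n at h; lia
      ext y
      rw [comp_zero]
      exact (Submodule.Quotient.mk_eq_zero N).2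
        (le_iSup (fun p : ℤ => LinearMap.range (totι F K L p (n - p) n (by lia)).hom) p ⟨y, rfl⟩)
    rw [← N.ker_mkQ, LinearMap.ker_eq_top]
    exact congrArg ModuleCat.Hom.hom h0
  have hx : x ∈ N := hN ▸ trivial
  refine Submodule.iSup_induction _ (motive := fun x => ∃ s : Finset ℤ, ∀ t, s ⊆ t →
    x = ∑ p ∈ t, totι F K L p (n - p) n (by lia) (totπ F K L p (n - p) n (by lia) x)) hx ?_ ?_ ?_
  · rintro p _ ⟨y, rfl⟩
    refine ⟨{p}, fun t ht => ?_⟩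
    rw [Finset.sum_eq_single p]
    · have := ConcreteCategory.congr_hom (totι_π_self F K L p (n - p) n (by lia)) y
      exact (congrArg (totι F K L p (n - p) n (by lia)) this).symm
    · intro p' _ hp
      have := ConcreteCategory.congr_hom
        (totι_π_of_ne F K L p (n - p) n (by lia) p' (n - p') (by lia) hp.symm) y
      exact (congrArg (totι F K L p' (n - p') n (by lia)) this).trans (map_zero _)
    · intro h
      exact absurd (ht (Finset.mem_singleton_self p)) h
  · exact ⟨∅, fun t _ => by simp⟩
  · rintro x y ⟨s, hs⟩ ⟨t, ht⟩
    refine ⟨s ∪ t, fun v hv => ?_⟩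
    conv_lhs => rw [hs v (Finset.union_subset_left hv), ht v (Finset.union_subset_right hv)]
    rw [← Finset.sum_add_distrib]
    exact Finset.sum_congr rfl fun p _ => by rw [map_add, map_add]

lemma tot_ext {n : ℤ} {x : (tot F K L).X n}
    (h : ∀ p q h, totπ F K L p q n h x = 0) : x = 0 := by
  obtain ⟨s, hs⟩ := tot_exists_eq_sum F K L x
  rw [hs s subset_rfl]
  exact Finset.sum_eq_zero fun p _ => by rw [h, map_zero]

lemma totι_d (p q n n' : ℤ) (h : p + q = n) (hn : n + 1 = n') :
    totι F K L p q n h ≫ (tot F K L).d n n' =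
      (F.map (K.d p (p + 1))).app (L.X q) ≫ totι F K L (p + 1) q n' (by lia) +
      p.negOnePow • ((F.obj (K.X p)).map (L.d q (q + 1)) ≫
        totι F K L p (q + 1) n' (by lia)) := by
  rw [mapBifunctor.d_eq, Preadditive.comp_add, mapBifunctor.ι_D₁, mapBifunctor.ι_D₂,
    mapBifunctor.d₁_eq K L F _ (i₁' := p + 1) rfl _ _ (by change p + 1 + q = n'; lia),
    mapBifunctor.d₂_eq K L F _ p (i₂' := q + 1) rfl _ (by change p + (q + 1) = n'; lia)]
  congr 1
  exact one_smul _ _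

lemma tot_d_π (p q p' q' n n' : ℤ) (h : p + q = n') (hn : n + 1 = n') (hp : p' + 1 = p)
    (hq : q' + 1 = q) :
    (tot F K L).d n n' ≫ totπ F K L p q n' h =
      totπ F K L p' q n (by lia) ≫ (F.map (K.d p' p)).app (L.X q) +
      p.negOnePow • (totπ F K L p q' n (by lia) ≫ (F.obj (K.X p)).map (L.d q' q)) := by
  subst hp hq hn
  apply mapBifunctor.hom_ext
  intro i j hij
  change i + j = n at hij
  change totι F K L i j n hij ≫ _ = totι F K L i j n hij ≫ _
  rw [← Category.assoc, totι_d F K L i j n _ hij rfl, Preadditive.add_comp, Preadditive.comp_add,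
    Linear.units_smul_comp, Linear.comp_units_smul, Category.assoc, Category.assoc]
  congr 1
  · by_cases hi : i = p'
    · obtain rfl := hi
      obtain rfl : j = q' + 1 := by lia
      rw [totι_π_self, Category.comp_id, totι_π_self_assoc]
    · rw [totι_π_of_ne _ _ _ _ _ _ _ _ _ _ (by lia), comp_zero, ← Category.assoc,
        totι_π_of_ne _ _ _ _ _ _ _ _ _ _ (by lia), zero_comp]
  · by_cases hi : i = p' + 1
    · obtain rfl := hi
      obtain rfl : j = q' := by lia
      rw [totι_π_self, Category.comp_id, totι_π_self_assoc]
    · rw [totι_π_of_ne _ _ _ _ _ _ _ _ _ _ (by lia), comp_zero, ← Category.assoc,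
        totι_π_of_ne _ _ _ _ _ _ _ _ _ _ (by lia), zero_comp, smul_zero, smul_zero]

variable {L L' L''}

/-- Functoriality of the total complex in the second variable. -/
abbrev totMap (f : L ⟶ L') : tot F K L ⟶ tot F K L' := mapBifunctorMap (𝟙 K) f F _

lemma totMap_π (f : L ⟶ L') (p q n : ℤ) (h : p + q = n) :
    (totMap F K f).f n ≫ totπ F K L' p q n h = totπ F K L p q n h ≫ (F.obj (K.X p)).map (f.f q) := by
  apply mapBifunctor.hom_ext
  intro i j hij
  rw [ι_mapBifunctorMap_assoc]
  change i + j = n at hij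
  rw [HomologicalComplex.id_f, CategoryTheory.Functor.map_id, NatTrans.id_app, Category.id_comp]
  change _ ≫ totι F K L' i j n hij ≫ _ = totι F K L i j n hij ≫ _
  by_cases hi : i = p
  · obtain rfl := hi
    obtain rfl : j = q := by lia
    rw [totι_π_self, Category.comp_id, totι_π_self_assoc]
  · rw [totι_π_of_ne _ _ _ _ _ _ _ _ _ _ hi, comp_zero, ← Category.assoc,
      totι_π_of_ne _ _ _ _ _ _ _ _ _ _ hi, zero_comp]

lemma totι_totMap (f : L ⟶ L') (p q n : ℤ) (h : p + q = n) :
    totι F K L p q n h ≫ (totMap F K f).f n = (F.obj (K.X p)).map (f.f q) ≫ totι F K L' p q n h := by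
  rw [ι_mapBifunctorMap, HomologicalComplex.id_f, CategoryTheory.Functor.map_id, NatTrans.id_app,
    Category.id_comp]

end Bifunctor
end

end CIDepth

/-! ### Exactness properties of total complexes -/

namespace CIDepth
noncomputable section

open HomologicalComplex

lemma PreservesExact.shortExact {A B : Type u} [CommRing A] [CommRing B]
    {G : ModuleCat.{u} A ⥤ ModuleCat.{u} B} [G.PreservesZeroMorphisms] (hG : PreservesExact G)
    {S : ShortComplex (ModuleCat.{u} A)} (hS : S.ShortExact) : (S.map G).ShortExact where
  exact := hG S hS.exact
  mono_f := by
    have := hS.mono_f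
    let S' : ShortComplex (ModuleCat.{u} A) := ShortComplex.mk (0 : S.X₁ ⟶ S.X₁) S.f zero_comp
    have h : S'.Exact := (S'.exact_iff_mono rfl).2 this
    exact ((S'.map G).exact_iff_mono (G.map_zero _ _)).1 (hG _ h)
  epi_g := by
    have := hS.epi_g
    let S' : ShortComplex (ModuleCat.{u} A) := ShortComplex.mk S.g (0 : S.X₃ ⟶ S.X₃) comp_zero
    have h : S'.Exact := (S'.exact_iff_epi rfl).2 this
    exact ((S'.map G).exact_iff_epi (G.map_zero _ _)).1 (hG _ h)

section Bifunctor

variable {A B C : Type u} [CommRing A] [CommRing B] [CommRing C]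
  (F : ModuleCat.{u} A ⥤ ModuleCat.{u} B ⥤ ModuleCat.{u} C)
  [F.Additive] [∀ X, (F.obj X).Additive]
  (K : CochainComplex (ModuleCat.{u} A) ℤ) (L : CochainComplex (ModuleCat.{u} B) ℤ)

instance : ((F.map₂CochainComplex).obj K).Additive where
  map_add {L L' f g} := by
    ext n : 1
    apply mapBifunctor.hom_ext
    intro p q h
    change totι F K L p q n h ≫ (totMap F K (f + g)).f n =
      totι F K L p q n h ≫ ((totMap F K f).f n + (totMap F K g).f n)
    rw [Preadditive.comp_add, totι_totMap, totι_totMap, totι_totMap, HomologicalComplex.add_f_apply,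
      Functor.map_add, Preadditive.add_comp]

/-- A vertical boundary in column p is realised by a total boundary that leaves the columns to the
left untouched. The remaining horizontal term lies in column p + 1. -/
lemma exists_tot_d (p q q' n n' : ℤ) (h : p + q = n) (hq : q' + 1 = q) (hn : n' + 1 = n)
    (w : (F.obj (K.X p)).obj (L.X q')) :
    ∃ y : (tot F K L).X n',
      totπ F K L p q n h ((tot F K L).d n' n y) = (F.obj (K.X p)).map (L.d q' q) w ∧
      ∀ i j hij, i < p → totπ F K L i j n hij ((tot F K L).d n' n y) = 0 := by
  subst hq hn
  let m := p.negOnePow • totι F K L p q' n' (by lia)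
  have h1 : (m ≫ (tot F K L).d n' (n' + 1)) ≫ totπ F K L p (q' + 1) (n' + 1) h =
      (F.obj (K.X p)).map (L.d q' (q' + 1)) := by
    rw [Linear.units_smul_comp, totι_d F K L p q' n' _ (by lia) rfl, Linear.units_smul_comp,
      Preadditive.add_comp, Linear.units_smul_comp, Category.assoc, Category.assoc,
      totι_π_of_ne _ _ _ _ _ _ _ _ _ _ (by lia), totι_π_self, Category.comp_id, comp_zero,
      zero_add, smul_smul, Int.units_mul_self, one_smul]
  have h2 (i j hij) (hi : i < p) :
      (m ≫ (tot F K L).d n' (n' + 1)) ≫ totπ F K L i j (n' + 1) hij = 0 := by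
    rw [Linear.units_smul_comp, totι_d F K L p q' n' _ (by lia) rfl, Linear.units_smul_comp,
      Preadditive.add_comp, Linear.units_smul_comp, Category.assoc, Category.assoc,
      totι_π_of_ne _ _ _ _ _ _ _ _ _ _ (by lia), totι_π_of_ne _ _ _ _ _ _ _ _ _ _ (by lia),
      comp_zero, comp_zero, smul_zero, add_zero, smul_zero]
  exact ⟨m w, ConcreteCategory.congr_hom h1 w,
    fun i j hij hi => ConcreteCategory.congr_hom (h2 i j hij hi) w⟩

/-- A cycle has finite support, and `K` vanishes beyond column N. The leftmost component is a
vertical cycle, hence a vertical boundary by exactness of the column. Subtracting the corresponding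
total boundary moves the support to the right, and finitely many such steps exhaust it. -/
lemma acyclic_tot (hK : ∃ N, K.IsStrictlyLE N) (hF : ∀ p, PreservesExact (F.obj (K.X p)))
    (hL : L.Acyclic) : (tot F K L).Acyclic := by
  obtain ⟨N, hN⟩ := hK
  intro n
  rw [exactAt_iff' _ (n - 1) n (n + 1) (by simp) (by simp), ShortComplex.moduleCat_exact_iff]
  intro x hx
  change (tot F K L).X n at x
  change (tot F K L).d n (n + 1) x = 0 at hx
  change ∃ y : (tot F K L).X (n - 1), (tot F K L).d (n - 1) n y = x
  have key : ∀ (k : ℕ) (x : (tot F K L).X n), (tot F K L).d n (n + 1) x = 0 →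
      (∀ p q h, p < N + 1 - k → totπ F K L p q n h x = 0) →
      ∃ y : (tot F K L).X (n - 1), (tot F K L).d (n - 1) n y = x := by
    intro k
    induction k with
    | zero =>
      intro x _ hx
      refine ⟨0, ?_⟩
      rw [map_zero]
      refine (tot_ext F K L fun p q h => ?_).symm
      by_cases hp : p < N + 1
      · exact hx p q h (by simpa using hp)
      · have h1 : IsZero ((F.obj (K.X p)).obj (L.X q)) :=
          ((evaluation _ _).obj (L.X q)).map_isZero
            (F.map_isZero (K.isZero_of_isStrictlyLE N p (by lia)))
        exact (ModuleCat.subsingleton_of_isZero h1).elim _ _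
    | succ k ih =>
      intro x hx hp
      -- The leftmost column that can be nonzero. Nothing enters it horizontally, so its component
      -- is a vertical cycle.
      let p : ℤ := N + 1 - (k + 1 : ℕ)
      have h1 : (F.obj (K.X p)).map (L.d (n - p) (n - p + 1))
          (totπ F K L p (n - p) n (by lia) x) = 0 := by
        have := ConcreteCategory.congr_hom
          (tot_d_π F K L p (n - p + 1) (p - 1) (n - p) n (n + 1) (by lia) rfl (by lia) rfl) x
        have h2 : totπ F K L p (n - p + 1) (n + 1) (by lia) ((tot F K L).d n (n + 1) x) =
          (F.map (K.d (p - 1) p)).app (L.X (n - p + 1)) (totπ F K L (p - 1) (n - p + 1) n (by lia) x)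
          + p.negOnePow • ((F.obj (K.X p)).map (L.d (n - p) (n - p + 1))
            (totπ F K L p (n - p) n (by lia) x)) := this
        rw [hx, map_zero, hp _ _ _ (by lia), map_zero, zero_add] at h2
        exact (smul_eq_zero_iff_eq _).1 h2.symm
      have h2 := hF p _ ((exactAt_iff' _ (n - p - 1) (n - p) (n - p + 1) (by simp) (by simp)).1
        (hL (n - p)))
      rw [ShortComplex.moduleCat_exact_iff] at h2
      obtain ⟨w, hw⟩ := h2 _ h1
      change (F.obj (K.X p)).obj (L.X (n - p - 1)) at w
      change (F.obj (K.X p)).map (L.d (n - p - 1) (n - p)) w = _ at hw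
      obtain ⟨y, hy, hy'⟩ := exists_tot_d F K L p (n - p) (n - p - 1) n (n - 1) (by lia)
        (by lia) (by lia) w
      obtain ⟨z, hz⟩ := ih (x - (tot F K L).d (n - 1) n y) (by
          rw [map_sub, hx, zero_sub, neg_eq_zero]
          exact ConcreteCategory.congr_hom ((tot F K L).d_comp_d (n - 1) n (n + 1)) y) (by
        intro p' q' h hp'
        rw [map_sub]
        obtain hpp | hpp : p' = p ∨ p' < p := by lia
        · obtain rfl := hpp
          obtain rfl : q' = n - p := by lia
          rw [hy, hw, sub_self]
        · rw [hp _ _ _ (by lia), hy' _ _ _ hpp, sub_zero])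
      exact ⟨z + y, by rw [map_add, hz, sub_add_cancel]⟩
  -- A lower bound `b` of the support fixes the number of columns to clear.
  obtain ⟨s, hs⟩ := tot_exists_eq_sum F K L x
  obtain ⟨b, hb⟩ : ∃ b : ℤ, ∀ p ∈ s, b ≤ p := by
    obtain ⟨b, hb⟩ := s.finite_toSet.bddBelow
    exact ⟨b, fun p hp => hb hp⟩
  refine key (N + 1 - b).toNat x hx fun p q h hp => ?_
  obtain rfl : q = n - p := by lia
  rw [hs s subset_rfl, map_sum]
  refine Finset.sum_eq_zero fun p' hp' => ?_
  have := hb p' hp'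
  exact ConcreteCategory.congr_hom (totι_π_of_ne F K L p' (n - p') n (by lia) p (n - p) h (by lia)) _

/-- Exactness is checked column by column, and preimages are assembled over the finite support of
the given element. -/
lemma shortExact_tot (hF : ∀ p, PreservesExact (F.obj (K.X p)))
    {S : ShortComplex (CochainComplex (ModuleCat.{u} B) ℤ)} (hS : S.ShortExact) :
    (S.map ((F.map₂CochainComplex).obj K)).ShortExact := by
  apply shortExact_of_degreewise_shortExact
  intro n
  have hS' (p : ℤ) := (hF p).shortExact (hS.map_of_exact (HomologicalComplex.eval _ _ (n - p)))
  let S' (p : ℤ) := (S.map (HomologicalComplex.eval _ _ (n - p))).map (F.obj (K.X p))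
  have hf (p : ℤ) (x : (tot F K S.X₁).X n) :=
    ConcreteCategory.congr_hom (totMap_π F K S.f p (n - p) n (by lia)) x
  have hg (p : ℤ) (x : (tot F K S.X₂).X n) :=
    ConcreteCategory.congr_hom (totMap_π F K S.g p (n - p) n (by lia)) x
  refine { exact := ?_, mono_f := ?_, epi_g := ?_ }
  · rw [ShortComplex.moduleCat_exact_iff]
    intro x hx
    change (tot F K S.X₂).X n at x
    change ∃ a : (tot F K S.X₁).X n, (totMap F K S.f).f n a = x
    have hex (p : ℤ) : ∃ y : (F.obj (K.X p)).obj (S.X₁.X (n - p)),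
        (F.obj (K.X p)).map (S.f.f (n - p)) y = totπ F K S.X₂ p (n - p) n (by lia) x := by
      refine ((S' p).moduleCat_exact_iff.1 (hS' p).exact) _ ?_
      refine (hg p x).symm.trans ?_
      change totπ F K S.X₃ p (n - p) n (by lia) ((totMap F K S.g).f n x) = 0
      exact (congrArg _ hx).trans (map_zero _)
    choose y hy using hex
    obtain ⟨s, hs⟩ := tot_exists_eq_sum F K S.X₂ x
    refine ⟨∑ p ∈ s, totι F K S.X₁ p (n - p) n (by lia) (y p), ?_⟩
    rw [map_sum, hs s subset_rfl]
    refine Finset.sum_congr rfl fun p _ => ?_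
    rw [← hy p]
    exact ConcreteCategory.congr_hom (totι_totMap F K S.f p (n - p) n (by lia)) (y p)
  · change Mono ((totMap F K S.f).f n)
    rw [ModuleCat.mono_iff_injective, injective_iff_map_eq_zero]
    intro x hx
    refine tot_ext F K S.X₁ fun p q h => ?_
    obtain rfl : q = n - p := by lia
    have := (hS' p).mono_f
    apply (ModuleCat.mono_iff_injective _).1 this
    refine ((hf p x).symm.trans ?_).trans (map_zero _).symm
    change totπ F K S.X₂ p (n - p) n (by lia) ((totMap F K S.f).f n x) = 0
    rw [hx, map_zero]
  · change Epi ((totMap F K S.g).f n)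
    rw [ModuleCat.epi_iff_surjective]
    intro x
    change (tot F K S.X₃).X n at x
    have hex (p : ℤ) : ∃ y : (F.obj (K.X p)).obj (S.X₂.X (n - p)),
        (F.obj (K.X p)).map (S.g.f (n - p)) y = totπ F K S.X₃ p (n - p) n (by lia) x := by
      have := (hS' p).epi_g
      exact (ModuleCat.epi_iff_surjective _).1 this _
    choose y hy using hex
    obtain ⟨s, hs⟩ := tot_exists_eq_sum F K S.X₃ x
    refine ⟨∑ p ∈ s, totι F K S.X₂ p (n - p) n (by lia) (y p), ?_⟩
    rw [map_sum, hs s subset_rfl]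
    refine Finset.sum_congr rfl fun p _ => ?_
    rw [← hy p]
    exact ConcreteCategory.congr_hom (totι_totMap F K S.g p (n - p) n (by lia)) (y p)

end Bifunctor
end

end CIDepth

/-! ### Exact functors on complexes that preserve acyclicity -/

namespace CIDepth
noncomputable section

open HomologicalComplex CochainComplex ZeroObject

lemma isZero_toD_iff {A : Type u} [CommRing A] (L : CochainComplex (ModuleCat.{u} A) ℤ) :
    IsZero ((toD A).obj L) ↔ L.Acyclic := by
  constructor
  · intro h i
    rw [exactAt_iff_isZero_homology]
    exact ((DerivedCategory.homologyFunctorFactors (ModuleCat.{u} A) i).app L).isZero_iff.1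
      ((hD A i).map_isZero h)
  · intro h
    have : QuasiIso (0 : L ⟶ 0) := by
      rw [quasiIso_iff]
      intro i
      rw [quasiIsoAt_iff_exactAt _ _ (h i)]
      rw [exactAt_iff_isZero_homology]
      exact (homologyFunctor _ _ i).map_isZero (isZero_zero _)
    have : IsIso ((toD A).map (0 : L ⟶ 0)) :=
      (DerivedCategory.isIso_Q_map_iff_quasiIso (C := ModuleCat.{u} A) (0 : L ⟶ 0)).2 this
    exact ((toD A).map_isZero (isZero_zero _)).of_iso (asIso ((toD A).map (0 : L ⟶ 0)))

lemma quasiIso_iff_acyclic_mappingCone {A : Type u} [CommRing A]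
    {K L : CochainComplex (ModuleCat.{u} A) ℤ} (f : K ⟶ L) :
    QuasiIso f ↔ (mappingCone f).Acyclic := by
  rw [← isZero_toD_iff, ← DerivedCategory.isIso_Q_map_iff_quasiIso]
  exact (Triangle.isZero₃_iff_isIso₁ _ (DerivedCategory.mappingCone_triangle_distinguished f)).symm

section Cone

variable {A : Type u} [CommRing A] {K L : CochainComplex (ModuleCat.{u} A) ℤ} (f : K ⟶ L)

/-- The mapping cone of `f` as a quotient of the direct sum of the target and of the cone of the
identity of the source. -/
def coneSES : ShortComplex (CochainComplex (ModuleCat.{u} A) ℤ) :=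
  ShortComplex.mk (biprod.lift f (mappingCone.inr (𝟙 K)))
    (biprod.desc (mappingCone.inr f) (-mappingCone.map (𝟙 K) f (𝟙 K) f (by simp)))
    (by simp [mappingCone.map])

/-- The degreewise section of `coneSES`. -/
def coneSection (n : ℤ) : (mappingCone f).X n ⟶ (L ⊞ mappingCone (𝟙 K)).X n :=
  (mappingCone.snd f).v n n (add_zero n) ≫ (biprod.inl : _ ⟶ L ⊞ mappingCone (𝟙 K)).f n -
    (mappingCone.fst f).1.v n (n + 1) rfl ≫ (mappingCone.inl (𝟙 K)).v (n + 1) n (by lia) ≫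
      (biprod.inr : _ ⟶ L ⊞ mappingCone (𝟙 K)).f n

lemma coneSection_id (n : ℤ) :
    ((biprod.snd : L ⊞ mappingCone (𝟙 K) ⟶ _).f n ≫ (mappingCone.snd (𝟙 K)).v n n (add_zero n)) ≫
      (biprod.lift f (mappingCone.inr (𝟙 K))).f n +
    (biprod.desc (mappingCone.inr f) (-mappingCone.map (𝟙 K) f (𝟙 K) f (by simp))).f n ≫
      coneSection f n = 𝟙 ((L ⊞ mappingCone (𝟙 K)).X n) := by
  have h1 : (mappingCone.inr f).f n ≫ coneSection f n =
      (biprod.inl : _ ⟶ L ⊞ mappingCone (𝟙 K)).f n := by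
    simp [coneSection]
  have h2 : (mappingCone.snd (𝟙 K)).v n n (add_zero n) ≫
        (biprod.lift f (mappingCone.inr (𝟙 K))).f n +
      (-mappingCone.map (𝟙 K) f (𝟙 K) f (by simp)).f n ≫ coneSection f n =
        (biprod.inr : _ ⟶ L ⊞ mappingCone (𝟙 K)).f n := by
    rw [biprod.lift_eq]
    apply mappingCone.ext_from (𝟙 K) (n + 1) n rfl <;> simp [mappingCone.map, coneSection]
  have h3 := congrArg (fun φ => φ.f n) (biprod.total (X := L) (Y := mappingCone (𝟙 K)))
  refine Eq.trans ?_ h3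
  rw [biprod.desc_eq, HomologicalComplex.add_f_apply, Preadditive.add_comp,
    HomologicalComplex.comp_f, HomologicalComplex.comp_f, Category.assoc, Category.assoc,
    Category.assoc, h1, add_left_comm, ← Preadditive.comp_add, h2]
  rfl

lemma coneSES_shortExact : (coneSES f).ShortExact := by
  apply shortExact_of_degreewise_shortExact
  intro n
  refine ShortComplex.Splitting.shortExact
    { r := (biprod.snd : L ⊞ mappingCone (𝟙 K) ⟶ _).f n ≫
        (mappingCone.snd (𝟙 K)).v n n (add_zero n)
      s := coneSection f n
      f_r := ?_
      s_g := ?_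
      id := coneSection_id f n }
  · change (biprod.lift f (mappingCone.inr (𝟙 K))).f n ≫ _ ≫ _ = 𝟙 (K.X n)
    rw [← Category.assoc, ← HomologicalComplex.comp_f, biprod.lift_snd]
    simp
  · change coneSection f n ≫ (biprod.desc (mappingCone.inr f) _).f n = 𝟙 ((mappingCone f).X n)
    rw [coneSection, Preadditive.sub_comp, Category.assoc, Category.assoc, Category.assoc,
      ← HomologicalComplex.comp_f, ← HomologicalComplex.comp_f, biprod.inl_desc, biprod.inr_desc]
    apply mappingCone.ext_from f (n + 1) n rfl <;> simp [mappingCone.map]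

end Cone

/-- A functor on complexes which is exact and preserves acyclic complexes. -/
structure IsHomologicallyExact {A B : Type u} [CommRing A] [CommRing B]
    (Φ : CochainComplex (ModuleCat.{u} A) ℤ ⥤ CochainComplex (ModuleCat.{u} B) ℤ)
    [Φ.Additive] : Prop where
  shortExact : ∀ S : ShortComplex (CochainComplex (ModuleCat.{u} A) ℤ), S.ShortExact →
    (S.map Φ).ShortExact
  acyclic : ∀ L, L.Acyclic → (Φ.obj L).Acyclic

namespace IsHomologicallyExact

variable {A B : Type u} [CommRing A] [CommRing B]
    {Φ : CochainComplex (ModuleCat.{u} A) ℤ ⥤ CochainComplex (ModuleCat.{u} B) ℤ}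
    [Φ.Additive] (hΦ : IsHomologicallyExact Φ)

include hΦ

lemma isIso_of_shortExact {S : ShortComplex (CochainComplex (ModuleCat.{u} A) ℤ)} (hS : S.ShortExact)
    (h : S.X₁.Acyclic) : IsIso ((toD B).map (Φ.map S.g)) := by
  have hT := DerivedCategory.triangleOfSES_distinguished (hΦ.shortExact S hS)
  exact (Triangle.isZero₁_iff_isIso₂ _ hT).1 ((isZero_toD_iff _).2 (hΦ.acyclic _ h))

/-- No compatibility of `Φ` with mapping cones or shifts is assumed. The cone is instead reached by
the short exact sequence 0 → K → L ⊕ cone(id_K) → cone(f) → 0, which `Φ` preserves. The contractible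
summand becomes invisible because `Φ` preserves acyclic complexes. -/
lemma exists_distinguished {K L : CochainComplex (ModuleCat.{u} A) ℤ} (f : K ⟶ L) :
    ∃ (g : _ ⟶ (toD B).obj (Φ.obj (mappingCone f))) (h : _),
      Triangle.mk ((toD B).map (Φ.map f)) g h ∈ distTriang (D B) := by
  have hT := DerivedCategory.triangleOfSES_distinguished (hΦ.shortExact _ (coneSES_shortExact f))
  let S : ShortComplex (CochainComplex (ModuleCat.{u} A) ℤ) :=
    ShortComplex.mk (biprod.inr : mappingCone (𝟙 K) ⟶ L ⊞ mappingCone (𝟙 K)) biprod.fst (by simp)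
  have hS : S.ShortExact :=
    ShortComplex.Splitting.shortExact { r := biprod.snd, s := biprod.inl, id := (add_comm _ _).trans biprod.total }
  have hac : (mappingCone (𝟙 K)).Acyclic := by
    rw [← quasiIso_iff_acyclic_mappingCone]
    infer_instance
  have := hΦ.isIso_of_shortExact hS hac
  change IsIso ((toD B).map (Φ.map (biprod.fst : L ⊞ mappingCone (𝟙 K) ⟶ L))) at this
  let e := asIso ((toD B).map (Φ.map (biprod.fst : L ⊞ mappingCone (𝟙 K) ⟶ L)))
  refine ⟨e.inv ≫ (DerivedCategory.triangleOfSES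
      (hΦ.shortExact _ (coneSES_shortExact f))).mor₂,
    (DerivedCategory.triangleOfSES (hΦ.shortExact _ (coneSES_shortExact f))).mor₃,
    isomorphic_distinguished _ hT _ (Triangle.isoMk _ _ (Iso.refl _) e.symm (Iso.refl _) ?_ ?_ ?_)⟩
  · change (toD B).map (Φ.map f) ≫ e.inv =
      𝟙 _ ≫ (toD B).map (Φ.map (biprod.lift f (mappingCone.inr (𝟙 K))))
    rw [Category.id_comp, Iso.comp_inv_eq]
    change _ = (toD B).map (Φ.map _) ≫ (toD B).map (Φ.map _)
    rw [← Functor.map_comp, ← Functor.map_comp, biprod.lift_fst]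
  · exact Category.comp_id _
  · change _ ≫ (𝟙 _)⟦(1 : ℤ)⟧' = 𝟙 _ ≫ _
    rw [CategoryTheory.Functor.map_id]
    exact (Category.comp_id _).trans (Category.id_comp _).symm

lemma quasiIso_map {K L : CochainComplex (ModuleCat.{u} A) ℤ} (f : K ⟶ L) (hf : QuasiIso f) :
    IsIso ((toD B).map (Φ.map f)) := by
  obtain ⟨g, h, hT⟩ := hΦ.exists_distinguished f
  exact (Triangle.isZero₃_iff_isIso₁ _ hT).1 ((isZero_toD_iff _).2
    (hΦ.acyclic _ ((quasiIso_iff_acyclic_mappingCone f).1 hf)))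

lemma isConeMul (x : A) (y : B) (hxy : ∀ L, Φ.map (x • 𝟙 L) = y • 𝟙 _)
    (L : CochainComplex (ModuleCat.{u} A) ℤ) :
    IsConeMul y ((toD B).obj (Φ.obj L)) ((toD B).obj (Φ.obj (coneMul x L))) := by
  obtain ⟨g, h, hT⟩ := hΦ.exists_distinguished (x • 𝟙 L)
  refine isConeMul_of_distinguished ?_ hT
  rw [hxy, CategoryTheory.Functor.map_smul, CategoryTheory.Functor.map_id]

end IsHomologicallyExact

lemma IsHomologicallyExact.isKoszul {A : Type u} [CommRing A]
    {Φ : CochainComplex (ModuleCat.{u} A) ℤ ⥤ CochainComplex (ModuleCat.{u} A) ℤ}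
    [Φ.Additive] (hΦ : IsHomologicallyExact Φ)
    (hsmul : ∀ (x : A) L, Φ.map (x • 𝟙 L) = x • 𝟙 _) (xs : List A)
    (L : CochainComplex (ModuleCat.{u} A) ℤ) :
    IsKoszul xs ((toD A).obj (Φ.obj L)) ((toD A).obj (Φ.obj (koszul xs L))) := by
  induction xs generalizing L with
  | nil => exact .nil (Iso.refl _)
  | cons x xs ih => exact .cons (hΦ.isConeMul x x (hsmul x) L) (ih _)


end

end CIDepth

/-! ### Tensor products with bounded above flat complexes -/

namespace CIDepth
noncomputable section

open HomologicalComplex CochainComplex MonoidalCategory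

/-- Families of homomorphisms presenting an additive group as a direct sum. -/
structure IsDecomposition {M : Type*} {N : ℤ → Type*} [AddCommGroup M] [∀ p, AddCommGroup (N p)]
    (ι : ∀ p, N p →+ M) (π : ∀ p, M →+ N p) : Prop where
  self : ∀ p x, π p (ι p x) = x
  ne : ∀ p q x, p ≠ q → π q (ι p x) = 0
  sum : ∀ x, ∃ s : Finset ℤ, ∀ t, s ⊆ t → x = ∑ p ∈ t, ι p (π p x)

lemma IsDecomposition.bijective {M M' : Type*} {N N' : ℤ → Type*} [AddCommGroup M]
    [AddCommGroup M'] [∀ p, AddCommGroup (N p)] [∀ p, AddCommGroup (N' p)]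
    {ι : ∀ p, N p →+ M} {π : ∀ p, M →+ N p} {ι' : ∀ p, N' p →+ M'} {π' : ∀ p, M' →+ N' p}
    (h : IsDecomposition ι π) (h' : IsDecomposition ι' π') (f : M →+ M') (θ : ∀ p, N p →+ N' p)
    (hθ : ∀ p, Function.Bijective (θ p)) (hf : ∀ p x, f (ι p x) = ι' p (θ p x)) :
    Function.Bijective f := by
  classical
  constructor
  · rw [injective_iff_map_eq_zero]
    intro x hx
    obtain ⟨s, hs⟩ := h.sum x
    rw [hs s subset_rfl]
    refine Finset.sum_eq_zero fun p hp => ?_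
    have h1 : θ p (π p x) = 0 := by
      have h2 : f x = ∑ p ∈ s, ι' p (θ p (π p x)) := by
        conv_lhs => rw [hs s subset_rfl]
        rw [map_sum]
        exact Finset.sum_congr rfl fun p _ => hf _ _
      have h3 := congrArg (π' p) (h2.symm.trans hx)
      rwa [map_sum, Finset.sum_eq_single_of_mem p hp (fun q _ hq => h'.ne _ _ _ hq), h'.self,
        map_zero] at h3
    rw [(injective_iff_map_eq_zero _).1 (hθ p).1 _ h1, map_zero]
  · intro y
    obtain ⟨s, hs⟩ := h'.sum y
    choose z hz using fun p => (hθ p).2 (π' p y)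
    refine ⟨∑ p ∈ s, ι p (z p), ?_⟩
    rw [map_sum, hs s subset_rfl]
    exact Finset.sum_congr rfl fun p _ => by rw [hf, hz]

section Bifunctor

variable {A B C : Type u} [CommRing A] [CommRing B] [CommRing C]
  (F : ModuleCat.{u} A ⥤ ModuleCat.{u} B ⥤ ModuleCat.{u} C)
  [F.Additive] [∀ X, (F.obj X).Additive]
  (K : CochainComplex (ModuleCat.{u} A) ℤ) (L : CochainComplex (ModuleCat.{u} B) ℤ)

lemma isDecomposition_tot (n : ℤ) :
    IsDecomposition (fun p => (totι F K L p (n - p) n (by lia)).hom.toAddMonoidHom)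
      (fun p => (totπ F K L p (n - p) n (by lia)).hom.toAddMonoidHom) where
  self p x := ConcreteCategory.congr_hom (totι_π_self F K L p (n - p) n (by lia)) x
  ne p q x h := ConcreteCategory.congr_hom
    (totι_π_of_ne F K L p (n - p) n (by lia) q (n - q) (by lia) h) x
  sum x := tot_exists_eq_sum F K L x

variable {F K L}

/-- Morphisms from the total complex. -/
def totDesc {T : CochainComplex (ModuleCat.{u} C) ℤ}
    (t : ∀ p q n (_ : p + q = n), (F.obj (K.X p)).obj (L.X q) ⟶ T.X n)
    (ht : ∀ p q n n' (h : p + q = n) (h' : n + 1 = n'), t p q n h ≫ T.d n n' =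
      (F.map (K.d p (p + 1))).app (L.X q) ≫ t (p + 1) q n' (by lia) +
      p.negOnePow • ((F.obj (K.X p)).map (L.d q (q + 1)) ≫ t p (q + 1) n' (by lia))) :
    tot F K L ⟶ T where
  f n := mapBifunctorDesc fun p q h => t p q n h
  comm' n n' hn := by
    apply mapBifunctor.hom_ext
    intro p q h
    rw [ι_mapBifunctorDesc_assoc, ht p q n n' h hn]
    have := totι_d F K L p q n n' h hn
    change _ = totι F K L p q n h ≫ _
    rw [← Category.assoc, this, Preadditive.add_comp, Linear.units_smul_comp, Category.assoc,
      Category.assoc, ι_mapBifunctorDesc, ι_mapBifunctorDesc]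

lemma totι_totDesc {T : CochainComplex (ModuleCat.{u} C) ℤ}
    (t : ∀ p q n (_ : p + q = n), (F.obj (K.X p)).obj (L.X q) ⟶ T.X n) (ht) (p q n : ℤ)
    (h : p + q = n) : totι F K L p q n h ≫ (totDesc t ht).f n = t p q n h :=
  ι_mapBifunctorDesc (fun p q h => t p q n h) p q h

lemma isIso_of_bijective {T T' : CochainComplex (ModuleCat.{u} C) ℤ} (f : T ⟶ T')
    (hf : ∀ n, Function.Bijective (f.f n)) : IsIso f := by
  have (n : ℤ) : IsIso (f.f n) := (ConcreteCategory.isIso_iff_bijective _).2 (hf n)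
  exact HomologicalComplex.Hom.isIso_of_components f

end Bifunctor

section Tensor

variable {A : Type u} [CommRing A]

lemma preservesExact_curriedTensor (M : ModuleCat.{u} A) [Module.Flat A M] :
    PreservesExact ((curriedTensor (ModuleCat.{u} A)).obj M) := fun S hS =>
  Module.Flat.lTensor_shortComplex_exact M S hS

lemma preservesExact_flip_curriedTensor (M : ModuleCat.{u} A) [Module.Flat A M] :
    PreservesExact ((curriedTensor (ModuleCat.{u} A)).flip.obj M) := fun S hS =>
  Module.Flat.rTensor_shortComplex_exact M S hS

/-- Tensor product on the left by a complex. -/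
abbrev tensL (P : CochainComplex (ModuleCat.{u} A) ℤ) :
    CochainComplex (ModuleCat.{u} A) ℤ ⥤ CochainComplex (ModuleCat.{u} A) ℤ :=
  ((curriedTensor (ModuleCat.{u} A)).map₂CochainComplex).obj P

lemma tensL_map_smul (P : CochainComplex (ModuleCat.{u} A) ℤ) (x : A)
    (L : CochainComplex (ModuleCat.{u} A) ℤ) : (tensL P).map (x • 𝟙 L) = x • 𝟙 _ := by
  ext n : 1
  apply mapBifunctor.hom_ext
  intro p q h
  refine (totι_totMap (curriedTensor (ModuleCat.{u} A)) P (x • 𝟙 L) p q n h).trans ?_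
  change (P.X p ◁ (x • 𝟙 (L.X q))) ≫ totι (curriedTensor (ModuleCat.{u} A)) P L p q n h =
    totι (curriedTensor (ModuleCat.{u} A)) P L p q n h ≫ (x • 𝟙 _)
  rw [MonoidalLinear.whiskerLeft_smul, Linear.smul_comp, MonoidalCategory.whiskerLeft_id]
  exact (congrArg (x • ·) ((Category.id_comp _).trans (Category.comp_id _).symm)).trans
    (Linear.comp_smul _ _ _ (totι (curriedTensor (ModuleCat.{u} A)) P L p q n h) x (𝟙 _)).symm

variable (P : CochainComplex (ModuleCat.{u} A) ℤ) (hP : ∃ n, P.IsStrictlyLE n)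
  (hflat : ∀ i, Module.Flat A (P.X i))

include hP hflat

lemma isHomologicallyExact_tensL : IsHomologicallyExact (tensL P) where
  shortExact _ hS := shortExact_tot _ P (fun _ => preservesExact_curriedTensor _) hS
  acyclic L hL := acyclic_tot _ P L hP (fun _ => preservesExact_curriedTensor _) hL

lemma nonempty_iso_tensL {K L : CochainComplex (ModuleCat.{u} A) ℤ} (f : K ⟶ L) (hf : QuasiIso f) :
    Nonempty ((toD A).obj (HomologicalComplex.tensorObj P K) ≅ (toD A).obj (HomologicalComplex.tensorObj P L)) := by
  have := (isHomologicallyExact_tensL P hP hflat).quasiIso_map f hf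
  exact ⟨@asIso _ _ _ _ _ this⟩

lemma nonempty_iso_tensR {K L : CochainComplex (ModuleCat.{u} A) ℤ} (f : K ⟶ L) (hf : QuasiIso f) :
    Nonempty ((toD A).obj (HomologicalComplex.tensorObj K P) ≅ (toD A).obj (HomologicalComplex.tensorObj L P)) := by
  let F := (curriedTensor (ModuleCat.{u} A)).flip
  have h : IsHomologicallyExact ((F.map₂CochainComplex).obj P) :=
    { shortExact := fun _ hS => shortExact_tot _ P (fun _ => preservesExact_flip_curriedTensor _) hS
      acyclic := fun L hL => acyclic_tot _ P L hP (fun _ => preservesExact_flip_curriedTensor _) hL }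
  have := h.quasiIso_map f hf
  let e (K : CochainComplex (ModuleCat.{u} A) ℤ) : tot F P K ≅ HomologicalComplex.tensorObj K P :=
    mapBifunctorFlipIso K P (curriedTensor (ModuleCat.{u} A)) (ComplexShape.up ℤ)
  exact ⟨(toD A).mapIso (e K).symm ≪≫ @asIso _ _ _ _ _ this ≪≫
    (toD A).mapIso (e L)⟩

end Tensor

end

end CIDepth

/-! ### Base change of tensor products and the projection formula -/

namespace CIDepth
noncomputable section

open HomologicalComplex CochainComplex MonoidalCategory
open Functor.LaxMonoidal Functor.OplaxMonoidal

section Comparison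

variable {A B C A' B' C' : Type u} [CommRing A] [CommRing B] [CommRing C]
  [CommRing A'] [CommRing B'] [CommRing C']
  {F : ModuleCat.{u} A ⥤ ModuleCat.{u} B ⥤ ModuleCat.{u} C}
  [F.Additive] [∀ X, (F.obj X).Additive]
  {F' : ModuleCat.{u} A' ⥤ ModuleCat.{u} B' ⥤ ModuleCat.{u} C'}
  [F'.Additive] [∀ X, (F'.obj X).Additive]
  {K : CochainComplex (ModuleCat.{u} A) ℤ} {L : CochainComplex (ModuleCat.{u} B) ℤ}
  {K' : CochainComplex (ModuleCat.{u} A') ℤ} {L' : CochainComplex (ModuleCat.{u} B') ℤ}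
  (G : ModuleCat.{u} C' ⥤ ModuleCat.{u} C) [G.Additive]

/-- A comparison isomorphism for total complexes. -/
lemma nonempty_iso_tot
    (θ : ∀ p q, (F.obj (K.X p)).obj (L.X q) ⟶ G.obj ((F'.obj (K'.X p)).obj (L'.X q)))
    (h₁ : ∀ p p' q, (F.map (K.d p p')).app (L.X q) ≫ θ p' q =
      θ p q ≫ G.map ((F'.map (K'.d p p')).app (L'.X q)))
    (h₂ : ∀ p q q', (F.obj (K.X p)).map (L.d q q') ≫ θ p q' =
      θ p q ≫ G.map ((F'.obj (K'.X p)).map (L'.d q q')))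
    (hθ : ∀ p q, Function.Bijective (θ p q))
    (hG : ∀ n, IsDecomposition
      (fun p => (G.map (totι F' K' L' p (n - p) n (by lia))).hom.toAddMonoidHom)
      (fun p => (G.map (totπ F' K' L' p (n - p) n (by lia))).hom.toAddMonoidHom)) :
    Nonempty (tot F K L ≅ (G.mapHomologicalComplex _).obj (tot F' K' L')) := by
  let φ : tot F K L ⟶ (G.mapHomologicalComplex _).obj (tot F' K' L') :=
    totDesc (fun p q n h => θ p q ≫ G.map (totι F' K' L' p q n h)) (by
      intro p q n n' h h'
      change (θ p q ≫ G.map _) ≫ G.map ((tot F' K' L').d n n') = _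
      rw [Category.assoc, ← G.map_comp, totι_d F' K' L' p q n n' h h', G.map_add,
        Functor.map_units_smul, G.map_comp, G.map_comp, Preadditive.comp_add,
        Linear.comp_units_smul, ← Category.assoc, ← Category.assoc, ← h₁, ← h₂, Category.assoc,
        Category.assoc]
      rfl)
  have : IsIso φ := by
    apply isIso_of_bijective
    intro n
    refine (isDecomposition_tot F K L n).bijective (hG n) (φ.f n).hom.toAddMonoidHom
      (fun p => (θ p (n - p)).hom.toAddMonoidHom) (fun p => hθ _ _) (fun p x => ?_)
    exact ConcreteCategory.congr_hom (totι_totDesc _ _ p (n - p) n (by lia)) x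
  exact ⟨asIso φ⟩

end Comparison

lemma exists_eq_sum_add {M : Type*} [AddCommGroup M] (ψ : ℤ → M →+ M) {x y : M}
    (hx : ∃ s : Finset ℤ, ∀ t, s ⊆ t → x = ∑ p ∈ t, ψ p x)
    (hy : ∃ s : Finset ℤ, ∀ t, s ⊆ t → y = ∑ p ∈ t, ψ p y) :
    ∃ s : Finset ℤ, ∀ t, s ⊆ t → x + y = ∑ p ∈ t, ψ p (x + y) := by
  classical
  obtain ⟨s, hs⟩ := hx
  obtain ⟨t, ht⟩ := hy
  refine ⟨s ∪ t, fun v hv => ?_⟩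
  conv_lhs => rw [hs v (Finset.union_subset_left hv), ht v (Finset.union_subset_right hv)]
  rw [← Finset.sum_add_distrib]
  exact Finset.sum_congr rfl fun p _ => by rw [map_add]

variable {Q S : Type u} [CommRing Q] [CommRing S] (g : Q →+* S)

lemma nonempty_extendScalars_tensorObj_iso (K L : CochainComplex (ModuleCat.{u} Q) ℤ) :
    Nonempty (HomologicalComplex.tensorObj
        (((ModuleCat.extendScalars g).mapHomologicalComplex _).obj K)
        (((ModuleCat.extendScalars g).mapHomologicalComplex _).obj L) ≅
      ((ModuleCat.extendScalars g).mapHomologicalComplex _).obj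
        (HomologicalComplex.tensorObj K L)) := by
  refine nonempty_iso_tot (ModuleCat.extendScalars g)
    (fun p q => μ (ModuleCat.extendScalars g) (K.X p) (L.X q)) ?_ ?_ ?_ ?_
  · intro p p' q
    exact μ_natural_left (ModuleCat.extendScalars g) (K.d p p') (L.X q)
  · intro p q q'
    exact μ_natural_right (ModuleCat.extendScalars g) (K.X p) (L.d q q')
  · intro p q
    exact ConcreteCategory.bijective_of_isIso (μ (ModuleCat.extendScalars g) (K.X p) (L.X q))
  · intro n
    have h := isDecomposition_tot (curriedTensor (ModuleCat.{u} Q)) K L n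
    let T := tot (curriedTensor (ModuleCat.{u} Q)) K L
    let G := ModuleCat.extendScalars g
    refine ⟨fun p x => ?_, fun p q x hpq => ?_, fun x => ?_⟩
    · have := congrArg (ModuleCat.extendScalars g).map
        (totι_π_self (curriedTensor (ModuleCat.{u} Q)) K L p (n - p) n (by lia))
      rw [Functor.map_comp, CategoryTheory.Functor.map_id] at this
      exact ConcreteCategory.congr_hom this x
    · have := congrArg (ModuleCat.extendScalars g).map
        (totι_π_of_ne (curriedTensor (ModuleCat.{u} Q)) K L p (n - p) n (by lia) q (n - q)
          (by lia) hpq)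
      rw [Functor.map_comp, CategoryTheory.Functor.map_zero] at this
      exact ConcreteCategory.congr_hom this x
    · let := g.toAlgebra
      let ψ (p : ℤ) : TensorProduct Q S (T.X n) →+ TensorProduct Q S (T.X n) :=
        (G.map (totι _ K L p (n - p) n (by lia))).hom.toAddMonoidHom.comp
          (G.map (totπ _ K L p (n - p) n (by lia))).hom.toAddMonoidHom
      change TensorProduct Q S (T.X n) at x
      change ∃ s : Finset ℤ, ∀ t, s ⊆ t → x = ∑ p ∈ t, ψ p x
      induction x using TensorProduct.induction_on with
      | zero => exact ⟨∅, fun t _ => by simp⟩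
      | add x y hx hy => exact exists_eq_sum_add ψ hx hy
      | tmul a x =>
        obtain ⟨s, hs⟩ := h.sum x
        refine ⟨s, fun t ht => ?_⟩
        conv_lhs => rw [hs t ht, TensorProduct.tmul_sum]
        rfl

/-- The projection formula map. -/
def projFormula (M : ModuleCat.{u} S) (N : ModuleCat.{u} Q) :
    (ModuleCat.restrictScalars g).obj M ⊗ N ⟶
      (ModuleCat.restrictScalars g).obj (M ⊗ (ModuleCat.extendScalars g).obj N) :=
  (ModuleCat.restrictScalars g).obj M ◁ (ModuleCat.extendRestrictScalarsAdj g).unit.app N ≫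
    μ (ModuleCat.restrictScalars g) M ((ModuleCat.extendScalars g).obj N)

/-- This is the cancellation M ⊗_S (S ⊗_Q N) ≅ M ⊗_Q N. The categorical form of the map makes its
naturality available. -/
lemma bijective_projFormula (M : ModuleCat.{u} S) (N : ModuleCat.{u} Q) :
    Function.Bijective (projFormula g M N) := by
  let := g.toAlgebra
  let : Module Q M := Module.compHom M g
  have : IsScalarTower Q S M := ⟨fun q s m => mul_smul (g q) s m⟩
  let e := TensorProduct.AlgebraTensorModule.cancelBaseChange Q S S M N
  have h (x : TensorProduct Q M N) : projFormula g M N x = e.symm x := by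
    induction x using TensorProduct.induction_on with
    | zero => rw [map_zero]; exact map_zero _
    | add x y hx hy => rw [map_add, ← hx, ← hy]; exact map_add _ _ _
    | tmul m n =>
      rw [TensorProduct.AlgebraTensorModule.cancelBaseChange_symm_tmul]
      exact ModuleCat.restrictScalars_μ_tmul g M ((ModuleCat.extendScalars g).obj N) m
        ((ModuleCat.extendRestrictScalarsAdj g).unit.app N n)
  have h' : ⇑(projFormula g M N) = ⇑e.symm := funext h
  rw [h']
  exact e.symm.bijective

lemma nonempty_restrictScalars_tensorObj_iso (P : CochainComplex (ModuleCat.{u} S) ℤ)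
    (L : CochainComplex (ModuleCat.{u} Q) ℤ) :
    Nonempty (HomologicalComplex.tensorObj
        (((ModuleCat.restrictScalars g).mapHomologicalComplex _).obj P) L ≅
      ((ModuleCat.restrictScalars g).mapHomologicalComplex _).obj
        (HomologicalComplex.tensorObj P
          (((ModuleCat.extendScalars g).mapHomologicalComplex _).obj L))) := by
  refine nonempty_iso_tot (ModuleCat.restrictScalars g) (fun p q => projFormula g (P.X p) (L.X q))
    ?_ ?_ (fun _ _ => bijective_projFormula g _ _) ?_
  · intro p p' q
    change (ModuleCat.restrictScalars g).map (P.d p p') ▷ L.X q ≫ projFormula g _ _ =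
      projFormula g _ _ ≫ (ModuleCat.restrictScalars g).map (P.d p p' ▷ _)
    rw [projFormula, projFormula, ← whisker_exchange_assoc, Category.assoc]
    exact congrArg (_ ≫ ·) (μ_natural_left (ModuleCat.restrictScalars g) (P.d p p')
      ((ModuleCat.extendScalars g).obj (L.X q)))
  · intro p q q'
    change _ ◁ L.d q q' ≫ projFormula g _ _ = projFormula g _ _ ≫
      (ModuleCat.restrictScalars g).map (_ ◁ (ModuleCat.extendScalars g).map (L.d q q'))
    rw [projFormula, projFormula, Category.assoc, ← μ_natural_right,
      ← MonoidalCategory.whiskerLeft_comp_assoc, ← MonoidalCategory.whiskerLeft_comp_assoc]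
    rw [Adjunction.unit_naturality]
  · intro n
    exact isDecomposition_tot _ P _ n

end

end CIDepth

/-! ### Surjective resolutions, reduction along a surjection, and self-extensions -/

namespace CIDepth
noncomputable section

open HomologicalComplex CochainComplex

/-- Surjective projective resolutions of bounded complexes. -/
lemma exists_epi_projRes {C : Type*} [Category C] [Abelian C] [EnoughProjectives C]
    (X : CochainComplex C ℤ) (n : ℤ) [X.IsStrictlyLE n] :
    ∃ (P : CochainComplex C ℤ) (π : P ⟶ X), Epi π ∧ QuasiIso π ∧
      (∀ i, Projective (P.X i)) ∧ P.IsStrictlyLE (n + 1) := by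
  let E := CochainComplex.opEquivalence C
  have hL : (E.functor.obj (Opposite.op X)).IsStrictlyGE (-n) := by
    rw [CochainComplex.isStrictlyGE_iff]
    intro i hi
    exact (X.isZero_of_isStrictlyLE n (-i) (by lia)).op
  obtain ⟨I, j, hj', hj, hI, hIn⟩ :=
    CochainComplex.Plus.modelCategoryQuillen.exists_mono_quasiIso_injective
      (E.functor.obj (Opposite.op X)) (-n - 1) (-n) (by lia)
  let g : Opposite.op X ⟶ E.inverse.obj I := E.unit.app _ ≫ E.inverse.map j
  have hg : E.functor.map g = j ≫ E.counitInv.app I := by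
    have h₁ : E.functor.map (E.unit.app (Opposite.op X)) =
        E.counitInv.app (E.functor.obj (Opposite.op X)) :=
      (E.counitInv_app_functor (Opposite.op X)).symm
    have h₂ := E.counitInv.naturality j
    rw [Functor.map_comp, h₁]
    exact h₂.symm
  have hq : QuasiIso g.unop := by
    apply quasiIso_of_op
    change QuasiIso (E.functor.map g)
    rw [hg]
    infer_instance
  have hm : Mono g := mono_comp _ _
  refine ⟨(E.inverse.obj I).unop, g.unop, inferInstance, hq, fun i => ?_, ?_⟩
  · have := hI (-i)
    change Projective (I.X (-i)).unop
    infer_instance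
  · rw [CochainComplex.isStrictlyLE_iff]
    intro i hi
    exact (I.isZero_of_isStrictlyGE (-n - 1) (-i) (by lia)).unop

section ExtendScalars

variable {Q S : Type u} [CommRing Q] [CommRing S] (g : Q →+* S)

/-- The canonical map to the extension of scalars. -/
abbrev extη (M : ModuleCat.{u} Q) :
    M ⟶ (ModuleCat.restrictScalars g).obj ((ModuleCat.extendScalars g).obj M) :=
  (ModuleCat.extendRestrictScalarsAdj g).unit.app M

variable (hg : Function.Surjective g)
include hg

lemma extη_surjective (M : ModuleCat.{u} Q) : Function.Surjective (extη g M) := by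
  let := g.toAlgebra
  intro x
  change TensorProduct Q S M at x
  change ∃ m : M, (1 : S) ⊗ₜ[Q] m = x
  induction x using TensorProduct.induction_on with
  | zero => exact ⟨0, TensorProduct.tmul_zero _ _⟩
  | add x y hx hy =>
    obtain ⟨m, rfl⟩ := hx
    obtain ⟨n, rfl⟩ := hy
    exact ⟨m + n, TensorProduct.tmul_add _ _ _⟩
  | tmul s m =>
    obtain ⟨q, rfl⟩ := hg s
    refine ⟨q • m, ?_⟩
    rw [← TensorProduct.smul_tmul, Algebra.smul_def, mul_one]
    rfl

lemma mem_of_extη_eq_zero (M : ModuleCat.{u} Q) {m : M} (hm : extη g M m = 0) :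
    m ∈ (RingHom.ker g) • (⊤ : Submodule Q M) := by
  let := g.toAlgebra
  change (1 : S) ⊗ₜ[Q] m = 0 at hm
  have hex : Function.Exact (RingHom.ker g).subtype (Algebra.linearMap Q S) := by
    intro x
    exact ⟨fun h => ⟨⟨x, h⟩, rfl⟩, fun ⟨y, hy⟩ => hy ▸ y.2⟩
  have := rTensor_exact M hex hg
  have h1 : (Algebra.linearMap Q S).rTensor M ((1 : Q) ⊗ₜ[Q] m) = 0 := by
    rw [LinearMap.rTensor_tmul, Algebra.linearMap_apply, map_one, hm]
  obtain ⟨y, hy⟩ := (this _).1 h1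
  have h2 : ∀ y : TensorProduct Q (RingHom.ker g) M, TensorProduct.lid Q M
      ((RingHom.ker g).subtype.rTensor M y) ∈ (RingHom.ker g) • (⊤ : Submodule Q M) := by
    intro y
    induction y using TensorProduct.induction_on with
    | zero => rw [map_zero, map_zero]; exact zero_mem _
    | add x y hx hy => rw [map_add, map_add]; exact add_mem hx hy
    | tmul a m =>
      rw [LinearMap.rTensor_tmul, TensorProduct.lid_tmul]
      exact Submodule.smul_mem_smul a.2 trivial
  have h3 := h2 y
  rwa [hy, TensorProduct.lid_tmul, one_smul] at h3

end ExtendScalars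

section

variable {A : Type u} [CommRing A] [IsLocalRing A]

lemma supE_eq_of_least {Z : D A} {a : ℤ} (h : ∀ i < a, IsZero (extk Z i)) (ha : ¬ IsZero (extk Z a)) :
    supE Z = (((-a : ℤ) : ℝ) : EReal) := by
  apply le_antisymm
  · refine iSup₂_le fun i hi => ?_
    by_contra hlt
    refine hi (h _ ?_)
    rw [not_le, EReal.coe_lt_coe_iff, Int.cast_lt] at hlt
    lia
  · exact le_iSup₂_of_le (f := fun (i : ℤ) (_ : ¬ IsZero (extk Z (-i))) => ((i : ℝ) : EReal)) (-a)
      (by rwa [neg_neg]) le_rfl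

lemma exists_least_extk (Z : D A) (hZ : ∃ n, Z.IsGE n) :
    (∀ i, IsZero (extk Z i)) ∨ ∃ a, (∀ i < a, IsZero (extk Z i)) ∧ ¬ IsZero (extk Z a) := by
  by_cases h : ∃ i, ¬ IsZero (extk Z i)
  · obtain ⟨n, hn⟩ := hZ
    obtain ⟨a, ha, ha'⟩ := Int.exists_least_of_bdd (P := fun i => ¬ IsZero (extk Z i))
      ⟨n, fun z hz => by
        by_contra hlt
        exact hz (isZero_extk_of_lt hn (by lia))⟩ h
    refine .inr ⟨a, fun i hi => ?_, ha⟩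
    by_contra h'
    exact absurd (ha' i h') (by lia)
  · push Not at h
    exact .inl h

/-- The supremum of `Ext(k, -)` of an extension of `W` by a shift of `W`. -/
lemma supE_of_triangle {Z M W : D A} {a : Z ⟶ M} {b : M ⟶ W} {c : W ⟶ Z⟦(1 : ℤ)⟧}
    (hT : Triangle.mk a b c ∈ distTriang (D A)) (e : Z ≅ W⟦(1 : ℤ)⟧) (hW : ∃ n, W.IsGE n) :
    (∃ n, M.IsGE n) ∧ supE M = supE W + 1 := by
  have h₂ := fun i => (homRes A).homologySequence_exact₂ _ hT i
  have hZ (i : ℤ) : IsZero (extk Z i) ↔ IsZero (extk W (i + 1)) := by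
    rw [isZero_extk_iff_of_iso e]
    exact (((homRes A).shiftIso 1 i (i + 1) (by lia)).app W).isZero_iff
  constructor
  · obtain ⟨n, hn⟩ := hW
    have h1 : (W⟦(1 : ℤ)⟧).IsGE (n - 1) :=
      DerivedCategory.TStructure.t.isGE_shift W n 1 (n - 1) (by lia)
    have h2 : Z.IsGE (n - 1) := DerivedCategory.TStructure.t.isGE_of_iso e.symm _
    refine ⟨n - 1, ?_⟩
    rw [DerivedCategory.isGE_iff]
    intro i hi
    exact (DerivedCategory.HomologySequence.exact₂ _ hT i).isZero_of_both_zeros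
      ((Z.isZero_of_isGE (n - 1) i hi).eq_of_src _ _) ((W.isZero_of_isGE n i (by lia)).eq_of_tgt _ _)
  obtain h0 | ⟨m, hm, hm'⟩ := exists_least_extk W hW
  · have hM (i : ℤ) : IsZero (extk M i) :=
      (h₂ i).isZero_of_both_zeros (((hZ i).2 (h0 _)).eq_of_src _ _) ((h0 i).eq_of_tgt _ _)
    have h1 {Z : D A} (h : ∀ i, IsZero (extk Z i)) : supE Z = ⊥ := by
      simp [supE, h]
    rw [h1 hM, h1 h0, EReal.bot_add]
  · rw [supE_eq_of_least hm hm', supE_eq_of_least (Z := M) (a := m - 1)]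
    · rw [← EReal.coe_one, ← EReal.coe_add]
      congr 1
      push_cast
      ring
    · intro i hi
      exact (h₂ i).isZero_of_both_zeros (((hZ i).2 (hm _ (by lia))).eq_of_src _ _)
        ((hm i (by lia)).eq_of_tgt _ _)
    · intro h
      refine hm' ?_
      have h3 := (homRes A).homologySequence_exact₁ _ hT (m - 2) (m - 1) (by lia)
      have h4 := hZ (m - 1)
      rw [sub_add_cancel] at h4
      exact h4.1 (h3.isZero_of_both_zeros ((hm _ (by lia)).eq_of_src _ _) (h.eq_of_tgt _ _))

end

end

end CIDepth

/-! ### Reduction of a resolution modulo a regular element -/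

namespace CIDepth
noncomputable section

open HomologicalComplex CochainComplex

section Adjoint

variable {Q S : Type u} [CommRing Q] [CommRing S] (g : Q →+* S)

/-- Extension of scalars for complexes. -/
abbrev extC : CochainComplex (ModuleCat.{u} Q) ℤ ⥤ CochainComplex (ModuleCat.{u} S) ℤ :=
  (ModuleCat.extendScalars g).mapHomologicalComplex (ComplexShape.up ℤ)

/-- Restriction of scalars for complexes. -/
abbrev resC : CochainComplex (ModuleCat.{u} S) ℤ ⥤ CochainComplex (ModuleCat.{u} Q) ℤ :=
  (ModuleCat.restrictScalars g).mapHomologicalComplex (ComplexShape.up ℤ)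

/-- The unit of the adjunction between extension and restriction of scalars, for complexes. -/
def extηC (K : CochainComplex (ModuleCat.{u} Q) ℤ) : K ⟶ (resC g).obj ((extC g).obj K) where
  f n := extη g (K.X n)
  comm' i j _ := ((ModuleCat.extendRestrictScalarsAdj g).unit.naturality (K.d i j)).symm

variable {g}

lemma extC_map_extη {K L : CochainComplex (ModuleCat.{u} Q) ℤ} (f : K ⟶ L) (n : ℤ) (x : K.X n) :
    ((extC g).map f).f n (extη g (K.X n) x) = extη g (L.X n) (f.f n x) :=
  ConcreteCategory.congr_hom
    ((ModuleCat.extendRestrictScalarsAdj g).unit.naturality (f.f n)).symm x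

/-- The adjoint of a morphism to a restriction of scalars. -/
def extDesc {G : CochainComplex (ModuleCat.{u} Q) ℤ} {Y : CochainComplex (ModuleCat.{u} S) ℤ}
    (q : G ⟶ (resC g).obj Y) : (extC g).obj G ⟶ Y where
  f n := ((ModuleCat.extendRestrictScalarsAdj g).homEquiv _ _).symm (q.f n)
  comm' i j _ := by
    have h1 := (ModuleCat.extendRestrictScalarsAdj g).homEquiv_naturality_right_symm (q.f i) (Y.d i j)
    have h2 := (ModuleCat.extendRestrictScalarsAdj g).homEquiv_naturality_left_symm (G.d i j) (q.f j)
    refine h1.symm.trans (Eq.trans ?_ h2)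
    exact congrArg _ (q.comm i j)

lemma extηC_extDesc {G : CochainComplex (ModuleCat.{u} Q) ℤ}
    {Y : CochainComplex (ModuleCat.{u} S) ℤ} (q : G ⟶ (resC g).obj Y) :
    extηC g G ≫ (resC g).map (extDesc q) = q := by
  ext n : 1
  exact ((ModuleCat.extendRestrictScalarsAdj g).homEquiv_unit _ _ _).symm.trans
    (Equiv.apply_symm_apply _ _)

lemma extDesc_extη {G : CochainComplex (ModuleCat.{u} Q) ℤ} {Y : CochainComplex (ModuleCat.{u} S) ℤ}
    (q : G ⟶ (resC g).obj Y) (n : ℤ) (x : G.X n) :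
    (extDesc q).f n (extη g (G.X n) x) = q.f n x :=
  ConcreteCategory.congr_hom (congrArg (fun φ => φ.f n) (extηC_extDesc q)) x

end Adjoint

section Comparison

variable {Q S : Type u} [CommRing Q] [CommRing S] (g : Q →+* S)
  {X Y P : CochainComplex (ModuleCat.{u} S) ℤ} {L G : CochainComplex (ModuleCat.{u} Q) ℤ}

lemma flat_of_projective {M : ModuleCat.{u} Q} (hM : Projective M) : Module.Flat Q M := by
  have := (IsProjective.iff_projective (R := Q) (P := M)).2 hM
  infer_instance

/-- Comparison of the derived tensor products over two rings. -/
lemma nonempty_iso_restrictScalars_tensorObj (p : P ⟶ X) (hp : QuasiIso p)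
    (l : L ⟶ (resC g).obj X) (hl : QuasiIso l) (hL : ∃ n, L.IsStrictlyLE n)
    (hL' : ∀ i, Projective (L.X i)) (q : G ⟶ (resC g).obj Y) (hq : QuasiIso q)
    (hG : ∃ n, G.IsStrictlyLE n) (hG' : ∀ i, Projective (G.X i)) :
    Nonempty ((toD Q).obj (HomologicalComplex.tensorObj L ((resC g).obj Y)) ≅
      (toD Q).obj ((resC g).obj (HomologicalComplex.tensorObj P ((extC g).obj G)))) := by
  obtain ⟨e₁⟩ := nonempty_iso_tensL L hL (fun i => flat_of_projective (hL' i)) q hq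
  have hG'' := fun i => flat_of_projective (hG' i)
  obtain ⟨e₂⟩ := nonempty_iso_tensR G hG hG'' l hl
  obtain ⟨e₃⟩ := nonempty_iso_tensR G hG hG'' ((resC g).map p) inferInstance
  obtain ⟨e₄⟩ := nonempty_restrictScalars_tensorObj_iso g P G
  exact ⟨e₁.symm ≪≫ e₂ ≪≫ e₃.symm ≪≫ (toD Q).mapIso e₄⟩

lemma quasiIso_extDesc (hg : Function.Bijective g) (q : G ⟶ (resC g).obj Y) (hq : QuasiIso q) :
    QuasiIso (extDesc q) := by
  have hη : IsIso (extηC g G) := by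
    apply isIso_of_bijective
    refine fun n => ⟨?_, extη_surjective g hg.2 _⟩
    rw [injective_iff_map_eq_zero]
    intro x hx
    have h1 := mem_of_extη_eq_zero g hg.2 _ hx
    rw [(RingHom.injective_iff_ker_eq_bot g).1 hg.1, Submodule.bot_smul] at h1
    exact h1
  rw [← quasiIso_map_iff_of_preservesHomology (extDesc q) (ModuleCat.restrictScalars g)]
  rw [← extηC_extDesc q] at hq
  exact quasiIso_of_comp_left (extηC g G) _

end Comparison

section Quotient

variable {Q S : Type u} [CommRing Q] [CommRing S] {g : Q →+* S} (hg : Function.Surjective g) {r : Q}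
  (hr : RingHom.ker g = Ideal.span {r})
  {K G : CochainComplex (ModuleCat.{u} Q) ℤ} {Y : CochainComplex (ModuleCat.{u} S) ℤ}
  {i : K ⟶ G} {q : G ⟶ (resC g).obj Y} (w : i ≫ q = 0)
  (hS : (ShortComplex.mk i q w).ShortExact)
  (hreg : ∀ n, IsSMulRegular (G.X n) r)

include hg hr in
lemma exists_smul_of_extη_eq_zero (M : ModuleCat.{u} Q) {m : M} (hm : extη g M m = 0) :
    ∃ m' : M, r • m' = m := by
  have := mem_of_extη_eq_zero g hg M hm
  rw [hr, Submodule.ideal_span_singleton_smul, Submodule.mem_smul_pointwise_iff_exists] at this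
  obtain ⟨m', -, h⟩ := this
  exact ⟨m', h⟩

include hr in
lemma map_eq_zero_of_ker : g r = 0 := by
  have : r ∈ RingHom.ker g := hr ▸ Ideal.mem_span_singleton_self r
  exact this

include hr in
lemma extη_smul (M : ModuleCat.{u} Q) (m : M) : extη g M (r • m) = 0 := by
  rw [map_smul]
  change g r • (show (ModuleCat.extendScalars g).obj M from extη g M m) = 0
  rw [map_eq_zero_of_ker hr, zero_smul]

include hS in
lemma exact_elements (n : ℤ) : Function.Injective (i.f n) ∧ Function.Surjective (q.f n) ∧
    ∀ x, q.f n x = 0 → ∃ y, i.f n y = x := by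
  have h := hS.map_of_exact (HomologicalComplex.eval _ _ n)
  have h1 := h.mono_f
  have h2 := h.epi_g
  exact ⟨(ModuleCat.mono_iff_injective _).1 h1, (ModuleCat.epi_iff_surjective _).1 h2,
    (ShortComplex.moduleCat_exact_iff _).1 h.exact⟩

include hr in
lemma smul_comp_resC : (r • 𝟙 G) ≫ q = 0 := by
  ext n x
  change q.f n (r • x) = 0
  rw [map_smul]
  change g r • (show Y.X n from q.f n x) = 0
  rw [map_eq_zero_of_ker hr, zero_smul]

include hg w in
lemma extC_map_extDesc : (extC g).map i ≫ extDesc q = 0 := by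
  ext n x
  obtain ⟨x, rfl⟩ := extη_surjective g hg _ x
  change (extDesc q).f n (((extC g).map i).f n (extη g (K.X n) x)) = 0
  rw [extC_map_extη, extDesc_extη]
  exact ConcreteCategory.congr_hom (congrArg (fun φ => φ.f n) w) x

include hg hS in
lemma exact_ext : (ShortComplex.mk ((extC g).map i) (extDesc q) (extC_map_extDesc hg w)).Exact := by
  apply HomologicalComplex.exact_of_degreewise_exact
  intro n
  rw [ShortComplex.moduleCat_exact_iff]
  intro x hx
  obtain ⟨x, rfl⟩ := extη_surjective g hg _ x
  change (extDesc q).f n (extη g (G.X n) x) = 0 at hx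
  rw [extDesc_extη] at hx
  obtain ⟨y, rfl⟩ := (exact_elements w hS n).2.2 x hx
  exact ⟨extη g (K.X n) y, extC_map_extη i n y⟩

include hS in
lemma epi_extDesc : Epi (extDesc q) := by
  have (n : ℤ) : Epi ((extDesc q).f n) := by
    rw [ModuleCat.epi_iff_surjective]
    intro y
    obtain ⟨x, hx⟩ := (exact_elements w hS n).2.1 y
    exact ⟨extη g (G.X n) x, (extDesc_extη q n x).trans hx⟩
  exact HomologicalComplex.epi_of_epi_f _ this

include hg hr hS hreg in
/-- The first syzygy of the reduction of a resolution. -/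
lemma exists_syzygy : ∃ (σ : Y ⟶ (extC g).obj K) (hσ : σ ≫ (extC g).map i = 0), Mono σ ∧
    (ShortComplex.mk σ ((extC g).map i) hσ).Exact := by
  have := hS.mono_f
  have hepi : Epi (extDesc q) := epi_extDesc w hS
  -- Since r kills `Y`, multiplication by r on `G` lands in the kernel `K` of `q`.
  let m : G ⟶ K := hS.exact.lift (r • 𝟙 G) (smul_comp_resC hr)
  have hmi : m ≫ i = r • 𝟙 G := hS.exact.lift_f _ _
  have him : i ≫ m = r • 𝟙 K := by
    rw [← cancel_mono i, Category.assoc, hmi]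
    simp
  have hm (n : ℤ) (x : G.X n) : i.f n (m.f n x) = r • x :=
    ConcreteCategory.congr_hom (congrArg (fun φ => φ.f n) hmi) x
  have hm' (n : ℤ) (x : K.X n) : m.f n (i.f n x) = r • x :=
    ConcreteCategory.congr_hom (congrArg (fun φ => φ.f n) him) x
  have h0 : (extC g).map i ≫ (extC g).map m = 0 := by
    ext n x
    obtain ⟨x, rfl⟩ := extη_surjective g hg _ x
    change ((extC g).map m).f n (((extC g).map i).f n (extη g (K.X n) x)) = 0
    rw [extC_map_extη, extC_map_extη, hm', extη_smul hr]
    rfl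
  -- σ sends q(x) to the class of rx in K/rK. This identifies `Y` with Tor₁(S, Y), the kernel of
  -- K/rK → G/rG.
  let σ : Y ⟶ (extC g).obj K := (exact_ext hg w hS).desc ((extC g).map m) h0
  have hσ : extDesc q ≫ σ = (extC g).map m := (exact_ext hg w hS).g_desc _ _
  have hσ' (n : ℤ) (x : G.X n) : σ.f n (q.f n x) = extη g (K.X n) (m.f n x) := by
    rw [← extC_map_extη, ← hσ, ← extDesc_extη]
    rfl
  refine ⟨σ, ?_, ?_, ?_⟩
  · rw [← cancel_epi (extDesc q), ← Category.assoc, hσ, comp_zero]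
    ext n x
    obtain ⟨x, rfl⟩ := extη_surjective g hg _ x
    change ((extC g).map i).f n (((extC g).map m).f n (extη g (G.X n) x)) = 0
    rw [extC_map_extη, extC_map_extη, hm, extη_smul hr]
    rfl
  · have (n : ℤ) : Mono (σ.f n) := by
      rw [ModuleCat.mono_iff_injective, injective_iff_map_eq_zero]
      intro y hy
      obtain ⟨x, rfl⟩ := (exact_elements w hS n).2.1 y
      obtain ⟨z, hz⟩ := exists_smul_of_extη_eq_zero hg hr _ ((hσ' n x).symm.trans hy)
      have h1 : x = i.f n z := by
        apply hreg n
        change r • x = r • _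
        rw [← hm, ← hz, map_smul]
      rw [h1]
      exact ConcreteCategory.congr_hom (congrArg (fun φ => φ.f n) w) z
    exact HomologicalComplex.mono_of_mono_f _ this
  · apply HomologicalComplex.exact_of_degreewise_exact
    intro n
    rw [ShortComplex.moduleCat_exact_iff]
    intro x hx
    obtain ⟨x, rfl⟩ := extη_surjective g hg _ x
    change ((extC g).map i).f n (extη g (K.X n) x) = 0 at hx
    rw [extC_map_extη] at hx
    obtain ⟨y, hy⟩ := exists_smul_of_extη_eq_zero hg hr _ hx
    have h1 : m.f n y = x := (exact_elements w hS n).1 ((hm n y).trans hy)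
    exact ⟨q.f n y, (hσ' n y).trans (by rw [h1])⟩

include hg hr hS hreg in
-- As a subcomplex of `G`, `K` has r as a regular element in each degree. Hence 0 → K → K → S ⊗ K →
-- 0 is exact, and its first two terms are acyclic.
lemma acyclic_ext_of_acyclic (hK : K.Acyclic) : ((extC g).obj K).Acyclic := by
  let T : ShortComplex (CochainComplex (ModuleCat.{u} Q) ℤ) :=
    ShortComplex.mk (r • 𝟙 K) (extηC g K) (by
      ext n x
      exact extη_smul hr _ x)
  have hT : T.ShortExact := by
    apply shortExact_of_degreewise_shortExact
    intro n
    refine { exact := ?_, mono_f := ?_, epi_g := ?_ }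
    · rw [ShortComplex.moduleCat_exact_iff]
      intro x hx
      exact exists_smul_of_extη_eq_zero hg hr _ hx
    · rw [ModuleCat.mono_iff_injective]
      intro x y hxy
      change r • (show K.X n from x) = r • (show K.X n from y) at hxy
      apply (exact_elements w hS n).1
      apply hreg n
      change r • _ = r • _
      exact (map_smul (i.f n).hom r x).symm.trans
        ((congrArg (i.f n) hxy).trans (map_smul (i.f n).hom r y))
    · exact (ModuleCat.epi_iff_surjective _).2 (extη_surjective g hg _)
  have h0 := (isZero_toD_iff _).2 hK
  have h1 : IsZero ((toD Q).obj ((resC g).obj ((extC g).obj K))) :=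
    Triangle.isZero₃_of_isZero₁₂ _ (DerivedCategory.triangleOfSES_distinguished hT) h0 h0
  rw [isZero_toD_iff] at h1
  intro n
  have h2 := h1 n
  rw [exactAt_iff_isZero_homology] at h2 ⊢
  exact (isZero_restrictScalars_iff g _).1
    ((mapHomologyIso (ModuleCat.restrictScalars g) _ n).isZero_iff.1 h2)

include hg hr hS hreg in
-- The exact sequence 0 → Y → S ⊗ K → S ⊗ G → Y → 0 is cut at the kernel of the last map. Since S ⊗
-- K is acyclic, that kernel becomes a shift of `Y`, and tensoring with the flat complex `P`
-- preserves all of this.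
lemma exists_triangle_tensorObj (hK : K.Acyclic) (P : CochainComplex (ModuleCat.{u} S) ℤ)
    (hP : ∃ n, P.IsStrictlyLE n) (hflat : ∀ i, Module.Flat S (P.X i)) :
    ∃ (Z : D S) (a : Z ⟶ (toD S).obj (HomologicalComplex.tensorObj P ((extC g).obj G)))
      (b : _ ⟶ (toD S).obj (HomologicalComplex.tensorObj P Y)) (c : _),
      Triangle.mk a b c ∈ distTriang (D S) ∧
      Nonempty (Z ≅ ((toD S).obj (HomologicalComplex.tensorObj P Y))⟦(1 : ℤ)⟧) := by
  obtain ⟨σ, hσ, hσm, hσe⟩ := exists_syzygy hg hr w hS hreg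
  have hepi : Epi (extDesc q) := epi_extDesc w hS
  have hex := exact_ext hg w hS
  let T₂ : ShortComplex (CochainComplex (ModuleCat.{u} S) ℤ) :=
    ShortComplex.mk (kernel.ι (extDesc q)) (extDesc q) (kernel.condition _)
  have hT₂ : T₂.ShortExact :=
    { exact := ShortComplex.exact_of_f_is_kernel _ (kernelIsKernel _) }
  let t := kernel.lift (extDesc q) ((extC g).map i) (extC_map_extDesc hg w)
  have htι : t ≫ kernel.ι (extDesc q) = (extC g).map i := kernel.lift_ι _ _ _
  have ht : Epi t := hex.epi_kernelLift
  let T₁ : ShortComplex (CochainComplex (ModuleCat.{u} S) ℤ) := ShortComplex.mk σ t (by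
    rw [← cancel_mono (kernel.ι (extDesc q)), Category.assoc, htι, hσ, zero_comp])
  have hT₁ : T₁.ShortExact :=
    { exact := by
        let φ : T₁ ⟶ ShortComplex.mk σ ((extC g).map i) hσ :=
          { τ₁ := 𝟙 _, τ₂ := 𝟙 _, τ₃ := kernel.ι (extDesc q) }
        exact (ShortComplex.exact_iff_of_epi_of_isIso_of_mono φ).2 hσe }
  have hΦ := isHomologicallyExact_tensL P hP hflat
  have hd₁ := DerivedCategory.triangleOfSES_distinguished (hΦ.shortExact _ hT₁)
  have hd₂ := DerivedCategory.triangleOfSES_distinguished (hΦ.shortExact _ hT₂)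
  have hiso := (Triangle.isZero₂_iff_isIso₃ _ hd₁).1
    ((isZero_toD_iff _).2 (hΦ.acyclic _ (acyclic_ext_of_acyclic hg hr w hS hreg hK)))
  exact ⟨_, _, _, _, hd₂, ⟨@asIso _ _ _ _ _ hiso⟩⟩

end Quotient

end

end CIDepth

/-! ### Change of rings for the derived tensor product -/

namespace CIDepth
noncomputable section

open HomologicalComplex CochainComplex RingTheory.Sequence

lemma exists_isGE_of_iso {A : Type u} [CommRing A] {Z W : D A} (e : Z ≅ W) (h : ∃ n, Z.IsGE n) :
    ∃ n, W.IsGE n := by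
  obtain ⟨n, hn⟩ := h
  exact ⟨n, DerivedCategory.TStructure.t.isGE_of_iso e n⟩

section Change

variable {Q S : Type u} [CommRing Q] [CommRing S] [IsLocalRing Q] [IsLocalRing S]
  [IsNoetherianRing S] {g : Q →+* S} (hg : Function.Surjective g)
  {P X Y : CochainComplex (ModuleCat.{u} S) ℤ} {L : CochainComplex (ModuleCat.{u} Q) ℤ}
  (hP : ∃ n, P.IsStrictlyLE n) (hP' : ∀ i, Projective (P.X i)) (p : P ⟶ X) (hp : QuasiIso p) (hY : ∃ n, Y.IsStrictlyLE n)
  (l : L ⟶ (resC g).obj X) (hl : QuasiIso l) (hL : ∃ n, L.IsStrictlyLE n)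
  (hL' : ∀ i, Projective (L.X i))
  (hPY : ∃ n, ((toD S).obj (HomologicalComplex.tensorObj P Y)).IsGE n)

omit [IsLocalRing Q] [IsLocalRing S] [IsNoetherianRing S] in
include hY in
lemma exists_epi_projRes_restrictScalars :
    ∃ (G : CochainComplex (ModuleCat.{u} Q) ℤ) (q : G ⟶ (resC g).obj Y), Epi q ∧ QuasiIso q ∧
      (∃ n, G.IsStrictlyLE n) ∧ ∀ i, Projective (G.X i) := by
  obtain ⟨n, hn⟩ := hY
  have : ((resC g).obj Y).IsStrictlyLE n := by
    rw [isStrictlyLE_iff] at hn ⊢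
    exact fun i hi => (ModuleCat.restrictScalars g).map_isZero (hn i hi)
  obtain ⟨G, q, h₁, h₂, h₃, h₄⟩ := exists_epi_projRes ((resC g).obj Y) n
  exact ⟨G, q, h₁, h₂, ⟨_, h₄⟩, h₃⟩

include hg hY hp hl hL hL' in
/-- Change of rings, in terms of a resolution over the larger ring. -/
lemma supE_tensorObj_of_iso (c : ℕ)
    (H : ∀ (G : CochainComplex (ModuleCat.{u} Q) ℤ) (q : G ⟶ (resC g).obj Y), Epi q → QuasiIso q →
      (∀ i, Projective (G.X i)) →
      (∃ n, ((toD S).obj (HomologicalComplex.tensorObj P ((extC g).obj G))).IsGE n) ∧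
        supE ((toD S).obj (HomologicalComplex.tensorObj P ((extC g).obj G))) =
          supE ((toD S).obj (HomologicalComplex.tensorObj P Y)) + (c : ℕ)) :
    (∃ n, ((toD Q).obj (HomologicalComplex.tensorObj L ((resC g).obj Y))).IsGE n) ∧
      supE ((toD Q).obj (HomologicalComplex.tensorObj L ((resC g).obj Y))) =
        supE ((toD S).obj (HomologicalComplex.tensorObj P Y)) + (c : ℕ) := by
  have := IsLocalHom.of_surjective g hg
  obtain ⟨G, q, hq, hq', hG, hG'⟩ := exists_epi_projRes_restrictScalars (g := g) hY
  obtain ⟨⟨n, hn⟩, h₂⟩ := H G q hq hq' hG'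
  -- Over `Q`, the product of `L` and the restriction of `Y` is the restriction of P ⊗_S (S ⊗_Q G),
  -- and restriction along a surjection does not change `supE`.
  obtain ⟨e⟩ := nonempty_iso_restrictScalars_tensorObj g p hp l hl hL hL' q hq' hG hG'
  have h₃ := (isGE_toD_iff_of_isZero_iff (fun i => (isZero_restrictScalars_iff g _).symm.trans
    (mapHomologyIso (ModuleCat.restrictScalars g) _ i).isZero_iff.symm) n).1 hn
  refine ⟨exists_isGE_of_iso e.symm ⟨n, h₃⟩, ?_⟩
  rw [← h₂, supE_congr e]
  exact supE_restrictScalars g hg _ ⟨n, hn⟩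

include hg hP hP' hp hY hl hL hL' hPY in
lemma supE_tensorObj_of_bijective (hg' : Function.Injective g) :
    (∃ n, ((toD Q).obj (HomologicalComplex.tensorObj L ((resC g).obj Y))).IsGE n) ∧
      supE ((toD Q).obj (HomologicalComplex.tensorObj L ((resC g).obj Y))) =
        supE ((toD S).obj (HomologicalComplex.tensorObj P Y)) + (0 : ℕ) := by
  refine supE_tensorObj_of_iso hg p hp hY l hl hL hL' 0 fun G q _ hq hG' => ?_
  obtain ⟨e⟩ := nonempty_iso_tensL P hP (fun i => flat_of_projective (hP' i)) (extDesc q)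
    (quasiIso_extDesc g ⟨hg', hg⟩ q hq)
  refine ⟨exists_isGE_of_iso e.symm hPY, ?_⟩
  rw [Nat.cast_zero, add_zero]
  exact supE_congr e

include hg hP hP' hp hY hl hL hL' hPY in
-- P ⊗_S (S ⊗_Q G) is an extension of P ⊗ Y by its shift, and the shift contributes the extra one.
lemma supE_tensorObj_of_ker_eq_span {r : Q} (hr : RingHom.ker g = Ideal.span {r})
    (hreg : IsSMulRegular Q r) :
    (∃ n, ((toD Q).obj (HomologicalComplex.tensorObj L ((resC g).obj Y))).IsGE n) ∧
      supE ((toD Q).obj (HomologicalComplex.tensorObj L ((resC g).obj Y))) =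
        supE ((toD S).obj (HomologicalComplex.tensorObj P Y)) + (1 : ℕ) := by
  refine supE_tensorObj_of_iso hg p hp hY l hl hL hL' 1 fun G q _ hq hG' => ?_
  have hS : (ShortComplex.mk (kernel.ι q) q (kernel.condition q)).ShortExact :=
    { exact := ShortComplex.exact_of_f_is_kernel _ (kernelIsKernel _) }
  have hG (n : ℤ) : IsSMulRegular (G.X n) r := by
    have := flat_of_projective (hG' n)
    exact Module.Flat.isSMulRegular_of_isRegular
      (isLeftRegular_iff_isRegular.1 hreg.isLeftRegular)
  obtain ⟨Z, a, b, c, hT, ⟨e⟩⟩ := exists_triangle_tensorObj hg hr _ hS hG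
    (ShortComplex.ShortExact.acyclic_X₁ hS hq) P hP (fun i => flat_of_projective (hP' i))
  simpa using supE_of_triangle hT e hPY

end Change

lemma isWeaklyRegular_quotient {Q : Type u} [CommRing Q] {r : Q} {rs : List Q}
    (h : IsWeaklyRegular Q (r :: rs)) :
    IsWeaklyRegular (Q ⧸ Ideal.span {r}) (rs.map (Ideal.Quotient.mk (Ideal.span {r}))) := by
  have h' := ((isWeaklyRegular_cons_iff Q r rs).1 h).2
  have e : QuotSMulTop r Q ≃ₗ[Q] (Q ⧸ Ideal.span {r}) := Submodule.quotEquivOfEq _ _ (by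
    rw [← Submodule.ideal_span_singleton_smul]
    simp)
  rw [e.isWeaklyRegular_congr] at h'
  exact (isWeaklyRegular_map_algebraMap_iff (Q ⧸ Ideal.span {r}) (Q ⧸ Ideal.span {r}) rs).2 h'

/-- Change of rings along a surjection whose kernel is generated by a regular sequence. -/
theorem supE_tensorObj_restrictScalars {S : Type u} [CommRing S] [IsLocalRing S]
    [IsNoetherianRing S] {P Y : CochainComplex (ModuleCat.{u} S) ℤ}
    (hP : ∃ n, P.IsStrictlyLE n) (hP' : ∀ i, Projective (P.X i)) (hY : ∃ n, Y.IsStrictlyLE n)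
    (hPY : ∃ n, ((toD S).obj (HomologicalComplex.tensorObj P Y)).IsGE n) (c : ℕ) :
    ∀ (Q : Type u) [CommRing Q] [IsLocalRing Q] [IsNoetherianRing Q] (g : Q →+* S)
      (_ : Function.Surjective g) (rs : List Q) (_ : IsWeaklyRegular Q rs)
      (_ : RingHom.ker g = Ideal.ofList rs) (_ : rs.length = c)
      (L : CochainComplex (ModuleCat.{u} Q) ℤ) (l : L ⟶ (resC g).obj P) (_ : QuasiIso l)
      (_ : ∃ n, L.IsStrictlyLE n) (_ : ∀ i, Projective (L.X i)),
    (∃ n, ((toD Q).obj (HomologicalComplex.tensorObj L ((resC g).obj Y))).IsGE n) ∧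
      supE ((toD Q).obj (HomologicalComplex.tensorObj L ((resC g).obj Y))) =
        supE ((toD S).obj (HomologicalComplex.tensorObj P Y)) + (c : ℕ) := by
  induction c with
  | zero =>
    intro Q _ _ _ g hg rs _ hker hlen L l hl hL hL'
    obtain rfl := List.length_eq_zero_iff.1 hlen
    refine supE_tensorObj_of_bijective hg hP hP' (𝟙 P) inferInstance hY l hl hL hL' hPY ?_
    rw [RingHom.injective_iff_ker_eq_bot, hker, Ideal.ofList_nil]
  | succ c ih =>
    intro Q _ _ _ g hg rs hrs hker hlen L l hl hL hL'
    obtain ⟨r, rs, rfl⟩ := List.exists_cons_of_length_eq_add_one hlen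
    let Q₁ := Q ⧸ Ideal.span {r}
    have hr : Ideal.span {r} ≤ RingHom.ker g := by
      rw [hker, Ideal.ofList_cons]
      exact le_sup_left
    let π : Q →+* Q₁ := Ideal.Quotient.mk _
    have hπ : Function.Surjective π := Ideal.Quotient.mk_surjective
    let g₁ : Q₁ →+* S := Ideal.Quotient.lift _ g (fun a ha => hr ha)
    have e : g = g₁.comp π := rfl
    clear_value g₁
    subst e
    have hg₁ : Function.Surjective g₁ := Function.Surjective.of_comp hg
    have : Nontrivial Q₁ := g₁.domain_nontrivial
    have : IsLocalRing Q₁ := IsLocalRing.of_surjective' π hπ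
    have hker₁ : RingHom.ker g₁ = Ideal.ofList (rs.map π) := by
      rw [← Ideal.map_ofList, ← Ideal.map_comap_of_surjective π hπ (RingHom.ker g₁),
        RingHom.comap_ker, hker, Ideal.ofList_cons, Ideal.map_sup, Ideal.map_span]
      have : π r = 0 := Ideal.Quotient.eq_zero_iff_mem.2 (Ideal.mem_span_singleton_self r)
      simp [this]
    -- The induction hypothesis compares `S` with Q/(r) through the resolution `L₁`. The one-element
    -- case, with `L₁` in the role of `P`, then compares Q/(r) with `Q`.
    obtain ⟨L₁, l₁, _, hl₁, hL₁, hL₁'⟩ := exists_epi_projRes_restrictScalars (g := g₁) hP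
    obtain ⟨h₁, h₂⟩ := ih Q₁ g₁ hg₁ (rs.map π) (isWeaklyRegular_quotient hrs) hker₁
      (by simpa using hlen) L₁ l₁ hl₁ hL₁ hL₁'
    obtain ⟨n, hn⟩ := hY
    have hY₁ : ((resC g₁).obj Y).IsStrictlyLE n := by
      rw [isStrictlyLE_iff] at hn ⊢
      exact fun i hi => (ModuleCat.restrictScalars g₁).map_isZero (hn i hi)
    obtain ⟨h₃, h₄⟩ := supE_tensorObj_of_ker_eq_span hπ hL₁ hL₁' l₁ hl₁ ⟨n, hY₁⟩ l hl hL hL' h₁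
      Ideal.mk_ker ((isWeaklyRegular_cons_iff Q r rs).1 hrs).1
    refine ⟨h₃, h₄.trans ?_⟩
    rw [h₂, add_assoc]
    norm_cast

end

end CIDepth

/-! ### Projective models and projective dimension -/

namespace CIDepth
noncomputable section

open HomologicalComplex CochainComplex

section Models

variable {A : Type u} [CommRing A]

/-- `L` is K-projective, so a morphism out of it in the derived category is the class of a morphism
of complexes. -/
lemma exists_toD_map_eq {L X : CochainComplex (ModuleCat.{u} A) ℤ} (hL : ∃ n, L.IsStrictlyLE n)
    (hL' : ∀ i, Projective (L.X i)) (f : (toD A).obj L ⟶ (toD A).obj X) :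
    ∃ φ : L ⟶ X, (toD A).map φ = f := by
  obtain ⟨d, hd⟩ := hL
  have := isKProjective_of_projective L d
  let e := DerivedCategory.quotientCompQhIso (ModuleCat.{u} A)
  obtain ⟨ψ, hψ⟩ := (IsKProjective.Qh_map_bijective L
    ((HomotopyCategory.quotient _ _).obj X)).2 (e.hom.app L ≫ f ≫ e.inv.app X)
  obtain ⟨φ, rfl⟩ := (HomotopyCategory.quotient _ _).map_surjective ψ
  refine ⟨φ, ?_⟩
  rw [← cancel_epi (e.hom.app L), ← cancel_mono (e.inv.app X), Category.assoc, Category.assoc,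
    ← hψ]
  exact (NatIso.naturality_2 e φ)

lemma eq_zero_of_isStrictlyGE {L X : CochainComplex (ModuleCat.{u} A) ℤ}
    (hL : ∃ n, L.IsStrictlyLE n) (hL' : ∀ i, Projective (L.X i))
    (h : ∀ i, IsZero (L.X i) ∨ IsZero (X.X i)) (f : (toD A).obj L ⟶ (toD A).obj X) : f = 0 := by
  obtain ⟨φ, rfl⟩ := exists_toD_map_eq hL hL' f
  have : φ = 0 := by
    ext1 i
    rcases h i with h | h
    · exact h.eq_of_src _ _
    · exact h.eq_of_tgt _ _
  rw [this, Functor.map_zero]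

lemma quasiIso_of_isIso_toD_map {K L : CochainComplex (ModuleCat.{u} A) ℤ} (f : K ⟶ L)
    (h : IsIso ((toD A).map f)) : QuasiIso f :=
  (DerivedCategory.isIso_Q_map_iff_quasiIso (φ := f)).1 h

lemma exists_quasiIso_of_iso {L X : CochainComplex (ModuleCat.{u} A) ℤ}
    (hL : ∃ n, L.IsStrictlyLE n) (hL' : ∀ i, Projective (L.X i))
    (e : (toD A).obj L ≅ (toD A).obj X) : ∃ φ : L ⟶ X, QuasiIso φ := by
  obtain ⟨φ, hφ⟩ := exists_toD_map_eq hL hL' e.hom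
  exact ⟨φ, quasiIso_of_isIso_toD_map φ (hφ ▸ inferInstance)⟩

lemma nonempty_iso_tensorObj {L L' B : CochainComplex (ModuleCat.{u} A) ℤ}
    (hL : ∃ n, L.IsStrictlyLE n) (hL' : ∀ i, Projective (L.X i)) (hM : ∃ n, L'.IsStrictlyLE n)
    (hM' : ∀ i, Projective (L'.X i)) (e : (toD A).obj L ≅ (toD A).obj L')
    (hB : ∃ n, B.IsStrictlyLE n) :
    Nonempty ((toD A).obj (HomologicalComplex.tensorObj L B) ≅
      (toD A).obj (HomologicalComplex.tensorObj L' B)) := by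
  obtain ⟨φ, hφ⟩ := exists_quasiIso_of_iso hL hL' e
  obtain ⟨n, hn⟩ := hB
  obtain ⟨G, q, _, hq, hG, hG'⟩ := exists_epi_projRes B n
  obtain ⟨e₁⟩ := nonempty_iso_tensL L hL (fun i => flat_of_projective (hL' i)) q hq
  obtain ⟨e₂⟩ := nonempty_iso_tensR G ⟨_, hG'⟩ (fun i => flat_of_projective (hG i)) φ hφ
  obtain ⟨e₃⟩ := nonempty_iso_tensL L' hM (fun i => flat_of_projective (hM' i)) q hq
  exact ⟨e₁.symm ≪≫ e₂ ≪≫ e₃⟩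

/-- `Z` is represented by a bounded below complex of projective modules vanishing in homological
degrees above `n`. -/
def HasProjModel (Z : D A) (n : ℤ) : Prop :=
  ∃ L : CochainComplex (ModuleCat.{u} A) ℤ, L.IsStrictlyGE (-n) ∧ (∃ N, L.IsStrictlyLE N) ∧
    (∀ i, Projective (L.X i)) ∧ Nonempty ((toD A).obj L ≅ Z)

lemma HasProjModel.of_iso {Z W : D A} {n : ℤ} (h : HasProjModel Z n) (e : Z ≅ W) :
    HasProjModel W n := by
  obtain ⟨L, h₁, h₂, h₃, ⟨e'⟩⟩ := h
  exact ⟨L, h₁, h₂, h₃, ⟨e' ≪≫ e⟩⟩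

lemma HasProjModel.isGE {Z : D A} {n : ℤ} (h : HasProjModel Z n) : Z.IsGE (-n) := by
  obtain ⟨L, h₁, h₂, h₃, ⟨e⟩⟩ := h
  have : ((toD A).obj L).IsGE (-n) := (DerivedCategory.isGE_Q_obj_iff L (-n)).2 inferInstance
  exact DerivedCategory.TStructure.t.isGE_of_iso e _

/-- The length of a resolution is a supremum of integers, so a bound strictly below n + 1 is a bound
by n. Thus the infimum is attained whenever it is finite. -/
lemma pd_le_iff (X : CochainComplex (ModuleCat.{u} A) ℤ) (n : ℤ) :
    pd X ≤ ((n : ℝ) : EReal) ↔ HasProjModel ((toD A).obj X) n := by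
  constructor
  · intro h
    have h' : pd X < (((n + 1 : ℤ) : ℝ) : EReal) := h.trans_lt (by
      rw [EReal.coe_lt_coe_iff]
      exact_mod_cast lt_add_one n)
    obtain ⟨P, hP⟩ := iInf_lt_iff.1 h'
    have := P.quasiIso
    refine ⟨P.P, ?_, P.bounded, P.projective, ⟨asIso ((toD A).map P.π)⟩⟩
    rw [isStrictlyGE_iff]
    intro i hi
    by_contra hi'
    have h1 : ((( -i : ℤ) : ℝ) : EReal) < (((n + 1 : ℤ) : ℝ) : EReal) :=
      lt_of_le_of_lt (le_iSup₂_of_le (f := fun (i : ℤ) (_ : ¬ IsZero (P.P.X (-i))) =>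
        ((i : ℝ) : EReal)) (-i) (by rwa [neg_neg]) le_rfl) hP
    rw [EReal.coe_lt_coe_iff] at h1
    have : -i < n + 1 := by exact_mod_cast h1
    lia
  · rintro ⟨L, h₁, h₂, h₃, ⟨e⟩⟩
    obtain ⟨φ, hφ⟩ := exists_quasiIso_of_iso h₂ h₃ e
    refine (iInf_le _ (⟨L, φ, hφ, h₃, h₂⟩ : ProjRes X)).trans ?_
    refine iSup₂_le fun i hi => ?_
    rw [EReal.coe_le_coe_iff]
    by_contra hi'
    refine hi (L.isZero_of_isStrictlyGE (-n) _ ?_)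
    have : n < i := by exact_mod_cast not_le.1 hi'
    lia

end Models

end

end CIDepth

/-! ### Approximation by finitely generated projective complexes -/

namespace CIDepth
noncomputable section

open HomologicalComplex CochainComplex

section Finite

variable {A : Type u} [CommRing A] [IsNoetherianRing A]

lemma finite_of_exact {S : ShortComplex (ModuleCat.{u} A)} (hS : S.Exact)
    (h₁ : Module.Finite A S.X₁) (h₃ : Module.Finite A S.X₃) : Module.Finite A S.X₂ := by
  have := isNoetherian_of_range_eq_ker S.f.hom S.g.hom hS.moduleCat_range_eq_ker
  infer_instance

lemma finite_homology (K : CochainComplex (ModuleCat.{u} A) ℤ) (i : ℤ)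
    (h : Module.Finite A (K.X i)) : Module.Finite A (K.homology i) := by
  have h₁ : Module.Finite A (K.cycles i) :=
    Module.Finite.of_injective (K.iCycles i).hom ((ModuleCat.mono_iff_injective _).1 inferInstance)
  exact Module.Finite.of_surjective (K.homologyπ i).hom
    ((ModuleCat.epi_iff_surjective _).1 inferInstance)

/-- The cohomology modules of an object of the derived category are finitely generated. -/
def IsFiniteD (Z : D A) : Prop := ∀ i, Module.Finite A ((hD A i).obj Z)

omit [IsNoetherianRing A] in
lemma isFiniteD_toD_iff (K : CochainComplex (ModuleCat.{u} A) ℤ) :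
    IsFiniteD ((toD A).obj K) ↔ ∀ i, Module.Finite A (K.homology i) :=
  forall_congr' fun i => Module.Finite.equiv_iff
    ((DerivedCategory.homologyFunctorFactors (ModuleCat.{u} A) i).app K).toLinearEquiv

omit [IsNoetherianRing A] in
lemma IsFiniteD.of_iso {Z W : D A} (h : IsFiniteD Z) (e : Z ≅ W) : IsFiniteD W := fun i => by
  have := h i
  exact Module.Finite.equiv ((hD A i).mapIso e).toLinearEquiv

lemma isFiniteD_obj₁ {T : Triangle (D A)} (hT : T ∈ distTriang (D A)) (h₂ : IsFiniteD T.obj₂)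
    (h₃ : IsFiniteD T.obj₃) : IsFiniteD T.obj₁ := fun i =>
  finite_of_exact (DerivedCategory.HomologySequence.exact₁ T hT (i - 1) i (by lia)) (h₃ _) (h₂ _)

/-- A bounded complex of finitely generated projective modules. -/
structure IsPerfectComplex (G : CochainComplex (ModuleCat.{u} A) ℤ) : Prop where
  bounded : ∃ n, G.IsStrictlyLE n
  projective : ∀ i, Projective (G.X i)
  finite : ∀ i, Module.Finite A (G.X i)

omit [IsNoetherianRing A] in
lemma isPerfectComplex_single (N : ModuleCat.{u} A) (hN : Projective N) (hN' : Module.Finite A N)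
    (k : ℤ) : IsPerfectComplex ((CochainComplex.singleFunctor (ModuleCat.{u} A) k).obj N) where
  bounded := ⟨k, inferInstance⟩
  projective i := by
    by_cases h : i = k
    · subst h
      exact Projective.of_iso (singleObjXSelf (ComplexShape.up ℤ) i N).symm hN
    · exact (isZero_single_obj_X (ComplexShape.up ℤ) k N i h).projective
  finite i := by
    by_cases h : i = k
    · subst h
      exact Module.Finite.equiv (singleObjXSelf (ComplexShape.up ℤ) i N).symm.toLinearEquiv
    · have := ModuleCat.subsingleton_of_isZero (isZero_single_obj_X (ComplexShape.up ℤ) k N i h)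
      exact (inferInstance : Module.Finite A (((single (ModuleCat.{u} A) (ComplexShape.up ℤ) k).obj N).X i))

omit [IsNoetherianRing A] in
lemma IsPerfectComplex.mappingCone {K L : CochainComplex (ModuleCat.{u} A) ℤ} (φ : K ⟶ L)
    (hK : IsPerfectComplex K) (hL : IsPerfectComplex L) :
    IsPerfectComplex (CochainComplex.mappingCone φ) where
  bounded := by
    obtain ⟨n, hn⟩ := hK.bounded
    obtain ⟨m, hm⟩ := hL.bounded
    refine ⟨max n m, ?_⟩
    rw [isStrictlyLE_iff]
    intro i hi
    refine IsZero.of_iso ?_ (homotopyCofiber.XIsoBiprod φ i (i + 1) rfl)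
    rw [biprod_isZero_iff]
    exact ⟨K.isZero_of_isStrictlyLE n _, L.isZero_of_isStrictlyLE m _⟩
  projective i := by
    have := hK.projective (i + 1)
    have := hL.projective i
    exact Projective.of_iso (homotopyCofiber.XIsoBiprod φ i (i + 1) rfl).symm inferInstance
  finite i := by
    have := hK.finite (i + 1)
    have := hL.finite i
    exact Module.Finite.equiv ((homotopyCofiber.XIsoBiprod φ i (i + 1) rfl) ≪≫
      ModuleCat.biprodIsoProd _ _).symm.toLinearEquiv

omit [IsNoetherianRing A] in
/-- Finitely generated cohomology is covered by a free module placed in one degree. -/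
lemma exists_epi_homology (W : D A) (k : ℤ) (h : Module.Finite A ((hD A k).obj W)) :
    ∃ (N : ModuleCat.{u} A) (f : (toD A).obj ((CochainComplex.singleFunctor _ k).obj N) ⟶ W),
      Projective N ∧ Module.Finite A N ∧ Epi ((hD A k).map f) := by
  let K := (toD A).objPreimage W
  let e : (toD A).obj K ≅ W := (toD A).objObjPreimageIso W
  let e' : (hD A k).obj ((toD A).obj K) ≅ K.homology k :=
    (DerivedCategory.homologyFunctorFactors (ModuleCat.{u} A) k).app K
  have hfin : Module.Finite A (K.homology k) :=
    Module.Finite.equiv (((hD A k).mapIso e).symm ≪≫ e').toLinearEquiv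
  obtain ⟨s, p, hp⟩ := Module.Finite.exists_fin' A (K.homology k)
  let N := ModuleCat.of A (Fin s → A)
  have hN : Projective N := (IsProjective.iff_projective (R := A) (P := N)).1 inferInstance
  have hp' : Epi (ModuleCat.ofHom p : N ⟶ K.homology k) := (ModuleCat.epi_iff_surjective _).2 hp
  let q : N ⟶ K.cycles k := Projective.factorThru (ModuleCat.ofHom p) (K.homologyπ k)
  have hq : q ≫ K.homologyπ k = ModuleCat.ofHom p := Projective.factorThru_comp _ _
  let f : (single _ (ComplexShape.up ℤ) k).obj N ⟶ K :=
    mkHomFromSingle (q ≫ K.iCycles k) (fun j _ => by simp)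
  have hf : (singleObjCyclesSelfIso (ComplexShape.up ℤ) k N).inv ≫ cyclesMap f k = q := by
    rw [← cancel_mono (K.iCycles k), Category.assoc, cyclesMap_i,
      singleObjCyclesSelfIso_inv_iCycles_assoc, mkHomFromSingle_f, Iso.inv_hom_id_assoc]
  have hf' : Epi (homologyMap f k) := by
    have : (singleObjCyclesSelfIso (ComplexShape.up ℤ) k N).inv ≫ homologyπ _ k ≫ homologyMap f k =
        ModuleCat.ofHom p := by
      rw [homologyπ_naturality, reassoc_of% hf, hq]
    have h2 : Epi (homologyπ ((single _ (ComplexShape.up ℤ) k).obj N) k ≫ homologyMap f k) :=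
      @epi_of_epi_fac _ _ _ _ _ _ _ _ hp' this
    exact @epi_of_epi _ _ _ _ _ _ _ h2
  refine ⟨N, (toD A).map f ≫ e.hom, hN, inferInstance, ?_⟩
  rw [Functor.map_comp]
  have h1 : Epi ((hD A k).map ((toD A).map f)) :=
    ((MorphismProperty.epimorphisms _).arrow_mk_iso_iff ((Arrow.isoOfNatIso
      (DerivedCategory.homologyFunctorFactors (ModuleCat.{u} A) k) (Arrow.mk f)))).2 hf'
  exact @epi_comp _ _ _ _ _ _ h1 _ inferInstance

/-- `B` is approximated by a perfect complex up to an object of `D^{≤ k}`. -/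
def IsApprox (B : D A) (k : ℤ) : Prop :=
  ∃ (G : CochainComplex (ModuleCat.{u} A) ℤ) (W : D A) (a : W ⟶ (toD A).obj G)
    (b : (toD A).obj G ⟶ B) (c : B ⟶ W⟦(1 : ℤ)⟧), Triangle.mk a b c ∈ distTriang (D A) ∧
    IsPerfectComplex G ∧ G.IsStrictlyGE k ∧ W.IsLE k

open ZeroObject in
omit [IsNoetherianRing A] in
lemma isApprox_of_isLE {B : D A} {n k : ℤ} (hB : B.IsLE n) (hk : n + 1 ≤ k) : IsApprox B k := by
  have hz : IsZero ((toD A).obj (0 : CochainComplex (ModuleCat.{u} A) ℤ)) :=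
    (toD A).map_isZero (isZero_zero _)
  have hz' (i : ℤ) : IsZero ((0 : CochainComplex (ModuleCat.{u} A) ℤ).X i) :=
    (HomologicalComplex.eval (ModuleCat.{u} A) (ComplexShape.up ℤ) i).map_isZero (isZero_zero _)
  obtain ⟨W, a, c, hT⟩ := distinguished_cocone_triangle₁
    (0 : (toD A).obj (0 : CochainComplex (ModuleCat.{u} A) ℤ) ⟶ B)
  refine ⟨0, W, a, 0, c, hT, ⟨⟨0, ?_⟩, fun i => (hz' i).projective, fun i => ?_⟩, ?_, ?_⟩
  · rw [isStrictlyLE_iff]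
    exact fun i _ => hz' i
  · have := ModuleCat.subsingleton_of_isZero (hz' i)
    infer_instance
  · rw [isStrictlyGE_iff]
    exact fun i _ => hz' i
  · rw [DerivedCategory.isLE_iff]
    intro i hi
    exact ShortComplex.Exact.isZero_of_both_zeros
      (DerivedCategory.HomologySequence.exact₁ _ hT (i - 1) i (by lia))
      ((B.isZero_of_isLE n (i - 1) (by lia)).eq_of_src _ _)
      (((hD A i).map_isZero hz).eq_of_tgt _ _)

/-- One step of building a finite free resolution: a free module covering the top cohomology of the
error term `W` is attached as a new cell to `G`. -/
lemma IsApprox.step {B : D A} (hB : IsFiniteD B) {k : ℤ} (h : IsApprox B (k + 1)) :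
    IsApprox B k := by
  obtain ⟨G, W, a, b, c, hT, hG, hG', hW⟩ := h
  have hfin : IsFiniteD W := isFiniteD_obj₁ hT
    ((isFiniteD_toD_iff G).2 fun i => finite_homology G i (hG.finite i)) hB
  obtain ⟨N, f, hN, hN', hf⟩ := exists_epi_homology W (k + 1) (hfin _)
  have hS := isPerfectComplex_single N hN hN' (k + 1)
  obtain ⟨φ, hφ⟩ := exists_toD_map_eq hS.bounded hS.projective (f ≫ a)
  -- The octahedral axiom for the composite N → W → G shows that the cone of `φ` approximates `B`
  -- with error `W'`, whose cohomology in degree k + 1 has been killed.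
  obtain ⟨W', g, h, hT'⟩ := distinguished_cocone_triangle f
  have hT₃ := DerivedCategory.mappingCone_triangle_distinguished φ
  refine ⟨mappingCone φ, W', _, _, _,
    (Triangulated.someOctahedron hφ.symm hT' hT hT₃).mem, hS.mappingCone φ hG,
    CochainComplex.isStrictlyGE_mappingCone φ (k + 1) (k + 1) k, ?_⟩
  rw [DerivedCategory.isLE_iff]
  intro i hi
  refine ShortComplex.Exact.isZero_of_both_zeros
    (DerivedCategory.HomologySequence.exact₃ _ hT' i (i + 1) rfl) ?_ ?_
  · refine (DerivedCategory.HomologySequence.epi_homologyMap_mor₁_iff _ hT' i).1 ?_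
    by_cases h : i = k + 1
    · subst h
      exact hf
    · exact ⟨fun _ _ _ => (W.isZero_of_isLE (k + 1) i (by lia)).eq_of_src _ _⟩
  · have : ((toD A).obj ((CochainComplex.singleFunctor (ModuleCat.{u} A) (k + 1)).obj N)).IsLE (k + 1) :=
      (DerivedCategory.isLE_Q_obj_iff _ _).2 inferInstance
    exact IsZero.eq_of_tgt (DerivedCategory.isZero_of_isLE _ (k + 1) (i + 1) (by lia) (hX := this)) _ _

/-- Finitely generated free approximations. -/
lemma isApprox {B : D A} (hB : IsFiniteD B) (hB' : ∃ n, B.IsLE n) (k : ℤ) : IsApprox B k := by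
  obtain ⟨n, hn⟩ := hB'
  by_cases h : n + 1 ≤ k
  · exact isApprox_of_isLE hn h
  · obtain ⟨d, hd⟩ := Int.le.dest (show k ≤ n + 1 by lia)
    induction d generalizing k with
    | zero => exact isApprox_of_isLE hn (by lia)
    | succ d ih =>
      by_cases h' : n + 1 ≤ k + 1
      · exact (isApprox_of_isLE hn h').step hB
      · exact (ih (k + 1) h' (by push_cast at hd; lia)).step hB

end Finite

end

end CIDepth

/-! ### Models whose last differential is not injective modulo the maximal ideal -/

namespace CIDepth
noncomputable section

open HomologicalComplex CochainComplex

section Minimal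

variable {A : Type u} [CommRing A]

lemma shortExact_single {S : ShortComplex (ModuleCat.{u} A)} (hS : S.ShortExact) (k : ℤ) :
    (S.map (CochainComplex.singleFunctor (ModuleCat.{u} A) k)).ShortExact := by
  apply shortExact_of_degreewise_shortExact
  intro i
  by_cases h : i = k
  · subst h
    exact ShortComplex.shortExact_of_iso (ShortComplex.isoMk
      (singleObjXSelf (ComplexShape.up ℤ) i S.X₁).symm (singleObjXSelf (ComplexShape.up ℤ) i S.X₂).symm
      (singleObjXSelf (ComplexShape.up ℤ) i S.X₃).symm
      (by
        change _ ≫ ((single _ (ComplexShape.up ℤ) i).map S.f).f i = _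
        rw [single_map_f_self, Iso.symm_hom, Iso.inv_hom_id_assoc]
        rfl)
      (by
        change _ ≫ ((single _ (ComplexShape.up ℤ) i).map S.g).f i = _
        rw [single_map_f_self, Iso.symm_hom, Iso.inv_hom_id_assoc]
        rfl)) hS
  · have hz (N : ModuleCat.{u} A) := isZero_single_obj_X (ComplexShape.up ℤ) k N i h
    exact
      { exact := ShortComplex.exact_of_isZero_X₂ _ (hz _)
        mono_f := ⟨fun _ _ _ => (hz _).eq_of_tgt _ _⟩
        epi_g := ⟨fun _ _ _ => (hz _).eq_of_src _ _⟩ }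

/-- A module without extensions is projective. -/
lemma projective_of_forall_eq_zero (K : ModuleCat.{u} A) (k : ℤ)
    (h : ∀ (M : ModuleCat.{u} A) (f : (toD A).obj ((CochainComplex.singleFunctor _ k).obj K) ⟶
      (toD A).obj ((CochainComplex.singleFunctor _ (k - 1)).obj M)), f = 0) : Projective K := by
  let p := Projective.π K
  have hS : (ShortComplex.mk (kernel.ι p) p (kernel.condition p)).ShortExact :=
    { exact := ShortComplex.exact_of_f_is_kernel _ (kernelIsKernel _) }
  have hT := DerivedCategory.triangleOfSES_distinguished (shortExact_single hS k)
  let e : ((toD A).obj ((CochainComplex.singleFunctor _ k).obj (kernel p)))⟦(1 : ℤ)⟧ ≅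
      (toD A).obj ((CochainComplex.singleFunctor _ (k - 1)).obj (kernel p)) :=
    ((toD A).commShiftIso (1 : ℤ)).symm.app _ ≪≫ (toD A).mapIso
      (((CochainComplex.singleFunctors (ModuleCat.{u} A)).shiftIso 1 (k - 1) k (by lia)).app _)
  -- The hypothesis kills the class of 0 → ker p → P → K → 0 in Ext¹, so the identity of `K` lifts.
  obtain ⟨s, hs⟩ := Triangle.coyoneda_exact₃ _ hT (𝟙 _) (by
    exact (Category.id_comp _).trans ((cancel_mono e.hom).1 ((h _ _).trans zero_comp.symm)))
  obtain ⟨t, rfl⟩ := (DerivedCategory.singleFunctor (ModuleCat.{u} A) k).map_surjective s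
  have ht : t ≫ p = 𝟙 K := by
    apply (DerivedCategory.singleFunctor (ModuleCat.{u} A) k).map_injective
    rw [Functor.map_comp, CategoryTheory.Functor.map_id]
    exact hs.symm
  exact (Retract.mk t p ht).projective

lemma mem_smul_top_of_linearMap {M N : Type u} [AddCommGroup M] [Module A M] [AddCommGroup N]
    [Module A N] (f : M →ₗ[A] N) (I : Ideal A) {x : M} (hx : x ∈ I • (⊤ : Submodule A M)) :
    f x ∈ I • (⊤ : Submodule A N) := by
  have := Submodule.mem_map_of_mem (f := f) hx
  rw [Submodule.map_smul''] at this
  exact (Submodule.smul_mono le_rfl le_top) this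

/-- Into a finite free module, split injectivity is detected modulo the maximal ideal. The element
`x` lifts a nonzero vector in the kernel of the reduction. -/
lemma exists_of_not_split [IsLocalRing A] {M N : Type u} [AddCommGroup M] [Module A M]
    [AddCommGroup N] [Module A N] [Module.Finite A M] [Module.Finite A N] [Module.Free A N]
    (f : M →ₗ[A] N) (h : ¬ ∃ g : N →ₗ[A] M, g ∘ₗ f = LinearMap.id) :
    ∃ x : M, x ∉ IsLocalRing.maximalIdeal A • (⊤ : Submodule A M) ∧
      f x ∈ IsLocalRing.maximalIdeal A • (⊤ : Submodule A N) := by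
  rw [IsLocalRing.split_injective_iff_lTensor_residueField_injective,
    injective_iff_map_eq_zero] at h
  push Not at h
  obtain ⟨z, hz, hz'⟩ := h
  obtain ⟨x, rfl⟩ := TensorProduct.mk_surjective A M (IsLocalRing.ResidueField A)
    IsLocalRing.residue_surjective z
  have hk (M : Type u) [AddCommGroup M] [Module A M] (x : M) :
      TensorProduct.mk A (IsLocalRing.ResidueField A) M 1 x = 0 ↔
        x ∈ IsLocalRing.maximalIdeal A • (⊤ : Submodule A M) := by
    rw [← LinearMap.mem_ker, ← LinearMap.ker_tensorProductMk]
    rfl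
  exact ⟨x, fun hx => hz' ((hk M x).2 hx), (hk N (f x)).1 hz⟩

lemma isGE_of_triangle {W G B : D A} {a : W ⟶ G} {b : G ⟶ B} {c : B ⟶ W⟦(1 : ℤ)⟧}
    (hT : Triangle.mk a b c ∈ distTriang (D A)) {k : ℤ} (hG : G.IsGE k) (hB : B.IsGE (k - 1)) :
    W.IsGE k := by
  rw [DerivedCategory.isGE_iff]
  intro i hi
  exact ShortComplex.Exact.isZero_of_both_zeros
      (DerivedCategory.HomologySequence.exact₁ _ hT (i - 1) i (by lia))
      ((B.isZero_of_isGE (k - 1) (i - 1) (by lia)).eq_of_src _ _)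
      ((G.isZero_of_isGE k i hi).eq_of_tgt _ _)

/-- Both neighbours of `W`, namely B[-1] and `G`, have projective models in degrees ≥ -n + 1, while
`M` sits in degree -n. So `f` vanishes on B[-1], factors through `G`, and is zero. -/
lemma eq_zero_of_triangle {G : CochainComplex (ModuleCat.{u} A) ℤ} (hG : IsPerfectComplex G)
    {n : ℤ} (hG' : G.IsStrictlyGE (-n + 1)) {W B : D A} {a : W ⟶ (toD A).obj G}
    {b : (toD A).obj G ⟶ B} {c : B ⟶ W⟦(1 : ℤ)⟧} (hT : Triangle.mk a b c ∈ distTriang (D A))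
    (hB : HasProjModel B n) (M : ModuleCat.{u} A)
    (f : W ⟶ (toD A).obj ((CochainComplex.singleFunctor _ (-n)).obj M)) : f = 0 := by
  have hM (i : ℤ) (hi : ¬ i < -n + 1) :
      IsZero (((CochainComplex.singleFunctor (ModuleCat.{u} A) (-n)).obj M).X i) :=
    isZero_single_obj_X (ComplexShape.up ℤ) (-n) M i (by lia)
  obtain ⟨L, hL, ⟨N, hN⟩, hL', ⟨e⟩⟩ := hB
  have hL₁ : (L⟦(-1 : ℤ)⟧).IsStrictlyGE (-n + 1) := L.isStrictlyGE_shift (-n) _ _ (by lia)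
  have hL₂ : (L⟦(-1 : ℤ)⟧).IsStrictlyLE (N + 1) := L.isStrictlyLE_shift N _ _ (by lia)
  let e' : (toD A).obj (L⟦(-1 : ℤ)⟧) ≅ B⟦(-1 : ℤ)⟧ :=
    ((toD A).commShiftIso (-1 : ℤ)).app L ≪≫ (CategoryTheory.shiftFunctor (D A) (-1 : ℤ)).mapIso e
  have h₁ : (Triangle.mk a b c).invRotate.mor₁ ≫ f = 0 := by
    refine (cancel_epi e'.hom).1 (Eq.trans ?_ comp_zero.symm)
    refine eq_zero_of_isStrictlyGE ⟨_, hL₂⟩ (fun i => hL' _) (fun i => ?_) _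
    by_cases hi : i < -n + 1
    · exact Or.inl ((L⟦(-1 : ℤ)⟧).isZero_of_isStrictlyGE (-n + 1) i)
    · exact Or.inr (hM i hi)
  obtain ⟨g, rfl⟩ := Triangle.yoneda_exact₂ _ (inv_rot_of_distTriang _ hT) f h₁
  have : g = 0 := by
    refine eq_zero_of_isStrictlyGE hG.bounded hG.projective (fun i => ?_) _
    by_cases hi : i < -n + 1
    · exact Or.inl (G.isZero_of_isStrictlyGE (-n + 1) i)
    · exact Or.inr (hM i hi)
  rw [this, comp_zero]
  rfl

/-- The cokernel of a split monomorphism of complexes. -/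
lemma hasProjModel_cokernel {T G : CochainComplex (ModuleCat.{u} A) ℤ} (hG : IsPerfectComplex G)
    {n : ℤ} (hG' : G.IsStrictlyGE (-n)) (φ : T ⟶ G) (hφ : ∀ i, ∃ r, φ.f i ≫ r = 𝟙 _) {B : D A}
    {b : (toD A).obj G ⟶ B} {c : B ⟶ ((toD A).obj T)⟦(1 : ℤ)⟧}
    (hT : Triangle.mk ((toD A).map φ) b c ∈ distTriang (D A)) : HasProjModel B n := by
  have hm (i : ℤ) : Mono (φ.f i) := by
    obtain ⟨r, hr⟩ := hφ i
    exact mono_of_mono_fac hr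
  have hm' : Mono φ := mono_of_mono_f _ hm
  have hS : (ShortComplex.mk φ (cokernel.π φ) (cokernel.condition φ)).ShortExact :=
    { exact := ShortComplex.exact_of_g_is_cokernel _ (cokernelIsCokernel _) }
  have hS' (i : ℤ) := hS.map_of_exact (HomologicalComplex.eval _ _ i)
  have hz (i : ℤ) (hi : IsZero (G.X i)) : IsZero ((cokernel φ).X i) := by
    have := (hS' i).epi_g
    exact IsZero.of_epi (X := G.X i) ((cokernel.π φ).f i) hi
  obtain ⟨N, hN⟩ := hG.bounded
  refine ⟨cokernel φ, ?_, ⟨N, ?_⟩, fun i => ?_, ⟨?_⟩⟩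
  · rw [isStrictlyGE_iff]
    exact fun i hi => hz i (G.isZero_of_isStrictlyGE (-n) i)
  · rw [isStrictlyLE_iff]
    exact fun i hi => hz i (G.isZero_of_isStrictlyLE N i)
  · obtain ⟨r, hr⟩ := hφ i
    have := (hS' i).epi_g
    let s := ShortComplex.Splitting.ofExactOfRetraction _ (hS' i).exact r hr this
    have := hG.projective i
    exact (Retract.mk (Y := G.X i) s.s ((cokernel.π φ).f i) s.s_g).projective
  · exact Triangle.π₃.mapIso (isoTriangleOfIso₁₂ _ _
      (DerivedCategory.triangleOfSES_distinguished hS) hT (Iso.refl _) (Iso.refl _)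
      ((Category.comp_id _).trans (Category.id_comp _).symm))

/-- An object of finite projective dimension `n` with finitely generated cohomology has a
projective model of length `n` whose last differential is not injective modulo the maximal ideal. -/
theorem exists_minimal_model [IsLocalRing A] [IsNoetherianRing A] {Z : D A} (hZ : IsFiniteD Z)
    (hZ' : ∃ N, Z.IsLE N) {n : ℤ} (h : HasProjModel Z n) (h' : ¬ HasProjModel Z (n - 1)) :
    ∃ L : CochainComplex (ModuleCat.{u} A) ℤ, L.IsStrictlyGE (-n) ∧ (∃ N, L.IsStrictlyLE N) ∧
      (∀ i, Projective (L.X i)) ∧ Nonempty ((toD A).obj L ≅ Z) ∧ ∃ a : L.X (-n),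
        a ∉ IsLocalRing.maximalIdeal A • (⊤ : Submodule A (L.X (-n))) ∧
        L.d (-n) (-n + 1) a ∈ IsLocalRing.maximalIdeal A • (⊤ : Submodule A (L.X (-n + 1))) := by
  -- The approximation stops one degree before the end of a model of length n. The error term is
  -- then the syzygy module `K` in degree -n + 1, and the finite length forces it to be projective.
  obtain ⟨G, W, a, b, c, hT, hG, hG', hW⟩ := isApprox hZ hZ' (-n + 1)
  have hGE : ((toD A).obj G).IsGE (-n + 1) := (DerivedCategory.isGE_Q_obj_iff _ _).2 inferInstance
  have hZGE : Z.IsGE (-n + 1 - 1) := by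
    rw [add_sub_cancel_right]
    exact h.isGE
  have hWGE : W.IsGE (-n + 1) := isGE_of_triangle hT hGE hZGE
  obtain ⟨K, ⟨e⟩⟩ := DerivedCategory.exists_iso_singleFunctor_obj_of_isGE_of_isLE W (-n + 1)
  let T := (CochainComplex.singleFunctor (ModuleCat.{u} A) (-n + 1)).obj K
  let e₁ : W ≅ (toD A).obj T := e
  have hWfin : IsFiniteD W := isFiniteD_obj₁ hT
    ((isFiniteD_toD_iff G).2 fun i => finite_homology G i (hG.finite i)) hZ
  have hKfin : Module.Finite A K := by
    have := (isFiniteD_toD_iff T).1 (hWfin.of_iso e₁) (-n + 1)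
    have hf : Module.Finite A (((single (ModuleCat.{u} A) (ComplexShape.up ℤ) (-n + 1)) ⋙
      homologyFunctor (ModuleCat.{u} A) (ComplexShape.up ℤ) (-n + 1)).obj K) := this
    exact @Module.Finite.equiv _ _ _ _ _ _ _ _ hf ((homologyFunctorSingleIso (ModuleCat.{u} A) (ComplexShape.up ℤ)
      (-n + 1)).app K).toLinearEquiv
  have hK : Projective K := by
    refine projective_of_forall_eq_zero K (-n + 1) fun M f => ?_
    refine (cancel_epi e₁.hom).1 (Eq.trans ?_ comp_zero.symm)
    revert f
    rw [add_sub_cancel_right]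
    exact fun f => eq_zero_of_triangle hG hG' hT h M _
  have hTp : IsPerfectComplex T := isPerfectComplex_single K hK hKfin (-n + 1)
  obtain ⟨φ, hφ⟩ := exists_toD_map_eq hTp.bounded hTp.projective (e₁.inv ≫ a)
  have hT' : Triangle.mk ((toD A).map φ) b (c ≫ e₁.hom⟦(1 : ℤ)⟧') ∈ distTriang (D A) :=
   by
    refine isomorphic_distinguished _ hT _ (Triangle.isoMk _ _ e₁.symm (Iso.refl _) (Iso.refl _)
      ((Category.comp_id _).trans hφ) ((Category.comp_id _).trans (Category.id_comp _).symm) ?_)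
    change (c ≫ e₁.hom⟦(1 : ℤ)⟧') ≫ e₁.inv⟦(1 : ℤ)⟧' = 𝟙 _ ≫ c
    rw [Category.assoc, ← Functor.map_comp, Iso.hom_inv_id, CategoryTheory.Functor.map_id,
      Category.comp_id, Category.id_comp]
  have hTz (i : ℤ) (hi : i ≠ -n + 1) : IsZero (T.X i) :=
    isZero_single_obj_X (ComplexShape.up ℤ) (-n + 1) K i hi
  -- A splitting of K → G^{-n+1} would make the cokernel of `φ` a projective model of length n - 1.
  have hns : ¬ ∃ g : G.X (-n + 1) →ₗ[A] T.X (-n + 1), g ∘ₗ (φ.f (-n + 1)).hom = LinearMap.id := by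
    rintro ⟨g, hg⟩
    refine h' (hasProjModel_cokernel hG (n := n - 1) ?_ φ (fun i => ?_) hT')
    · rwa [show -(n - 1) = -n + 1 by ring]
    · by_cases hi : i = -n + 1
      · subst hi
        exact ⟨ModuleCat.ofHom g, ModuleCat.hom_ext hg⟩
      · exact ⟨0, (hTz i hi).eq_of_src _ _⟩
  have := hTp.finite (-n + 1)
  have := hG.finite (-n + 1)
  have := flat_of_projective (hG.projective (-n + 1))
  have : Module.Free A (G.X (-n + 1)) := Module.free_of_flat_of_isLocalRing
  obtain ⟨x, hx, hx'⟩ := exists_of_not_split _ hns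
  -- The required element is `x`, seen in the shifted copy of `K`, which is the lowest term of the
  -- cone. The differential there is φ, as `T` has nothing in the next degree.
  refine ⟨mappingCone φ, CochainComplex.isStrictlyGE_mappingCone φ (-n + 1) (-n + 1) (-n),
    (hTp.mappingCone φ hG).bounded, (hTp.mappingCone φ hG).projective, ⟨?_⟩,
    (mappingCone.inl φ).v (-n + 1) (-n) (by lia) x, fun hx₁ => ?_, ?_⟩
  · exact Triangle.π₃.mapIso (isoTriangleOfIso₁₂ _ _
      (DerivedCategory.mappingCone_triangle_distinguished φ) hT' (Iso.refl _) (Iso.refl _)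
      ((Category.comp_id _).trans (Category.id_comp _).symm))
  · apply hx
    have h1 := mem_smul_top_of_linearMap
      ((mappingCone.fst φ).1.v (-n) (-n + 1) rfl).hom _ hx₁
    have h2 := mappingCone.inl_v_fst_v φ (-n + 1) (-n) (by lia)
    have h3 : ((mappingCone.fst φ).1.v (-n) (-n + 1) rfl).hom
        ((mappingCone.inl φ).v (-n + 1) (-n) (by lia) x) = x := ConcreteCategory.congr_hom h2 x
    rwa [h3] at h1
  · have h2 := mappingCone.inl_v_d φ (-n + 1) (-n) (-n + 1 + 1) (by lia) (by lia)
    have h3 : (mappingCone.inl φ).v (-n + 1) (-n) (by lia) ≫ (mappingCone φ).d (-n) (-n + 1) =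
        φ.f (-n + 1) ≫ (mappingCone.inr φ).f (-n + 1) := by
      rw [h2, (hTz (-n + 1 + 1) (by lia)).eq_of_tgt (T.d _ _) 0, zero_comp, sub_zero]
    have h4 := mem_smul_top_of_linearMap ((mappingCone.inr φ).f (-n + 1)).hom _ hx'
    exact (ConcreteCategory.congr_hom h3 x).symm ▸ h4

end Minimal

end

end CIDepth

/-! ### Socle elements in the lowest degree of a tensor product -/

namespace CIDepth
noncomputable section

open HomologicalComplex CochainComplex TensorProduct

section Corner

variable {A : Type u} [CommRing A] [IsLocalRing A]

omit [IsLocalRing A] in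
lemma isIso_homologyπ_of_isStrictlyGE (K : CochainComplex (ModuleCat.{u} A) ℤ) (j : ℤ)
    [K.IsStrictlyGE j] : IsIso (K.homologyπ j) :=
  K.isIso_homologyπ (j - 1) j (by simp)
    ((K.isZero_of_isStrictlyGE j (j - 1)).eq_of_src _ _)

/-- In the lowest degree of a complex there are no boundaries, so a nonzero cycle is a nonzero class
and the socle can be read off from chains. -/
lemma supE_eq_of_socle_element (K : CochainComplex (ModuleCat.{u} A) ℤ) (j : ℤ)
    [K.IsStrictlyGE j] {z : K.X j} (hz : z ≠ 0) (hd : K.d j (j + 1) z = 0)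
    (hm : ∀ x ∈ IsLocalRing.maximalIdeal A, x • z = 0) : supE ((toD A).obj K) = (((-j : ℤ) : ℝ) : EReal) := by
  let t : ModuleCat.of A A ⟶ K.X j := ModuleCat.ofHom (LinearMap.toSpanSingleton A (K.X j) z)
  have ht : t ≫ K.d j (j + 1) = 0 := by
    ext
    change K.d j (j + 1) ((1 : A) • z) = 0
    rw [one_smul, hd]
  let c : K.cycles j := K.liftCycles t (j + 1) (by simp) ht (1 : A)
  have hc : K.iCycles j c = z :=
    (ConcreteCategory.congr_hom (K.liftCycles_i t (j + 1) (by simp) ht) (1 : A)).trans (one_smul _ _)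
  have hinj : Function.Injective (K.iCycles j) := (ModuleCat.mono_iff_injective _).1 inferInstance
  have hc' : ∀ x ∈ IsLocalRing.maximalIdeal A, x • c = 0 := fun x hx => hinj (by
    rw [map_smul, hc, hm x hx, map_zero])
  have := isIso_homologyπ_of_isStrictlyGE K j
  let e : K.cycles j ≅ (hD A j).obj ((toD A).obj K) :=
    @asIso _ _ _ _ (K.homologyπ j) this ≪≫
      ((DerivedCategory.homologyFunctorFactors (ModuleCat.{u} A) j).app K).symm
  have hK : ((toD A).obj K).IsGE j := (DerivedCategory.isGE_Q_obj_iff _ _).2 inferInstance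
  refine supE_eq_of_socle hK (m := e.toLinearEquiv c) ?_ fun x hx => ?_
  · rw [Ne, LinearEquiv.map_eq_zero_iff]
    rintro h
    rw [h, map_zero] at hc
    exact hz hc.symm
  · rw [← map_smul, hc' x hx, map_zero]

omit [IsLocalRing A] in
lemma exists_element_of_homology (K : CochainComplex (ModuleCat.{u} A) ℤ) (j : ℤ)
    [K.IsStrictlyGE j] (h : ¬ IsZero (K.homology j)) (I : Ideal A)
    (hm : ∀ x ∈ I, ∀ m : K.homology j, x • m = 0) :
    ∃ z : K.X j, z ≠ 0 ∧ K.d j (j + 1) z = 0 ∧ ∀ x ∈ I, x • z = 0 := by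
  rw [ModuleCat.isZero_iff_subsingleton, not_subsingleton_iff_nontrivial] at h
  obtain ⟨m, hm0⟩ := exists_ne (0 : K.homology j)
  have hinj : Function.Injective (K.iCycles j) := (ModuleCat.mono_iff_injective _).1 inferInstance
  have hiso := isIso_homologyπ_of_isStrictlyGE K j
  have hbij : Function.Bijective (K.homologyπ j) := (ConcreteCategory.isIso_iff_bijective _).1 hiso
  obtain ⟨c, rfl⟩ := hbij.2 m
  refine ⟨K.iCycles j c, fun hc => hm0 ?_, ConcreteCategory.congr_hom (K.iCycles_d j (j + 1)) c,
    fun x hx => ?_⟩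
  · rw [hinj (hc.trans (map_zero _).symm), map_zero]
  · rw [← map_smul, show x • c = 0 from hbij.1 (by rw [map_smul, hm x hx, map_zero]), map_zero]

/-- A projective module embeds as a summand of a free one, and there an element outside 𝔪M has a
unit coordinate. That coordinate sends a ⊗ v to a unit multiple of v. -/
lemma tmul_ne_zero {M N : Type u} [AddCommGroup M] [Module A M] [Module.Projective A M]
    [AddCommGroup N] [Module A N] {a : M} (ha : a ∉ IsLocalRing.maximalIdeal A • (⊤ : Submodule A M)) {v : N} (hv : v ≠ 0) :
    a ⊗ₜ[A] v ≠ 0 := by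
  obtain ⟨s, hs⟩ := (Module.projective_def (R := A) (P := M)).1 inferInstance
  have : ∃ p, s a p ∉ IsLocalRing.maximalIdeal A := by
    by_contra! h
    apply ha
    rw [← hs a, Finsupp.linearCombination_apply]
    exact Submodule.sum_mem _ fun p _ => Submodule.smul_mem_smul (h p) trivial
  obtain ⟨p, hp⟩ := this
  intro h
  have h1 := congrArg (fun y => TensorProduct.lid A N
    (LinearMap.rTensor N (Finsupp.lapply p ∘ₗ s) y)) h
  simp only [LinearMap.rTensor_tmul, TensorProduct.lid_tmul, map_zero] at h1
  rw [IsLocalRing.mem_maximalIdeal, mem_nonunits_iff, not_not] at hp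
  exact hv (hp.smul_eq_zero.1 h1)

omit [IsLocalRing A] in
lemma tmul_eq_zero_of_mem {M N : Type u} [AddCommGroup M] [Module A M] [AddCommGroup N]
    [Module A N] {I : Ideal A} {a : M} (ha : a ∈ I • (⊤ : Submodule A M)) {v : N}
    (hv : ∀ x ∈ I, x • v = 0) : a ⊗ₜ[A] v = 0 := by
  refine Submodule.smul_induction_on (p := fun a => a ⊗ₜ[A] v = 0) ha (fun x hx y _ => ?_)
    fun x y hx hy => ?_
  · rw [TensorProduct.smul_tmul, hv x hx, TensorProduct.tmul_zero]
  · rw [TensorProduct.add_tmul, hx, hy, add_zero]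

omit [IsLocalRing A] in
lemma add_units_smul_apply_eq_zero {M N : ModuleCat.{u} A} (f g : M ⟶ N) (ε : ℤˣ) {z : M}
    (hf : f z = 0) (hg : g z = 0) : (f + ε • g) z = 0 := by
  obtain rfl | rfl := Int.units_eq_one_or ε
  · rw [one_smul]
    change f z + g z = 0
    rw [hf, hg, add_zero]
  · rw [Units.neg_smul, one_smul]
    change f z + -(g z) = 0
    rw [hf, hg, neg_zero, add_zero]

variable {L : CochainComplex (ModuleCat.{u} A) ℤ} {n : ℤ} [L.IsStrictlyGE (-n)]
  (hL : ∃ N, L.IsStrictlyLE N) (hL' : ∀ i, Projective (L.X i)) {a : L.X (-n)}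
  (ha : a ∉ IsLocalRing.maximalIdeal A • (⊤ : Submodule A (L.X (-n))))
  (ha' : L.d (-n) (-n + 1) a ∈ IsLocalRing.maximalIdeal A • (⊤ : Submodule A (L.X (-n + 1))))

omit [IsLocalRing A] in
lemma isStrictlyGE_tensorObj (V : CochainComplex (ModuleCat.{u} A) ℤ) (j : ℤ)
    [V.IsStrictlyGE j] : ((tensL L).obj V).IsStrictlyGE (-n + j) := by
  rw [isStrictlyGE_iff]
  intro i hi
  have : Subsingleton (((tensL L).obj V).X i) := by
    refine subsingleton_of_forall_eq 0 fun x => ?_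
    refine tot_ext (MonoidalCategory.curriedTensor (ModuleCat.{u} A)) L V fun p q h => ?_
    have hz : IsZero ((((MonoidalCategory.curriedTensor (ModuleCat.{u} A))).obj (L.X p)).obj (V.X q)) := by
      by_cases hp : p < -n
      · exact (((MonoidalCategory.curriedTensor (ModuleCat.{u} A)).flip.obj (V.X q))).map_isZero
          (L.isZero_of_isStrictlyGE (-n) p)
      · exact ((MonoidalCategory.curriedTensor (ModuleCat.{u} A)).obj (L.X p)).map_isZero
          (V.isZero_of_isStrictlyGE j q)
    have := ModuleCat.subsingleton_of_isZero hz
    exact Subsingleton.elim _ _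
  exact ModuleCat.isZero_of_subsingleton _

include hL' ha ha' in
-- The witness is a ⊗ v. It is a cycle because dv = 0 and da ⊗ v lies in 𝔪(L ⊗ v) = 0.
lemma supE_tensorObj_of_element (V : CochainComplex (ModuleCat.{u} A) ℤ) (j : ℤ)
    [V.IsStrictlyGE j] {v : V.X j} (hv : v ≠ 0) (hd : V.d j (j + 1) v = 0)
    (hm : ∀ x ∈ IsLocalRing.maximalIdeal A, x • v = 0) :
    supE ((toD A).obj ((tensL L).obj V)) = (((-(-n + j) : ℤ) : ℝ) : EReal) := by
  have := isStrictlyGE_tensorObj (L := L) (n := n) V j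
  let F := MonoidalCategory.curriedTensor (ModuleCat.{u} A)
  let z₀ : (F.obj (L.X (-n))).obj (V.X j) := (a ⊗ₜ[A] v : L.X (-n) ⊗[A] V.X j)
  have hproj : Module.Projective A (L.X (-n)) :=
    (IsProjective.iff_projective (R := A) (P := L.X (-n))).2 (hL' _)
  have hz₀ : z₀ ≠ 0 := tmul_ne_zero ha hv
  refine supE_eq_of_socle_element ((tensL L).obj V) (-n + j)
    (z := totι F L V (-n) j (-n + j) rfl z₀) (fun h => hz₀ ?_) ?_ fun x hx => ?_
  · have h1 := ConcreteCategory.congr_hom (totι_π_self F L V (-n) j (-n + j) rfl) z₀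
    refine h1.symm.trans ?_
    exact (congrArg (totπ F L V (-n) j (-n + j) rfl) h).trans (map_zero _)
  · refine (ConcreteCategory.congr_hom
      (totι_d F L V (-n) j (-n + j) (-n + j + 1) rfl rfl) z₀).trans ?_
    have h1 : (F.map (L.d (-n) (-n + 1))).app (V.X j) z₀ = 0 :=
      tmul_eq_zero_of_mem (M := L.X (-n + 1)) ha' hm
    have h2 : (F.obj (L.X (-n))).map (V.d j (j + 1)) z₀ = 0 := by
      change (a ⊗ₜ[A] V.d j (j + 1) v : L.X (-n) ⊗[A] V.X (j + 1)) = 0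
      rw [hd, TensorProduct.tmul_zero]
    refine add_units_smul_apply_eq_zero _ _ _ ?_ ?_
    · exact (congrArg (totι F L V (-n + 1) j (-n + j + 1) (by lia)) h1).trans (map_zero _)
    · exact (congrArg (totι F L V (-n) (j + 1) (-n + j + 1) (by lia)) h2).trans (map_zero _)
  · have h1 : x • z₀ = 0 := by
      change (x • (a ⊗ₜ[A] v) : L.X (-n) ⊗[A] V.X j) = 0
      rw [← TensorProduct.tmul_smul, hm x hx, TensorProduct.tmul_zero]
    exact (map_smul (totι F L V (-n) j (-n + j) rfl).hom x z₀).symm.trans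
      ((congrArg _ h1).trans (map_zero _))

variable [IsNoetherianRing A]

include hL hL' ha ha' in
/-- The Auslander–Buchsbaum formula for a complex of projective modules whose last differential
is not injective modulo the maximal ideal. -/
theorem supE_tensorObj_of_minimal (B : CochainComplex (ModuleCat.{u} A) ℤ)
    (hB : ∃ n, ((toD A).obj B).IsGE n) :
    supE ((toD A).obj (HomologicalComplex.tensorObj L B)) =
      supE ((toD A).obj B) + ((n : ℝ) : EReal) := by
  have hflat := fun i => flat_of_projective (hL' i)
  have hΦ := isHomologicallyExact_tensL L hL hflat
  obtain ⟨xs, hxs⟩ := exists_ofList_eq (IsLocalRing.maximalIdeal A)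
  have hmem : ∀ x ∈ xs, x ∈ IsLocalRing.maximalIdeal A := fun x hx => hxs ▸ Ideal.subset_span hx
  have h₁ := isKoszul_koszul xs B
  have h₂ := hΦ.isKoszul (tensL_map_smul L) xs B
  let V₀ := koszul xs B
  -- Passing to Koszul complexes adds the same length to both sides, since tensoring with `L`
  -- commutes with cones of multiplications.
  suffices h : supE ((toD A).obj ((tensL L).obj V₀)) = supE ((toD A).obj V₀) + ((n : ℝ) : EReal) by
    rw [h₁.supE_eq hmem, h₂.supE_eq hmem, add_right_comm] at h
    exact ereal_add_coe_cancel _ h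
  obtain h | ⟨j, hj, hj'⟩ := isZero_or_exists_least _ (h₁.isGE hB)
  · have h₀ : V₀.Acyclic := fun i => by
      rw [exactAt_iff_isZero_homology]
      exact ((DerivedCategory.homologyFunctorFactors (ModuleCat.{u} A) i).app V₀).isZero_iff.1
        (DerivedCategory.isZero_of_isGE _ (i + 1) i (by lia) (hX := h (i + 1)))
    have h₃ := (isZero_toD_iff _).2 (hΦ.acyclic V₀ h₀)
    rw [supE_eq_bot h, supE_eq_bot, EReal.bot_add]
    exact fun i => (DerivedCategory.isGE_iff _ _).2 fun k _ => (hD A k).map_isZero h₃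
  · have hV₀ : V₀.IsGE j := (DerivedCategory.isGE_Q_obj_iff _ _).1 hj
    -- The truncation makes j the lowest degree at the level of chains, so that a cohomology class
    -- becomes an actual cycle killed by the maximal ideal.
    let V := V₀.truncGE j
    have hπ : QuasiIso (V₀.πTruncGE j) := inferInstance
    obtain ⟨e₁⟩ := nonempty_iso_tensL L hL hflat (V₀.πTruncGE j) hπ
    have e₂ : V₀.homology j ≅ V.homology j := @asIso _ _ _ _ (homologyMap (V₀.πTruncGE j) j) inferInstance
    obtain ⟨v, hv, hd, hm⟩ := exists_element_of_homology V j
      (fun h => hj' (((DerivedCategory.homologyFunctorFactors (ModuleCat.{u} A) j).app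
        V₀).isZero_iff.2 (e₂.isZero_iff.2 h))) (IsLocalRing.maximalIdeal A) (fun x hx =>
          smul_eq_zero_of_iso e₂.symm (smul_koszul_homology xs B x (hxs ▸ hx) j))
    have h₃ := supE_tensorObj_of_element hL' ha ha' V j hv hd hm
    have h₄ := supE_eq_of_socle_element V j hv hd hm
    rw [supE_congr (show (toD A).obj ((tensL L).obj V₀) ≅ (toD A).obj ((tensL L).obj V) from e₁),
      supE_congr (@asIso _ _ _ _ ((toD A).map (V₀.πTruncGE j)) inferInstance), h₃, h₄]
    norm_cast
    ring_nf

end Corner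

end

end CIDepth

/-! ### The Auslander–Buchsbaum formula -/

namespace CIDepth
noncomputable section

open HomologicalComplex CochainComplex RingTheory.Sequence

section AuslanderBuchsbaum

variable {A : Type u} [CommRing A]

lemma HasProjModel.mono {Z : D A} {n m : ℤ} (h : HasProjModel Z n) (hnm : n ≤ m) :
    HasProjModel Z m := by
  obtain ⟨L, h₁, h₂, h₃, h₄⟩ := h
  exact ⟨L, L.isStrictlyGE_of_ge (-m) (-n) (by lia), h₂, h₃, h₄⟩

/-- Separates projective dimension -∞, where models exist in every length, from an integer value,
where a shortest length exists. -/
lemma HasProjModel.forall_or_exists {Z : D A} {n : ℤ} (h : HasProjModel Z n) :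
    (∀ m, HasProjModel Z m) ∨ ∃ m, HasProjModel Z m ∧ ¬ HasProjModel Z (m - 1) := by
  by_cases h' : ∀ m, HasProjModel Z m
  · exact Or.inl h'
  · push Not at h'
    obtain ⟨m, hm⟩ := h'
    obtain ⟨j, hj, hj'⟩ := Int.exists_least_of_bdd (P := fun i => HasProjModel Z i)
      ⟨m, fun z hz => by
        by_contra! hzm
        exact hm (hz.mono hzm.le)⟩ ⟨n, h⟩
    exact Or.inr ⟨j, hj, fun hj'' => by have := hj' _ hj''; lia⟩

lemma isZero_of_forall_isGE {Z : D A} (h : ∀ n, Z.IsGE n) : IsZero Z := by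
  let K := (toD A).objPreimage Z
  let e : (toD A).obj K ≅ Z := (toD A).objObjPreimageIso Z
  refine IsZero.of_iso ?_ e.symm
  rw [isZero_toD_iff]
  intro i
  rw [exactAt_iff_isZero_homology]
  exact ((DerivedCategory.homologyFunctorFactors (ModuleCat.{u} A) i).app K).isZero_iff.1
    (((hD A i).mapIso e).isZero_iff.2
      (DerivedCategory.isZero_of_isGE _ (i + 1) i (by lia) (hX := h (i + 1))))

lemma pd_eq {X : CochainComplex (ModuleCat.{u} A) ℤ} {n : ℤ} (h : HasProjModel ((toD A).obj X) n)
    (h' : ¬ HasProjModel ((toD A).obj X) (n - 1)) : pd X = ((n : ℝ) : EReal) := by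
  rw [← pd_le_iff] at h h'
  refine le_antisymm h (not_lt.1 fun hlt => h' ?_)
  obtain ⟨P, hP⟩ := iInf_lt_iff.1 hlt
  refine (iInf_le _ P).trans (iSup₂_le fun i hi => ?_)
  have h1 : ((i : ℝ) : EReal) < ((n : ℝ) : EReal) := lt_of_le_of_lt
    (le_iSup₂_of_le (f := fun (i : ℤ) (_ : ¬ IsZero (P.P.X (-i))) => ((i : ℝ) : EReal))
      i hi le_rfl) hP
  rw [EReal.coe_lt_coe_iff] at h1
  rw [EReal.coe_le_coe_iff]
  have : i < n := by exact_mod_cast h1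
  exact_mod_cast (by lia : i ≤ n - 1)

lemma pd_eq_bot {X : CochainComplex (ModuleCat.{u} A) ℤ}
    (h : ∀ n, HasProjModel ((toD A).obj X) n) : pd X = ⊥ := by
  refine EReal.eq_bot_iff_forall_lt _ |>.2 fun y => ?_
  obtain ⟨n, hn⟩ := exists_int_lt y
  exact ((pd_le_iff X n).2 (h n)).trans_lt (EReal.coe_lt_coe_iff.2 hn)

lemma exists_hasProjModel_of_pd_lt_top {X : CochainComplex (ModuleCat.{u} A) ℤ} (h : pd X < ⊤) :
    ∃ n, HasProjModel ((toD A).obj X) n := by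
  obtain ⟨y, hy, -⟩ := EReal.lt_iff_exists_real_btwn.1 h
  obtain ⟨n, hn⟩ := exists_int_gt y
  exact ⟨n, (pd_le_iff X n).1 (hy.le.trans (EReal.coe_le_coe_iff.2 hn.le))⟩

variable [IsLocalRing A] [IsNoetherianRing A]

/-- The Auslander–Buchsbaum formula. -/
theorem supE_tensorObj {Z : D A} (hZ : IsFiniteD Z) (hZ' : ∃ N, Z.IsLE N) {n : ℤ}
    (h : HasProjModel Z n) (h' : ¬ HasProjModel Z (n - 1)) {L B : CochainComplex (ModuleCat.{u} A) ℤ}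
    (hL : ∃ N, L.IsStrictlyLE N) (hL' : ∀ i, Projective (L.X i)) (e : (toD A).obj L ≅ Z)
    (hB : ∃ N, B.IsStrictlyLE N) (hB' : ∃ N, ((toD A).obj B).IsGE N) :
    supE ((toD A).obj (HomologicalComplex.tensorObj L B)) =
      supE ((toD A).obj B) + ((n : ℝ) : EReal) := by
  obtain ⟨M, hM, hM₁, hM₂, ⟨e'⟩, a, ha, ha'⟩ := exists_minimal_model hZ hZ' h h'
  -- The given resolution may be exchanged for the special model, since tensoring with `B` depends
  -- only on the class of the resolution.
  obtain ⟨e''⟩ := nonempty_iso_tensorObj hL hL' hM₁ hM₂ (e ≪≫ e'.symm) hB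
  rw [supE_congr e'']
  exact supE_tensorObj_of_minimal hM₁ hM₂ ha ha' B hB'

open ZeroObject in
omit [IsLocalRing A] [IsNoetherianRing A] in
lemma isZero_tensorObj {L B : CochainComplex (ModuleCat.{u} A) ℤ}
    (hL : ∃ N, L.IsStrictlyLE N) (hL' : ∀ i, Projective (L.X i)) (h : IsZero ((toD A).obj L))
    (hB : ∃ N, B.IsStrictlyLE N) :
    IsZero ((toD A).obj (HomologicalComplex.tensorObj L B)) := by
  obtain ⟨n, hn⟩ := hB
  obtain ⟨G, q, _, hq, hG, hG'⟩ := exists_epi_projRes B n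
  obtain ⟨e₁⟩ := nonempty_iso_tensL L hL (fun i => flat_of_projective (hL' i)) q hq
  have hflat := fun i => flat_of_projective (hG i)
  have hz : IsZero ((toD A).obj (0 : CochainComplex (ModuleCat.{u} A) ℤ)) :=
    (toD A).map_isZero (isZero_zero _)
  obtain ⟨e₂⟩ := nonempty_iso_tensR G ⟨_, hG'⟩ (fun i => flat_of_projective (hG i))
    (0 : L ⟶ 0) (quasiIso_of_isIso_toD_map _ ⟨0, h.eq_of_src _ _, hz.eq_of_src _ _⟩)
  refine IsZero.of_iso ?_ (e₁.symm ≪≫ e₂)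
  rw [isZero_toD_iff]
  intro i
  rw [exactAt_iff_isZero_homology]
  apply ShortComplex.isZero_homology_of_isZero_X₂
  have : Subsingleton ((HomologicalComplex.tensorObj (0 : CochainComplex (ModuleCat.{u} A) ℤ) G).X i) := by
    refine subsingleton_of_forall_eq 0 fun x => ?_
    refine tot_ext (MonoidalCategory.curriedTensor (ModuleCat.{u} A)) 0 G fun p q h => ?_
    have h0 : IsZero ((0 : CochainComplex (ModuleCat.{u} A) ℤ).X p) :=
      (HomologicalComplex.eval (ModuleCat.{u} A) (ComplexShape.up ℤ) p).map_isZero (isZero_zero _)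
    have := ModuleCat.subsingleton_of_isZero
      ((((MonoidalCategory.curriedTensor (ModuleCat.{u} A)).flip.obj (G.X q))).map_isZero h0)
    exact @Subsingleton.elim _ this _ _
  exact @ModuleCat.isZero_of_subsingleton _ _ _ this

end AuslanderBuchsbaum

section Regular

open scoped Pointwise

variable {A : Type u} [CommRing A]

/-- The cone of r on a projective model of `M` is one of M/rM, longer by one. -/
lemma hasProjModel_quotSMulTop {M : Type u} [AddCommGroup M] [Module A M] {n : ℤ}
    (h : HasProjModel ((toD A).obj (moduleComplex (R := A) M)) n) {r : A} (hr : IsSMulRegular M r) :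
    HasProjModel ((toD A).obj (moduleComplex (R := A) (QuotSMulTop r M))) (n + 1) := by
  obtain ⟨L, h₁, ⟨N, h₂⟩, h₃, ⟨e⟩⟩ := h
  let S : ShortComplex (ModuleCat.{u} A) := ShortComplex.mk (r • 𝟙 (ModuleCat.of A M))
    (ModuleCat.ofHom (Submodule.mkQ (r • (⊤ : Submodule A M)))) (by
      ext x
      exact (Submodule.Quotient.mk_eq_zero _).2 (Submodule.smul_mem_pointwise_smul x r ⊤ trivial))
  have hS : S.ShortExact :=
    { exact := by
        rw [ShortComplex.moduleCat_exact_iff]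
        intro x hx
        obtain ⟨y, -, hy⟩ := (Submodule.mem_smul_pointwise_iff_exists _ _ _).1
          ((Submodule.Quotient.mk_eq_zero _).1 hx)
        exact ⟨y, hy⟩
      mono_f := (ModuleCat.mono_iff_injective _).2 hr
      epi_g := (ModuleCat.epi_iff_surjective _).2 (Submodule.mkQ_surjective _) }
  have hT := DerivedCategory.triangleOfSES_distinguished (shortExact_single hS 0)
  have hT' := DerivedCategory.mappingCone_triangle_distinguished (r • 𝟙 L)
  refine ⟨mappingCone (r • 𝟙 L), CochainComplex.isStrictlyGE_mappingCone _ (-n) (-n) _, ⟨N, ?_⟩,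
    fun i => ?_, ⟨Triangle.π₃.mapIso (isoTriangleOfIso₁₂ _ _ hT' hT e e ?_)⟩⟩
  · rw [isStrictlyLE_iff]
    intro i hi
    rw [mappingCone.isZero_X_iff]
    exact ⟨L.isZero_of_isStrictlyLE N _, L.isZero_of_isStrictlyLE N _⟩
  · have := h₃ (i + 1)
    have := h₃ i
    exact Projective.of_iso (homotopyCofiber.XIsoBiprod (r • 𝟙 L) i (i + 1) rfl).symm inferInstance
  · change (toD A).map (r • 𝟙 L) ≫ e.hom =
      e.hom ≫ (toD A).map ((CochainComplex.singleFunctor (ModuleCat.{u} A) 0).map (r • 𝟙 _))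
    have h₁ : (CochainComplex.singleFunctor (ModuleCat.{u} A) 0).map (r • 𝟙 (ModuleCat.of A M)) =
        r • 𝟙 _ := by
      apply from_single_hom_ext
      change ((single _ (ComplexShape.up ℤ) 0).map _).f 0 = r • 𝟙 _
      rw [single_map_f_self, Linear.smul_comp, Linear.comp_smul, Category.id_comp, Iso.hom_inv_id]
      rfl
    rw [h₁, Functor.map_smul, Functor.map_smul, CategoryTheory.Functor.map_id,
      CategoryTheory.Functor.map_id, Linear.smul_comp, Linear.comp_smul, Category.id_comp,
      Category.comp_id]

lemma hasProjModel_quotient_ofList {M : Type u} [AddCommGroup M] [Module A M] {n : ℤ}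
    (h : HasProjModel ((toD A).obj (moduleComplex (R := A) M)) n) (rs : List A)
    (hr : IsWeaklyRegular M rs) :
    HasProjModel ((toD A).obj (moduleComplex (R := A)
      (M ⧸ (Ideal.ofList rs • ⊤ : Submodule A M)))) (n + rs.length) := by
  have hiso {M N : Type u} [AddCommGroup M] [Module A M] [AddCommGroup N] [Module A N]
      (e : M ≃ₗ[A] N) : (toD A).obj (moduleComplex (R := A) M) ≅
        (toD A).obj (moduleComplex (R := A) N) :=
    (toD A).mapIso ((CochainComplex.singleFunctor (ModuleCat.{u} A) 0).mapIso e.toModuleIso)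
  induction rs generalizing M n with
  | nil =>
    refine (h.mono (by simp)).of_iso (hiso ?_)
    exact (Submodule.quotEquivOfEqBot _ (by simp)).symm
  | cons r rs ih =>
    rw [isWeaklyRegular_cons_iff] at hr
    refine ((ih (hasProjModel_quotSMulTop h hr.1) hr.2).mono ?_).of_iso (hiso ?_)
    · rw [List.length_cons]
      push_cast
      lia
    · exact (Submodule.quotOfListConsSMulTopEquivQuotSMulTopInner M r rs).symm

lemma hasProjModel_self : HasProjModel ((toD A).obj (moduleComplex (R := A) A)) 0 := by
  have h := isPerfectComplex_single (ModuleCat.of A A)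
    ((IsProjective.iff_projective (R := A) (P := A)).1 inferInstance) inferInstance 0
  exact ⟨moduleComplex (R := A) A, (inferInstance : (moduleComplex (R := A) A).IsStrictlyGE 0),
    h.bounded, h.projective, ⟨Iso.refl _⟩⟩

end Regular

end

end CIDepth

/-! ### Projective dimension over Q and depth over its quotient -/

namespace CIDepth
noncomputable section

open HomologicalComplex CochainComplex RingTheory.Sequence

section Single

variable {A : Type u} [CommRing A] [IsLocalRing A]

lemma supE_moduleComplex_residueField :
    supE ((toD A).obj (moduleComplex (R := A) (IsLocalRing.ResidueField A))) = 0 := by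
  let k := ModuleCat.of A (IsLocalRing.ResidueField A)
  let K := moduleComplex (R := A) (IsLocalRing.ResidueField A)
  have hK : K.IsStrictlyGE 0 := inferInstance
  let e : K.X 0 ≅ k := singleObjXSelf (ComplexShape.up ℤ) 0 k
  have h1 : (1 : IsLocalRing.ResidueField A) ≠ 0 := one_ne_zero
  have := supE_eq_of_socle_element K 0 (z := e.toLinearEquiv.symm (1 : IsLocalRing.ResidueField A))
    ?_ ?_ ?_
  · simpa using this
  · rw [Ne, LinearEquiv.map_eq_zero_iff]
    exact h1
  · have : K.d 0 (0 + 1) = 0 :=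
      (isZero_single_obj_X (ComplexShape.up ℤ) 0 k (0 + 1) (by lia)).eq_of_tgt _ _
    rw [this]
    rfl
  · intro x hx
    rw [← map_smul]
    have h2 : x • (1 : IsLocalRing.ResidueField A) = 0 := by
      rw [Algebra.smul_def, mul_one]
      exact (IsLocalRing.residue_eq_zero_iff x).2 hx
    exact (congrArg e.toLinearEquiv.symm h2).trans (map_zero _)

/-- Tensoring with a resolution of the ring does not change the depth. -/
lemma exists_model_self_supE [IsNoetherianRing A] :
    ∃ P : CochainComplex (ModuleCat.{u} A) ℤ, (∃ N, P.IsStrictlyLE N) ∧ (∀ i, Projective (P.X i)) ∧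
      Nonempty ((toD A).obj P ≅ (toD A).obj (moduleComplex (R := A) A)) ∧
      (∃ n, ((toD A).obj (HomologicalComplex.tensorObj P
        (moduleComplex (R := A) (IsLocalRing.ResidueField A)))).IsGE n) ∧
      supE ((toD A).obj (HomologicalComplex.tensorObj P
        (moduleComplex (R := A) (IsLocalRing.ResidueField A)))) = 0 := by
  let P := moduleComplex (R := A) A
  let K := moduleComplex (R := A) (IsLocalRing.ResidueField A)
  have hP := isPerfectComplex_single (ModuleCat.of A A)
    ((IsProjective.iff_projective (R := A) (P := A)).1 inferInstance) inferInstance 0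
  have hGE : P.IsStrictlyGE (-0) := (inferInstance : P.IsStrictlyGE 0)
  have hK : K.IsStrictlyGE 0 := inferInstance
  have hKD : ((toD A).obj K).IsGE 0 := (DerivedCategory.isGE_Q_obj_iff _ _).2 inferInstance
  have hGE' : ((tensL P).obj K).IsStrictlyGE (-0 + 0) := isStrictlyGE_tensorObj K 0
  let e : P.X (-0) ≅ ModuleCat.of A A := singleObjXSelf (ComplexShape.up ℤ) 0 (ModuleCat.of A A)
  have h := supE_tensorObj_of_minimal hP.bounded hP.projective
    (a := e.toLinearEquiv.symm (1 : A)) (fun h1 => ?_) ?_ K ⟨0, hKD⟩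
  · refine ⟨P, hP.bounded, hP.projective, ⟨Iso.refl _⟩,
      ⟨-0 + 0, (DerivedCategory.isGE_Q_obj_iff _ _).2 (inferInstanceAs (((tensL P).obj K).IsGE _))⟩, ?_⟩
    rw [h, supE_moduleComplex_residueField]
    simp
  · have h2 := mem_smul_top_of_linearMap e.toLinearEquiv.toLinearMap _ h1
    have h3 : e.toLinearEquiv (e.toLinearEquiv.symm (1 : A)) = (1 : A) :=
      e.toLinearEquiv.apply_symm_apply _
    have h4 : (1 : A) ∈ IsLocalRing.maximalIdeal A • (⊤ : Submodule A A) := h3 ▸ h2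
    rw [smul_eq_mul, Ideal.mul_top] at h4
    exact (IsLocalRing.maximalIdeal.isMaximal A).ne_top ((Ideal.eq_top_iff_one _).2 h4)
  · have : P.d (-0) (-0 + 1) = 0 :=
      (isZero_single_obj_X (ComplexShape.up ℤ) 0 (ModuleCat.of A A) (-0 + 1) (by lia)).eq_of_tgt _ _
    rw [this]
    exact Submodule.zero_mem _

end Single

lemma pd_le_of_iso {C : Type*} [Category C] [Abelian C] {X Y : CochainComplex C ℤ} (e : X ≅ Y) :
    pd Y ≤ pd X :=
  le_iInf fun P => by
    have := P.quasiIso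
    exact iInf_le_of_le ⟨P.P, P.π ≫ e.hom, inferInstance, P.projective, P.bounded⟩ le_rfl

section QuasiDeformation

variable {S Q : Type u} [CommRing S] [CommRing Q] [IsLocalRing S] [IsLocalRing Q]
  [IsNoetherianRing S] [IsNoetherianRing Q] {g : Q →+* S} (hg : Function.Surjective g)
  {rs : List Q} (hrs : IsWeaklyRegular Q rs) (hker : RingHom.ker g = Ideal.ofList rs)

omit [IsLocalRing S] [IsLocalRing Q] [IsNoetherianRing S] [IsNoetherianRing Q] in
include hg in
lemma finite_restrictScalars (M : ModuleCat.{u} S) [Module.Finite S M] :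
    Module.Finite Q ((ModuleCat.restrictScalars g).obj M) := by
  let := g.toAlgebra
  let : Module Q M := Module.compHom M g
  have : IsScalarTower Q S M := ⟨fun q s m => mul_smul (g q) s m⟩
  have : Module.Finite Q S := Module.Finite.of_surjective (Algebra.linearMap Q S) hg
  have h : Module.Finite Q M := Module.Finite.trans S M
  exact h

omit [IsLocalRing S] [IsLocalRing Q] [IsNoetherianRing S] [IsNoetherianRing Q] in
include hg in
lemma isFiniteD_restrictScalars {X : CochainComplex (ModuleCat.{u} S) ℤ}
    (hX : ∀ i, Module.Finite S (X.homology i)) : IsFiniteD ((toD Q).obj ((resC g).obj X)) := by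
  rw [isFiniteD_toD_iff]
  intro i
  have := hX i
  have h := finite_restrictScalars hg (X.homology i)
  exact Module.Finite.equiv (mapHomologyIso (ModuleCat.restrictScalars g) X i).symm.toLinearEquiv

omit [IsLocalRing S] [IsLocalRing Q] [IsNoetherianRing S] [IsNoetherianRing Q] in
lemma isLE_restrictScalars {X : CochainComplex (ModuleCat.{u} S) ℤ} (hX : ∃ N, X.IsLE N) :
    ∃ N, ((toD Q).obj ((resC g).obj X)).IsLE N := by
  obtain ⟨N, hN⟩ := hX
  refine ⟨N, (DerivedCategory.isLE_iff _ _).2 fun i hi => ?_⟩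
  refine ((DerivedCategory.homologyFunctorFactors (ModuleCat.{u} Q) i).app _).isZero_iff.2 ?_
  refine (mapHomologyIso (ModuleCat.restrictScalars g) X i).isZero_iff.2 ?_
  exact (isZero_restrictScalars_iff g _).2 (X.isZero_of_isLE N i hi)

include hg hrs hker in
/-- The projective dimension over `Q` measures how tensoring changes the depth over `S`. -/
lemma pd_restrictScalars {P X Y : CochainComplex (ModuleCat.{u} S) ℤ}
    (hP : ∃ n, P.IsStrictlyLE n) (hP' : ∀ i, Projective (P.X i)) (p : P ⟶ X) (hp : QuasiIso p)
    (hX : ∃ N, X.IsLE N) (hX' : ∀ i, Module.Finite S (X.homology i))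
    (hY : ∃ n, Y.IsStrictlyLE n) (hY' : ∃ n, ((toD S).obj Y).IsGE n)
    (hPY : ∃ n, ((toD S).obj (HomologicalComplex.tensorObj P Y)).IsGE n) {n : ℤ}
    (hn : HasProjModel ((toD Q).obj ((resC g).obj X)) n) :
    (pd ((resC g).obj X) = ⊥ ∧ supE ((toD S).obj (HomologicalComplex.tensorObj P Y)) = ⊥) ∨
      ∃ m : ℤ, pd ((resC g).obj X) = ((m : ℝ) : EReal) ∧
        supE ((toD S).obj Y) + ((m : ℝ) : EReal) =
          supE ((toD S).obj (HomologicalComplex.tensorObj P Y)) +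
            ((rs.length : ℝ) : EReal) := by
  have := IsLocalHom.of_surjective g hg
  obtain ⟨L, l, _, hl, hL, hL'⟩ := exists_epi_projRes_restrictScalars (g := g) hP
  -- The tensor product over `Q` is evaluated twice: here by change of rings, below by the
  -- Auslander–Buchsbaum formula. Comparing the results gives the identity over `S`.
  obtain ⟨hGE, h⟩ := supE_tensorObj_restrictScalars hP hP' hY hPY _ Q g hg rs hrs hker rfl L l hl
    hL hL'
  have e : (toD Q).obj L ≅ (toD Q).obj ((resC g).obj X) :=
    @asIso _ _ _ _ ((toD Q).map l) inferInstance ≪≫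
      @asIso _ _ _ _ ((toD Q).map ((resC g).map p)) inferInstance
  have hYres : ∃ n, ((resC g).obj Y).IsStrictlyLE n := by
    obtain ⟨n, hn⟩ := hY
    refine ⟨n, ?_⟩
    rw [isStrictlyLE_iff] at hn ⊢
    exact fun i hi => (ModuleCat.restrictScalars g).map_isZero (hn i hi)
  have hYres' : ∃ n, ((toD Q).obj ((resC g).obj Y)).IsGE n := by
    obtain ⟨n, hn⟩ := hY'
    exact ⟨n, (isGE_toD_iff_of_isZero_iff (fun i => (isZero_restrictScalars_iff g _).symm.trans
      (mapHomologyIso (ModuleCat.restrictScalars g) _ i).isZero_iff.symm) n).1 hn⟩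
  obtain h₁ | ⟨m, h₁, h₂⟩ := hn.forall_or_exists
  · refine Or.inl ⟨pd_eq_bot h₁, ?_⟩
    -- A model vanishing above every degree forces the object to be zero, and then the tensor
    -- product vanishes too.
    have hz : IsZero ((toD Q).obj L) := (isZero_of_forall_isGE fun k => by
      simpa using (h₁ (-k)).isGE).of_iso e
    have hz' := isZero_tensorObj hL hL' hz hYres
    rw [supE_eq_bot fun k => (DerivedCategory.isGE_iff _ _).2 fun i _ =>
      (hD Q i).map_isZero hz'] at h
    obtain h | h := EReal.add_eq_bot_iff.1 h.symm
    · exact h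
    · exact absurd h (EReal.natCast_ne_bot _)
  · refine Or.inr ⟨m, pd_eq h₁ h₂, ?_⟩
    rw [supE_tensorObj (isFiniteD_restrictScalars hg hX') (isLE_restrictScalars hX) h₁ h₂ hL hL' e
      hYres hYres', supE_restrictScalars g hg Y hY'] at h
    exact h

include hg hrs hker in
-- Cones on the regular sequence bound the projective dimension from above. Its exact value comes
-- from `pd_restrictScalars` with X = S and Y = k: both `supE` terms are 0, which leaves the length
-- of the sequence.
lemma pd_restrictScalars_self :
    pd ((CochainComplex.singleFunctor (ModuleCat.{u} Q) 0).obj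
      ((ModuleCat.restrictScalars g).obj (ModuleCat.of S S))) = ((rs.length : ℝ) : EReal) := by
  let X := (CochainComplex.singleFunctor (ModuleCat.{u} Q) 0).obj
      ((ModuleCat.restrictScalars g).obj (ModuleCat.of S S))
  let K := moduleComplex (R := S) (IsLocalRing.ResidueField S)
  have e : X ≅ (resC g).obj (moduleComplex (R := S) S) :=
    ((singleMapHomologicalComplex (ModuleCat.restrictScalars g) (ComplexShape.up ℤ) 0).app
      (ModuleCat.of S S)).symm
  let t : Q →ₗ[Q] ((ModuleCat.restrictScalars g).obj (ModuleCat.of S S)) :=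
    LinearMap.toSpanSingleton Q ((ModuleCat.restrictScalars g).obj (ModuleCat.of S S)) (1 : S)
  have ht (q : Q) : t q = g q := mul_one (g q)
  have hker' : t.ker = (Ideal.ofList rs • ⊤ : Submodule Q Q) := by
    rw [smul_eq_mul, Ideal.mul_top, ← hker]
    ext q
    rw [LinearMap.mem_ker, ht]
    rfl
  let E : (Q ⧸ (Ideal.ofList rs • ⊤ : Submodule Q Q)) ≃ₗ[Q]
      ((ModuleCat.restrictScalars g).obj (ModuleCat.of S S)) :=
    (Submodule.quotEquivOfEq _ _ hker'.symm).trans (t.quotKerEquivOfSurjective fun s => by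
      obtain ⟨q, rfl⟩ := hg s
      exact ⟨q, ht q⟩)
  have h₁ : HasProjModel ((toD Q).obj X) (0 + rs.length) :=
    (hasProjModel_quotient_ofList hasProjModel_self rs hrs).of_iso
      ((toD Q).mapIso ((CochainComplex.singleFunctor (ModuleCat.{u} Q) 0).mapIso E.toModuleIso))
  obtain ⟨P, hP, hP', ⟨e'⟩, hPK, h⟩ := exists_model_self_supE (A := S)
  obtain ⟨p, hp⟩ := exists_quasiIso_of_iso hP hP' e'
  have hfin : Module.Finite S (ModuleCat.of S S) := inferInstanceAs (Module.Finite S S)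
  have hX := isPerfectComplex_single (ModuleCat.of S S)
    ((IsProjective.iff_projective (R := S) (P := S)).1 inferInstance) hfin 0
  have hpd : pd X = pd ((resC g).obj (moduleComplex (R := S) S)) :=
    le_antisymm (pd_le_of_iso e.symm) (pd_le_of_iso e)
  change pd X = _
  obtain ⟨-, h₂⟩ | ⟨m, h₂, h₃⟩ := pd_restrictScalars hg hrs hker hP hP' p hp
    ⟨0, inferInstance⟩ (fun i => finite_homology _ i (hX.finite i))
    (Y := K) ⟨0, inferInstance⟩ ⟨0, (DerivedCategory.isGE_Q_obj_iff K 0).2 inferInstance⟩ hPK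
    (h₁.of_iso ((toD Q).mapIso e))
  · rw [h] at h₂
    simp at h₂
  · rw [hpd, h₂]
    rw [h, supE_moduleComplex_residueField, zero_add, zero_add] at h₃
    exact h₃

end QuasiDeformation

end

end CIDepth

/-! ### The depth formula for a single quasi-deformation -/

namespace CIDepth
noncomputable section

open HomologicalComplex CochainComplex RingTheory.Sequence

section Main

variable {R : Type u} [CommRing R] [IsNoetherianRing R] [IsLocalRing R]
  {X Y : CochainComplex (ModuleCat.{u} R) ℤ}

omit [IsNoetherianRing R] [IsLocalRing R] in
lemma projective_extendScalars {S : Type u} [CommRing S] (f : R →+* S) {M : ModuleCat.{u} R}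
    (hM : Projective M) : Projective ((ModuleCat.extendScalars f).obj M) :=
  (ModuleCat.extendRestrictScalarsAdj f).map_projective M hM

omit [IsNoetherianRing R] [IsLocalRing R] in
lemma finite_extendScalars {S : Type u} [CommRing S] (f : R →+* S) (M : ModuleCat.{u} R)
    [Module.Finite R M] : Module.Finite S ((ModuleCat.extendScalars f).obj M) := by
  let := f.toAlgebra
  exact Module.Finite.equiv (extendScalarsEquiv f M).symm

/-- The comparison of depths given by a single quasi-deformation. -/
lemma pd_baseChange (hX : HomologicallyFinite X) (hY : HomologicallyFinite Y)
    (hXY : ∃ n, ((toD R).obj (derivedTensor X hX.boundedBelow Y)).IsGE n) (D : QuasiDeformation R)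
    (hD : pd (D.baseChange X) < ⊤) :
    (pd (D.baseChange X) - pd D.ringComplex = ⊥ ∧
      supE ((toD R).obj (derivedTensor X hX.boundedBelow Y)) = ⊥) ∨
    ∃ m : ℤ, pd (D.baseChange X) - pd D.ringComplex = ((m : ℝ) : EReal) ∧
      supE ((toD R).obj (derivedTensor X hX.boundedBelow Y)) =
        supE ((toD R).obj Y) + ((m : ℝ) : EReal) := by
  have := D.isLocalHom
  have := D.isLocalHomQ
  have hflat := ModuleCat.preservesFiniteLimits_extendScalars_of_flat D.flat
  obtain ⟨rs, hrs, hker⟩ := D.ker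
  have hring : pd D.ringComplex = ((rs.length : ℝ) : EReal) :=
    pd_restrictScalars_self D.surjective hrs.toIsWeaklyRegular hker
  obtain ⟨e, he⟩ := exists_supE_extendScalars D.f D.flat
  let P := projRes X hX.boundedBelow
  have hπ := P.quasiIso
  obtain ⟨N, hN⟩ := hY.boundedBelow
  obtain ⟨a, ha⟩ := hY.boundedAbove
  -- The results above need a complex that is bounded above as a complex, not merely in homology.
  let Y₁ := Y.truncLE N
  have e₁ : (toD R).obj Y₁ ≅ (toD R).obj Y :=
    @asIso _ _ _ _ ((toD R).map (Y.ιTruncLE N)) inferInstance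
  obtain ⟨e₂⟩ := nonempty_iso_tensL P.P P.bounded (fun i => flat_of_projective (P.projective i))
    (Y.ιTruncLE N) inferInstance
  have hY₁ : ∃ n, ((toD R).obj Y₁).IsGE n :=
    exists_isGE_of_iso e₁.symm ⟨a, (DerivedCategory.isGE_Q_obj_iff _ _).2 ha⟩
  have hPY₁ := exists_isGE_of_iso e₂.symm hXY
  obtain ⟨e₃⟩ := nonempty_extendScalars_tensorObj_iso D.f P.P Y₁
  have h₁ := he Y₁ hY₁
  -- The same `e` as for `Y₁`, so it cancels in the final comparison.
  have h₂ := he _ hPY₁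
  rw [supE_congr e₁] at h₁
  rw [supE_congr e₂, ← supE_congr ((toD _).mapIso e₃)] at h₂
  have hLE {K : CochainComplex (ModuleCat.{u} R) ℤ} (h : ∃ n, K.IsStrictlyLE n) :
      ∃ n, ((extC D.f).obj K).IsStrictlyLE n := by
    obtain ⟨n, hn⟩ := h
    refine ⟨n, ?_⟩
    rw [isStrictlyLE_iff] at hn ⊢
    exact fun i hi => (ModuleCat.extendScalars D.f).map_isZero (hn i hi)
  obtain ⟨n, hn⟩ := exists_hasProjModel_of_pd_lt_top hD
  have hpres : (ModuleCat.extendScalars D.f).PreservesHomology := inferInstance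
  have key := pd_restrictScalars D.surjective hrs.toIsWeaklyRegular hker (hLE P.bounded)
    (fun i => projective_extendScalars D.f (P.projective i)) ((extC D.f).map P.π) inferInstance
    (X := (extC D.f).obj X) (Y := (extC D.f).obj Y₁) ?_ (fun i => ?_) (hLE ⟨N, inferInstance⟩) ?_ ?_ hn
  · change (pd (D.baseChange X) = ⊥ ∧ _) ∨ (∃ m : ℤ, pd (D.baseChange X) = _ ∧ _) at key
    rw [hring]
    obtain ⟨h₃, h₄⟩ | ⟨m, h₃, h₄⟩ := key
    · refine Or.inl ⟨by rw [h₃, EReal.bot_sub], ?_⟩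
      rw [h₄, EReal.bot_add] at h₂
      exact h₂.symm
    · refine Or.inr ⟨m - rs.length, ?_, ?_⟩
      · rw [h₃]
        push_cast
        rfl
      · refine ereal_add_coe_cancel (rs.length : ℝ) ?_
        have h₅ : (((m - rs.length : ℤ) : ℝ) : EReal) + ((rs.length : ℝ) : EReal) = (m : ℝ) := by
          rw [← EReal.coe_add]
          exact congrArg _ (by push_cast; ring)
        rw [add_assoc, h₅, ← h₁, add_right_comm, h₄, ← add_right_comm, h₂]
        rfl
  · obtain ⟨k, hk⟩ := hX.boundedBelow
    refine ⟨k, (isLE_iff _ _).2 fun i hi => ?_⟩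
    rw [exactAt_iff_isZero_homology]
    exact (mapHomologyIso (ModuleCat.extendScalars D.f) X i).isZero_iff.2
      ((ModuleCat.extendScalars D.f).map_isZero (X.isZero_of_isLE k i hi))
  · have := hX.finite i
    have h := finite_extendScalars D.f (X.homology i)
    exact Module.Finite.equiv (mapHomologyIso (ModuleCat.extendScalars D.f) X i).symm.toLinearEquiv
  · obtain ⟨k, hk⟩ := hY₁
    exact ⟨k, isGE_extendScalars D.f D.flat hk⟩
  · obtain ⟨k, hk⟩ := hPY₁
    exact exists_isGE_of_iso ((toD _).mapIso e₃.symm) ⟨k, isGE_extendScalars D.f D.flat hk⟩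

omit [IsNoetherianRing R] [IsLocalRing R] in
lemma pd_ringComplex (D : QuasiDeformation R) :
    ∃ c : ℕ, pd D.ringComplex = ((c : ℝ) : EReal) := by
  obtain ⟨rs, hrs, hker⟩ := D.ker
  exact ⟨_, pd_restrictScalars_self D.surjective hrs.toIsWeaklyRegular hker⟩

omit [IsNoetherianRing R] [IsLocalRing R] in
lemma pd_baseChange_lt_top_or (D : QuasiDeformation R) :
    pd (D.baseChange X) < ⊤ ∨ pd (D.baseChange X) - pd D.ringComplex = ⊤ := by
  obtain ⟨c, hc⟩ := pd_ringComplex D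
  by_cases h : pd (D.baseChange X) < ⊤
  · exact Or.inl h
  · rw [not_lt_top_iff] at h
    rw [h, hc]
    exact Or.inr (EReal.top_sub_coe _)

end Main

end

end CIDepth

theorem proposition3p4 {R : Type u} [CommRing R] [IsNoetherianRing R] [IsLocalRing R]
    (X Y : CochainComplex (ModuleCat.{u} R) ℤ)
    (hX : CIDepth.HomologicallyFinite X) (hY : CIDepth.HomologicallyFinite Y)
    (hCI : CIDepth.ciDim X < ⊤)
    (hsup : CIDepth.supH (CIDepth.derivedTensor X hX.boundedBelow Y) < ⊤) :
    CIDepth.depth (CIDepth.derivedTensor X hX.boundedBelow Y) =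
      CIDepth.depth Y - CIDepth.ciDim X := by
  open CIDepth in
  have hXY : ∃ n, ((toD R).obj (derivedTensor X hX.boundedBelow Y)).IsGE n := by
    rw [exists_isGE_iff, supD_toD]
    exact hsup
  obtain ⟨a, ha⟩ := hY.boundedAbove
  have hYtop : CIDepth.supE ((CIDepth.toD R).obj Y) < ⊤ :=
    (CIDepth.supE_le_of_isGE (j := -a) ((DerivedCategory.isGE_Q_obj_iff _ _).2
      (by rwa [neg_neg]))).trans_lt (EReal.coe_lt_top _)
  rw [CIDepth.depth_eq, CIDepth.depth_eq]
  obtain ⟨D₀, hD₀⟩ := iInf_lt_iff.1 hCI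
  have hpd₀ := (CIDepth.pd_baseChange_lt_top_or (X := X) D₀).resolve_right hD₀.ne
  obtain ⟨h₁, h₂⟩ | ⟨m, h₁, h₂⟩ := CIDepth.pd_baseChange hX hY hXY D₀ hpd₀
  · have h : CIDepth.ciDim X = ⊥ := eq_bot_iff.2 ((iInf_le _ D₀).trans h₁.le)
    -- Here X ⊗ᴸ Y has depth ⊤. In `EReal` the sum ⊥ + ⊤ is ⊥, so the depth of `Y` must be known to
    -- differ from ⊥, which follows from the bound on its homology.
    rw [h, h₂, sub_eq_add_neg, EReal.neg_bot, EReal.add_top_of_ne_bot]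
    rw [Ne, EReal.neg_eq_bot_iff]
    exact hYtop.ne
  · by_cases hYbot : CIDepth.supE ((CIDepth.toD R).obj Y) = ⊥
    · rw [h₂, hYbot, EReal.bot_add, EReal.neg_bot, sub_eq_add_neg, EReal.top_add_of_ne_bot]
      rw [Ne, EReal.neg_eq_bot_iff]
      exact hCI.ne
    · obtain ⟨y, hy⟩ : ∃ y : ℝ, CIDepth.supE ((CIDepth.toD R).obj Y) = (y : EReal) :=
        ⟨_, (EReal.coe_toReal hYtop.ne hYbot).symm⟩
      have h : CIDepth.ciDim X = ((m : ℝ) : EReal) := by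
        -- Any other quasi-deformation contributes either ⊤ or an integer m' with s(Y) + m' = s(X ⊗ᴸ
        -- Y) = s(Y) + m. Since s(Y) is a real number, m' = m.
        refine le_antisymm ((iInf_le _ D₀).trans h₁.le) (le_iInf fun D => ?_)
        obtain hD | hD := CIDepth.pd_baseChange_lt_top_or (X := X) D
        · obtain ⟨-, h₄⟩ | ⟨m', h₃, h₄⟩ := CIDepth.pd_baseChange hX hY hXY D hD
          · rw [h₂, hy, ← EReal.coe_add] at h₄
            exact absurd h₄ (EReal.coe_ne_bot _)
          · rw [h₂, hy, ← EReal.coe_add, ← EReal.coe_add, EReal.coe_eq_coe_iff,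
              add_right_inj] at h₄
            rw [h₃, h₄]
        · rw [hD]
          exact le_top
      rw [h, h₂, hy, ← EReal.coe_add, ← EReal.coe_neg, ← EReal.coe_neg, ← EReal.coe_sub,
        neg_add']
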